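/- An instance $\mathcal I$ of mRmD consists of finite sets $D$ (demands), $R$ (resource types, linearly ordered) and $L$ (starting locations); for each $r\in R$ a set $S^r\subseteq L$ and numbers $l^r_s\in\mathbb N$ ($s\in S^r$) of units of type $r$ starting at $s$; for each $d\in D$ a nonempty set $M_d\subseteq R$ of requested types, a start time $\tau_d$, a duration $\Delta_d\ge 0$ and a reward $w_d$, all integers; and integer travel times $f_{sd}$, $f_{ij}$ ($s\in L$, $d,i,j\in D$) satisfying the triangle inequality $f_{xk}\le f_{xj}+f_{jk}$ ($x\in L\cup D$, $j,k\in D$). Write $m_r=\sum_{s\in S^r}l^r_s$. A path of type $r$ from $s\in S^r$ is a nonempty sequence $d_1,\dots,d_q$ of distinct demands with $r\in M_{d_i}$ for all $i$, $f_{sd_1}\le\tau_{d_1}$, and $\tau_{d_i}+\Delta_{d_i}+f_{d_id_{i+1}}\le\tau_{d_{i+1}}$ for all $i<q$. A feasible solution consists of, for each $r\in R$ and $s\in S^r$, at most $l^r_s$ paths of type $r$ from $s$ (with repetition allowed), and a set of met demands such that each met demand $d$ lies, for every $r\in M_d$, on one of the chosen paths of type $r$. Its objective value is the sum of $w_d$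 over the met demands, and $OPT(\mathcal I)$ is the maximum objective value. The conflict graph $G$ has as nodes the distinct sets $M_d$, $d\in D$; distinct nodes $u,v$ are adjacent iff $u\cap v\ne\emptyset$. For a node $v$ let $\rho(v)$ be the type in $v$ with the smallest $m_r$ (the smallest such type in case of ties; thus $\rho(v)=\min v$ if types are labelled with $m_1\le m_2\le\cdots$), and let $1R1\bar D^v$ be the single-type instance with the units of type $\rho(v)$ and the demands $\{d: M_d=v\}$, each requesting that single type. Algorithm $\mathcal B$ takes $\mathcal I$ and a proper coloring of $G$ with colors $1,\dots,\chi$ and color classes $S_1,\dots,S_\chi$. It solves $1R1\bar D^v$ to optimality for every node $v$, with value $\mathcal B_v$. Starting from the value $0$, it goes through $i=1,\dots,\chi$ and replaces the current best value by $\sum_{v\in S_i}\mathcal B_v$ whenever the latter is at least as large. It returns the final value $\mathcal B(\mathcal I)$, together with the solution in which, for each node $v$ of the last selected color, the units of every type $r\in v$ follow the paths of the solution found for $1R1\bar D^v$, and the demands met there are met. **Theorem.** Given a $\chi$-coloring of the conflict graph, Algorithm $\mathcal B$ is a $\chi$-approximation algorithm for mRmD instances with the same starting location for every resource (that is, $\bigcup_r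 S^r$ has at most one element). Explicitly, for all such instances and colorings: 1. whichever optimal solutions of the subproblems are used, the returned solution is feasible for $\mathcal I$, its objective value is $\mathcal B(\mathcal I)$, and $OPT(\mathcal I)\le\chi\cdot\mathcal B(\mathcal I)$; 2. Algorithm $\mathcal B$, including the solution of the subproblems, can be carried out in polynomial time: there are a single program and a polynomial $q$ such that on every such input $(\mathcal I,(S_1,\dots,S_\chi))$ the program halts with an output of Algorithm $\mathcal B$ (value and solution) after at most $q(N)$ steps, where $N$ is the size of the input with integers written in binary. (Programs act on integers, pairs and lists and are built from elementary operations by composition, pairing, branching and while-loops; each elementary operation costs the bit size of its argument plus that of its result.) -/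

import Mathlib

/-! ## Instances of the multiple resource type allocation problem -/

/-- An instance of the multi-resource allocation problem with demands `D`, resource types `R`
and starting locations `L`. -/
structure MRMD (D R L : Type) where
  /-- the set of starting locations of each resource type -/
  S : R → Finset L
  /-- the number of units of type `r` starting at `s ∈ S r` (not used when `s ∉ S r`) -/
  l : R → L → ℕ
  /-- the set of resource types requested by a demand -/
  M : D → Finset R
  M_nonempty : ∀ d, (M d).Nonempty
  /-- service start time -/
  τ : D → ℤ
  /-- service duration -/
  Δ : D → ℤ
  /-- reward -/
  w : D → ℤ
  /-- travel time from a starting location to the location of a demand -/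
  fS : L → D → ℤ
  /-- travel time from the location of a demand to the location of a demand -/
  fD : D → D → ℤ

/-- A candidate solution: for each type `r` and starting location `s` the routes (sequences of
served demands) of the units of type `r` that leave `s`, one route per unit in use, together with
the set of demands that are declared met. -/
structure Solution (D R L : Type) where
  paths : R → L → Multiset (List D)
  met : Finset D

namespace MRMD

variable {D R L : Type}

/-- The arc from `i` to `j`: demand `j` can be served immediately after demand `i`. -/
def A (I : MRMD D R L) [DecidableEq R] (i j : D) : Prop :=
  I.τ i + I.Δ i + I.fD i j ≤ I.τ j ∧ (I.M i ∩ I.M j).Nonempty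

/-- The arc from `s` to `d` for type `r`: a unit of type `r` starting at `s` can serve `d` first. -/
def B (I : MRMD D R L) (r : R) (s : L) (d : D) : Prop :=
  I.fS s d ≤ I.τ d ∧ s ∈ I.S r ∧ r ∈ I.M d

/-- A path of the network of resource type `r` that starts at `s` and then visits the demands
of the list `p`, at least one. -/
def IsPath (I : MRMD D R L) [DecidableEq R] (r : R) (s : L) (p : List D) : Prop :=
  (∃ d, p.head? = some d ∧ I.B r s d) ∧ p.IsChain I.A ∧ (∀ d ∈ p, r ∈ I.M d) ∧ p.Nodup

/-- Feasibility: all routes are paths, no more units are used than are available, and every demand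
declared met is visited by a unit of each of its requested types. -/
def Feasible (I : MRMD D R L) [DecidableEq R] (σ : Solution D R L) : Prop :=
  (∀ r s, ∀ p ∈ σ.paths r s, I.IsPath r s p) ∧
  (∀ r, ∀ s ∈ I.S r, (σ.paths r s).card ≤ I.l r s) ∧
  (∀ d ∈ σ.met, ∀ r ∈ I.M d, ∃ s, ∃ p ∈ σ.paths r s, d ∈ p)

/-- The objective value: total reward of the met demands. -/
def reward (I : MRMD D R L) (σ : Solution D R L) : ℤ := ∑ d ∈ σ.met, I.w d

/-- The optimal objective value. -/
noncomputable def opt (I : MRMD D R L) [DecidableEq R] : ℤ :=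
  sSup {z | ∃ σ, I.Feasible σ ∧ I.reward σ = z}

/-- The supremum in `opt` is attained. -/
theorem isGreatest_opt (I : MRMD D R L) [DecidableEq R] [Fintype D] :
    IsGreatest {z | ∃ σ, I.Feasible σ ∧ I.reward σ = z} I.opt := by
  have hne : ({z | ∃ σ, I.Feasible σ ∧ I.reward σ = z}).Nonempty :=
    ⟨0, ⟨fun _ _ => 0, ∅⟩, ⟨by simp, by simp, by simp⟩, by simp [reward]⟩
  have hbdd : BddAbove {z | ∃ σ, I.Feasible σ ∧ I.reward σ = z} := by
    refine ⟨∑ d, |I.w d|, ?_⟩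
    rintro z ⟨σ, -, rfl⟩
    calc I.reward σ ≤ ∑ d ∈ σ.met, |I.w d| := Finset.sum_le_sum fun d _ => le_abs_self _
      _ ≤ ∑ d, |I.w d| :=
        Finset.sum_le_sum_of_subset_of_nonneg (Finset.subset_univ _) fun d _ _ => abs_nonneg _
  exact ⟨Int.csSup_mem hne hbdd, fun z hz => le_csSup hbdd hz⟩

/-- An optimal (exact) solution of the instance. -/
def IsOptimal (I : MRMD D R L) [DecidableEq R] (σ : Solution D R L) : Prop :=
  I.Feasible σ ∧ I.reward σ = I.opt

/-- The number `m_r` of units of type `r`. -/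
def numUnits (I : MRMD D R L) (r : R) : ℕ := ∑ s ∈ I.S r, I.l r s

/-- All resources share one starting location. -/
def SameStart (I : MRMD D R L) : Prop :=
  ∀ r r' s s', s ∈ I.S r → s' ∈ I.S r' → s = s'

/-- Travel times satisfy the triangle inequality (for all journeys that end at a demand). -/
def TriangleIneq (I : MRMD D R L) : Prop :=
  (∀ i j k, I.fD i k ≤ I.fD i j + I.fD j k) ∧ (∀ s j k, I.fS s k ≤ I.fS s j + I.fD j k)

/-! ## The conflict graph and the single-type subproblems -/

variable [Fintype D] [DecidableEq R]

/-- The nodes of the conflict graph: the distinct request sets. -/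
abbrev Node (I : MRMD D R L) : Type := {v : Finset R // v ∈ Finset.univ.image I.M}

/-- The request set of a demand, as a node. -/
def nodeOf (I : MRMD D R L) (d : D) : I.Node :=
  ⟨I.M d, Finset.mem_image_of_mem I.M (Finset.mem_univ d)⟩

/-- Distinct request sets are adjacent when they intersect. -/
def conflictGraph (I : MRMD D R L) : SimpleGraph I.Node where
  Adj u v := u ≠ v ∧ (u.1 ∩ v.1).Nonempty
  symm := ⟨fun u v h => ⟨h.1.symm, by rw [Finset.inter_comm]; exact h.2⟩⟩
  loopless := ⟨fun _ h => h.1 rfl⟩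

/-- The members of `v` with the fewest units. -/
def scarcest (I : MRMD D R L) (v : I.Node) : Finset R :=
  v.1.filter fun r => ∀ r' ∈ v.1, I.numUnits r ≤ I.numUnits r'

theorem scarcest_nonempty (I : MRMD D R L) (v : I.Node) : (I.scarcest v).Nonempty := by
  obtain ⟨d, -, hd⟩ := Finset.mem_image.1 v.2
  obtain ⟨r, hr, hmin⟩ := Finset.exists_min_image v.1 I.numUnits (hd ▸ I.M_nonempty d)
  exact ⟨r, Finset.mem_filter.2 ⟨hr, hmin⟩⟩

/-- The resource type that represents the node `v`: the member of `v` with the fewest units, the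
one of smallest index among several. When the types are labelled in nondecreasing order of their
numbers of units, this is the smallest index in `v`. -/
def rep (I : MRMD D R L) [LinearOrder R] (v : I.Node) : R :=
  (I.scarcest v).min' (I.scarcest_nonempty v)

/-- The single-type subproblem of the node `v`: the demands with request set `v`, each of which
now requests the only resource type, whose units are those of type `rep v`. -/
def sub (I : MRMD D R L) [LinearOrder R] (v : I.Node) : MRMD {d : D // I.M d = v.1} Unit L where
  S _ := I.S (I.rep v)
  l _ s := I.l (I.rep v) s
  M _ := {()}
  M_nonempty _ := Finset.singleton_nonempty ()
  τ d := I.τ d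
  Δ d := I.Δ d
  w d := I.w d
  fS s d := I.fS s d
  fD d d' := I.fD d d'

/-! ## Algorithm B -/

/-- A choice of a solution of the subproblem of each node. -/
abbrev SubSolutions (I : MRMD D R L) [LinearOrder R] : Type :=
  (v : I.Node) → Solution {d : D // I.M d = v.1} Unit L

variable {χ : ℕ}

/-- The total value of the subproblems of the nodes of colour `i`. -/
def colorValue (I : MRMD D R L) [LinearOrder R] (c : I.conflictGraph.Coloring (Fin χ))
    (σs : I.SubSolutions) (i : Fin χ) : ℤ :=
  ∑ v ∈ Finset.univ.filter (fun v => c v = i), (I.sub v).reward (σs v)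

/-- The loop over the colours: it keeps the best value found so far, starting from `0`, and the
colour at which it was found, and it is updated when the value of a colour is at least as good. -/
def bestColor (I : MRMD D R L) [LinearOrder R] (c : I.conflictGraph.Coloring (Fin χ))
    (σs : I.SubSolutions) : ℤ × Option (Fin χ) :=
  (List.finRange χ).foldl
    (fun best i => if best.1 ≤ I.colorValue c σs i then (I.colorValue c σs i, some i) else best)
    (0, none)

/-- The solution built from the colour `i`: for each node `v` of colour `i`, the units of every
type in `v` follow the routes of the solution of the subproblem of `v`. -/
def combine (I : MRMD D R L) [LinearOrder R] [DecidableEq D]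
    (c : I.conflictGraph.Coloring (Fin χ)) (σs : I.SubSolutions) (i : Fin χ) :
    Solution D R L where
  paths r s := ∑ v ∈ Finset.univ.filter (fun v : I.Node => c v = i ∧ r ∈ v.1),
    ((σs v).paths () s).map (List.map Subtype.val)
  met := (Finset.univ.filter fun v => c v = i).biUnion
    fun v => (σs v).met.map (Function.Embedding.subtype _)

/-- `b` is the value and `σ` the solution returned by some run of Algorithm B with the colouring
`c`: the subproblems are solved to optimality (any optimal solutions may be found), and the
solution is built from the colour selected by the loop. -/
def IsOutputB (I : MRMD D R L) [LinearOrder R] [DecidableEq D]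
    (c : I.conflictGraph.Coloring (Fin χ)) (b : ℤ) (σ : Solution D R L) : Prop :=
  ∃ σs : I.SubSolutions, (∀ v, (I.sub v).IsOptimal (σs v)) ∧
    b = (I.bestColor c σs).1 ∧
    σ = match (I.bestColor c σs).2 with
      | none => ⟨fun _ _ => 0, ∅⟩
      | some i => I.combine c σs i

end MRMD

/-! ## A programming language with a step count

Programs act on integers, pairs and lists. Every elementary operation costs the number of bits of
its argument plus that of its result, so that running times agree with those of Turing machines up
to polynomials. -/

/-- Data types. -/
inductive Ty : Type
  | int : Ty
  | prod : Ty → Ty → Ty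
  | list : Ty → Ty

/-- The values of a data type. -/
@[reducible] def Ty.Val : Ty → Type
  | .int => ℤ
  | .prod a b => a.Val × b.Val
  | .list a => List a.Val

/-- The size of a value: integers are measured by their binary length. -/
def Ty.size : (a : Ty) → a.Val → ℕ
  | .int, z => Nat.size (Int.natAbs z) + 1
  | .prod a b, x => a.size x.1 + b.size x.2 + 1
  | .list a, x => (List.map a.size x).sum + List.length x + 1

/-- Elementary operations. -/
inductive Op : Ty → Ty → Type
  | id (a : Ty) : Op a a
  | fst (a b : Ty) : Op (.prod a b) a
  | snd (a b : Ty) : Op (.prod a b) b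
  | const (a : Ty) (z : ℤ) : Op a .int
  | add : Op (.prod .int .int) .int
  | sub : Op (.prod .int .int) .int
  | mul : Op (.prod .int .int) .int
  | nil (a b : Ty) : Op a (.list b)
  | cons (a : Ty) : Op (.prod a (.list a)) (.list a)
  | head (a : Ty) : Op (.prod a (.list a)) a
  | tail (a : Ty) : Op (.list a) (.list a)
  | length (a : Ty) : Op (.list a) .int

/-- The result of an elementary operation; `head` returns its first argument on the empty list. -/
def Op.eval : {a b : Ty} → Op a b → a.Val → b.Val
  | _, _, .id _, x => x
  | _, _, .fst _ _, x => x.1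
  | _, _, .snd _ _, x => x.2
  | _, _, .const _ z, _ => z
  | _, _, .add, x => (x.1 + x.2 : ℤ)
  | _, _, .sub, x => (x.1 - x.2 : ℤ)
  | _, _, .mul, x => (x.1 * x.2 : ℤ)
  | _, _, .nil _ _, _ => []
  | _, _, .cons _, x => x.1 :: x.2
  | _, _, .head _, x => List.headD x.2 x.1
  | _, _, .tail _, x => List.tail x
  | _, _, .length _, x => ((List.length x : ℕ) : ℤ)

/-- Programs: elementary operations, composition (`comp p q` runs `p`, then `q`), pairing,
branching on the sign of an integer, and while-loops. -/
inductive Prog : Ty → Ty → Type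
  | op {a b : Ty} (o : Op a b) : Prog a b
  | comp {a b c : Ty} (p : Prog a b) (q : Prog b c) : Prog a c
  | pair {a b c : Ty} (p : Prog a b) (q : Prog a c) : Prog a (.prod b c)
  | branch {a b : Ty} (test : Prog a .int) (p q : Prog a b) : Prog a b
  | loop {a : Ty} (test : Prog a .int) (body : Prog a a) : Prog a a

/-- `Runs p x y t`: on input `x` the program `p` halts with output `y` after `t` steps. -/
inductive Runs : {a b : Ty} → Prog a b → a.Val → b.Val → ℕ → Prop
  | op {a b : Ty} (o : Op a b) (x : a.Val) :
      Runs (.op o) x (o.eval x) (a.size x + b.size (o.eval x))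
  | comp {a b c : Ty} {p : Prog a b} {q : Prog b c} {x : a.Val} {y : b.Val} {z : c.Val}
      {s t : ℕ} (hp : Runs p x y s) (hq : Runs q y z t) : Runs (.comp p q) x z (s + t + 1)
  | pair {a b c : Ty} {p : Prog a b} {q : Prog a c} {x : a.Val} {y : b.Val} {z : c.Val}
      {s t : ℕ} (hp : Runs p x y s) (hq : Runs q x z t) :
      Runs (.pair p q) x (y, z) (s + t + 1)
  | branch_pos {a b : Ty} {test : Prog a .int} {p q : Prog a b} {x : a.Val} {n : ℤ} {y : b.Val}
      {s t : ℕ} (hc : Runs test x n s) (hn : 0 < n) (hp : Runs p x y t) :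
      Runs (.branch test p q) x y (s + t + 1)
  | branch_neg {a b : Ty} {test : Prog a .int} {p q : Prog a b} {x : a.Val} {n : ℤ} {y : b.Val}
      {s t : ℕ} (hc : Runs test x n s) (hn : n ≤ 0) (hq : Runs q x y t) :
      Runs (.branch test p q) x y (s + t + 1)
  | loop_stop {a : Ty} {test : Prog a .int} {body : Prog a a} {x : a.Val} {n : ℤ} {s : ℕ}
      (hc : Runs test x n s) (hn : n ≤ 0) : Runs (.loop test body) x x (s + 1)
  | loop_step {a : Ty} {test : Prog a .int} {body : Prog a a} {x y z : a.Val} {n : ℤ}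
      {s t u : ℕ} (hc : Runs test x n s) (hn : 0 < n) (hb : Runs body x y t)
      (hl : Runs (.loop test body) y z u) : Runs (.loop test body) x z (s + t + u + 1)

/-! ## Encoding of instances, colourings and solutions -/

/-- The data type of instances: for each type and starting location the membership in `S r` and
the number of units; for each demand its start time, duration, reward and request set; the two
tables of travel times. -/
abbrev instTy : Ty :=
  .prod (.list (.list (.prod .int .int)))
    (.prod (.list (.prod (.prod .int .int) (.prod .int (.list .int))))
      (.prod (.list (.list .int)) (.list (.list .int))))

/-- The data type of inputs of Algorithm B: an instance and the list of colour classes. -/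
abbrev inTy : Ty := .prod instTy (.list (.list .int))

/-- The data type of outputs of Algorithm B: the value, the routes of each type and starting
location, and the list of met demands. -/
abbrev outTy : Ty :=
  .prod .int (.prod (.list (.list (.list (.list .int)))) (.list .int))

/-- A truth value as an integer. -/
def encBool (p : Prop) [Decidable p] : ℤ := if p then 1 else 0

/-- The encoding of an instance. -/
def encInst {n k m : ℕ} (I : MRMD (Fin n) (Fin k) (Fin m)) : instTy.Val :=
  (List.ofFn fun r => List.ofFn fun s => (encBool (s ∈ I.S r), (I.l r s : ℤ)),
   List.ofFn fun d => ((I.τ d, I.Δ d), (I.w d, List.ofFn fun r => encBool (r ∈ I.M d))),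
   List.ofFn fun s => List.ofFn fun d => I.fS s d,
   List.ofFn fun i => List.ofFn fun j => I.fD i j)

/-- The encoding of an instance with a colouring of its conflict graph; the class of a colour is
given by the demands whose request sets have that colour. -/
def encIn {n k m χ : ℕ} (I : MRMD (Fin n) (Fin k) (Fin m))
    (c : I.conflictGraph.Coloring (Fin χ)) : inTy.Val :=
  (encInst I, List.ofFn fun i => List.ofFn fun d => encBool (c (I.nodeOf d) = i))

/-- The encoding of a value, lists of routes, and a list of met demands. -/
def encOut {n k m : ℕ} (b : ℤ) (P : Fin k → Fin m → List (List (Fin n))) (Y : List (Fin n)) :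
    outTy.Val :=
  (b, List.ofFn fun r => List.ofFn fun s => (P r s).map (List.map fun d => (d.val : ℤ)),
   Y.map fun d => (d.val : ℤ))

/-- The solution given by lists of routes and a list of met demands. -/
def listSolution {n k m : ℕ} (P : Fin k → Fin m → List (List (Fin n))) (Y : List (Fin n)) :
    Solution (Fin n) (Fin k) (Fin m) where
  paths r s := (P r s : Multiset (List (Fin n)))
  met := Y.toFinset

/-! ## Polynomial-time functions -/

/-! Approximation. Fix a feasible solution and a node `v`. Every met demand with request set `v` is
visited by a unit of type `rep v`. Deleting all other demands from the routes of that type leaves a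
feasible solution of the subproblem of `v`: by the triangle inequality and nonnegative durations a
unit may skip demands (`feasible_restrict`). Request sets partition the demands, so OPT is at most
the sum of the subproblem optima. That sum equals the sum of the χ colour values, each of which is
at most the value returned (`opt_le`). Feasibility of the returned solution has two reasons. Nodes
of one colour have disjoint request sets, so each type serves at most one of them (`eq_of_color`).
With a single starting location, every type in `v` has at that location at least as many units as
the scarcest type `rep v`, so all types in `v` can copy the routes found for it
(`SameStart.rep_le`).

Running time. A subproblem asks for at most `m` chains of a strict order that cover elements of
maximum weight. It is an assignment problem with a `2n × 2n` cost matrix. Columns are elements as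
predecessors, then `n` units; rows are elements as successors, then `n` sinks. A diagonal element
entry means "not covered" and costs the weight of the element, an allowed succession costs 0, and a
forbidden one costs more than the total weight. Since `m` may be exponential in the input size, only
`n` units are modelled; disjoint nonempty chains never need more. The assignment problem is solved
by a Hungarian method that keeps a full permutation at every moment (`Hungarian.sum_solve_le`). Its
dual values may grow by a constant factor at each step, which keeps their bit length polynomial
(`dualBdd_iterate`). Programs are not written out. `PolyTime` is shown to be closed under the usual
list operations, and `fun_prop` assembles the program for the whole algorithm from its functional
definition (`polyTime_output`). What remains is that this function computes an output of Algorithm B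
(`isOutputB_best`, `enc_output`). -/

/-- Types whose elements are represented as values of a data type of the programming language. -/
class Codable (α : Type) where
  /-- the data type -/
  ty : Ty
  /-- the representation -/
  enc : α → ty.Val

namespace Codable

instance : Codable ℤ := ⟨.int, fun z => z⟩
instance : Codable ℕ := ⟨.int, fun n => (n : ℤ)⟩
instance : Codable Bool := ⟨.int, fun b => if b = true then (1 : ℤ) else (0 : ℤ)⟩
instance {α β : Type} [Codable α] [Codable β] : Codable (α × β) :=
  ⟨.prod (ty α) (ty β), fun x => (enc x.1, enc x.2)⟩
instance {α : Type} [Codable α] : Codable (List α) := ⟨.list (ty α), fun l => l.map enc⟩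

/-- The size of the representation. -/
def size {α : Type} [Codable α] (x : α) : ℕ := (ty α).size (enc x)

end Codable

open Codable (size)

theorem Polynomial.eval_mono_nat (q : Polynomial ℕ) {a b : ℕ} (h : a ≤ b) :
    q.eval a ≤ q.eval b := by
  rw [Polynomial.eval_eq_sum, Polynomial.eval_eq_sum]
  exact Finset.sum_le_sum fun i _ => Nat.mul_le_mul_left _ (Nat.pow_le_pow_left h i)

/-- Quantities bounded by a polynomial in the size of the representation. -/
def PolyBdd {α : Type} [Codable α] (g : α → ℕ) : Prop :=
  ∃ q : Polynomial ℕ, ∀ x, g x ≤ q.eval (size x)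

namespace PolyBdd

variable {α β : Type} [Codable α] [Codable β]

theorem mono {f g : α → ℕ} (hg : PolyBdd g) (h : ∀ x, f x ≤ g x) : PolyBdd f :=
  let ⟨q, hq⟩ := hg
  ⟨q, fun x => (h x).trans (hq x)⟩

theorem const (c : ℕ) : PolyBdd fun _ : α => c := ⟨Polynomial.C c, fun x => by simp⟩

theorem size : PolyBdd fun x : α => Codable.size x := ⟨Polynomial.X, fun x => by simp⟩

theorem add {f g : α → ℕ} (hf : PolyBdd f) (hg : PolyBdd g) : PolyBdd fun x => f x + g x := by
  obtain ⟨p, hp⟩ := hf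
  obtain ⟨q, hq⟩ := hg
  exact ⟨p + q, fun x => by simpa using Nat.add_le_add (hp x) (hq x)⟩

theorem mul {f g : α → ℕ} (hf : PolyBdd f) (hg : PolyBdd g) : PolyBdd fun x => f x * g x := by
  obtain ⟨p, hp⟩ := hf
  obtain ⟨q, hq⟩ := hg
  exact ⟨p * q, fun x => by simpa using Nat.mul_le_mul (hp x) (hq x)⟩

theorem comp {g : β → ℕ} {f : α → β} (hg : PolyBdd g) (hf : PolyBdd fun x => Codable.size (f x)) :
    PolyBdd fun x => g (f x) := by
  obtain ⟨p, hp⟩ := hf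
  obtain ⟨q, hq⟩ := hg
  exact ⟨q.comp p, fun x => by
    rw [Polynomial.eval_comp]; exact (hq _).trans (q.eval_mono_nat (hp x))⟩

theorem eval (q : Polynomial ℕ) {g : α → ℕ} (hg : PolyBdd g) : PolyBdd fun x => q.eval (g x) := by
  obtain ⟨p, hp⟩ := hg
  exact ⟨q.comp p, fun x => by rw [Polynomial.eval_comp]; exact q.eval_mono_nat (hp x)⟩

end PolyBdd

/-- Every elementary operation is charged for its result, so a time bound is also a bound on the
output size. This is what makes polynomial time closed under composition. -/
theorem Runs.size_le {a b : Ty} {p : Prog a b} {x : a.Val} {y : b.Val} {t : ℕ}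
    (h : Runs p x y t) : a.size x ≤ t ∧ b.size y ≤ t := by
  induction h with
  | op => exact ⟨Nat.le_add_right _ _, Nat.le_add_left _ _⟩
  | comp _ _ h1 h2 => omega
  | pair _ _ h1 h2 => simp only [Ty.size] at *; omega
  | branch_pos _ _ _ h1 h2 => omega
  | branch_neg _ _ _ h1 h2 => omega
  | loop_stop _ _ h => omega
  | loop_step _ _ _ _ h1 h2 h3 => omega

/-- Functions computed by a program in polynomial time. -/
@[fun_prop]
def PolyTime {α β : Type} [Codable α] [Codable β] (f : α → β) : Prop :=
  ∃ (p : Prog (Codable.ty α) (Codable.ty β)) (T : α → ℕ), PolyBdd T ∧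
    ∀ x, ∃ t ≤ T x, Runs p (Codable.enc x) (Codable.enc (f x)) t

namespace PolyTime

variable {α β γ δ σ : Type} [Codable α] [Codable β] [Codable γ] [Codable δ] [Codable σ]

theorem polyBdd_size {f : α → β} (hf : PolyTime f) : PolyBdd fun x => size (f x) := by
  obtain ⟨p, T, hT, h⟩ := hf
  refine hT.mono fun x => ?_
  obtain ⟨t, ht, hr⟩ := h x
  exact hr.size_le.2.trans ht

theorem bdd_comp {g : β → ℕ} {f : α → β} (hg : PolyBdd g) (hf : PolyTime f) :
    PolyBdd fun x => g (f x) := hg.comp hf.polyBdd_size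

theorem of_op {f : α → β} (o : Op (Codable.ty α) (Codable.ty β))
    (h : ∀ x, o.eval (Codable.enc x) = Codable.enc (f x))
    (hs : PolyBdd fun x => size (f x)) : PolyTime f :=
  ⟨.op o, fun x => size x + size (f x), PolyBdd.size.add hs, fun x =>
    ⟨_, le_rfl, by have := Runs.op o (Codable.enc x); rw [h] at this; exact this⟩⟩

@[fun_prop]
theorem id : PolyTime fun x : α => x := of_op (.id _) (fun _ => rfl) PolyBdd.size

@[fun_prop]
theorem comp {g : β → γ} {f : α → β} (hg : PolyTime g) (hf : PolyTime f) :
    PolyTime fun x => g (f x) := by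
  have hf' := hf.polyBdd_size
  obtain ⟨p, S, hS, hp⟩ := hf
  obtain ⟨q, T, hT, hq⟩ := hg
  refine ⟨.comp p q, fun x => S x + T (f x) + 1, (hS.add (hT.comp hf')).add (.const 1), fun x => ?_⟩
  obtain ⟨s, hs, h1⟩ := hp x
  obtain ⟨t, ht, h2⟩ := hq (f x)
  exact ⟨_, by dsimp only; omega, h1.comp h2⟩

@[fun_prop]
theorem prodMk {f : α → β} {g : α → γ} (hf : PolyTime f) (hg : PolyTime g) :
    PolyTime fun x => (f x, g x) := by
  obtain ⟨p, S, hS, hp⟩ := hf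
  obtain ⟨q, T, hT, hq⟩ := hg
  refine ⟨.pair p q, fun x => S x + T x + 1, (hS.add hT).add (.const 1), fun x => ?_⟩
  obtain ⟨s, hs, h1⟩ := hp x
  obtain ⟨t, ht, h2⟩ := hq x
  exact ⟨_, by dsimp only; omega, h1.pair h2⟩

@[fun_prop]
theorem fst {f : α → β × γ} (hf : PolyTime f) : PolyTime fun x => (f x).1 :=
  comp (of_op (f := Prod.fst) (.fst _ _) (fun _ => rfl)
    (PolyBdd.size.mono fun x => by simp only [size, Codable.ty, Codable.enc, Ty.size]; omega)) hf

@[fun_prop]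
theorem snd {f : α → β × γ} (hf : PolyTime f) : PolyTime fun x => (f x).2 :=
  comp (of_op (f := Prod.snd) (.snd _ _) (fun _ => rfl)
    (PolyBdd.size.mono fun x => by simp only [size, Codable.ty, Codable.enc, Ty.size]; omega)) hf

end PolyTime

/-! ### Constants, branching and bounded loops -/

/-- A program with a given constant value. -/
def constProg (a : Ty) : (b : Ty) → b.Val → Prog a b
  | .int, z => .op (.const a z)
  | .prod b c, x => .pair (constProg a b x.1) (constProg a c x.2)
  | .list b, l =>
    List.rec (.op (.nil a b)) (fun y _ p => .comp (.pair (constProg a b y) p) (.op (.cons b))) l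

/-- The value is built from constant and `nil` operations, each of which reads the whole input once.
Hence the cost is linear in the input size, with a coefficient that depends on `y` only. -/
theorem exists_runs_constProg (a b : Ty) (y : b.Val) :
    ∃ C, ∀ x, ∃ t ≤ a.size x * C + C, Runs (constProg a b y) x y t := by
  induction b with
  | int => exact ⟨1 + Ty.int.size y, fun x => ⟨_, by
    have := Nat.zero_le (a.size x * Ty.int.size y)
    simp only [Op.eval]; nlinarith, Runs.op (.const a y) x⟩⟩
  | prod b c hb hc =>
    obtain ⟨B, hB⟩ := hb y.1
    obtain ⟨C, hC⟩ := hc y.2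
    refine ⟨B + C + 1, fun x => ?_⟩
    obtain ⟨s, hs, h1⟩ := hB x
    obtain ⟨t, ht, h2⟩ := hC x
    exact ⟨_, by nlinarith, h1.pair h2⟩
  | list b hb =>
    change List b.Val at y
    induction y with
    | nil => exact ⟨2, fun x => ⟨_, by simp only [Op.eval, Ty.size]; simp; omega,
        Runs.op (.nil a b) x⟩⟩
    | cons z l ih =>
      obtain ⟨B, hB⟩ := hb z
      obtain ⟨C, hC⟩ := ih
      refine ⟨B + C + (b.size z + 1 + 2 * (Ty.list b).size l + b.size z + 10), fun x => ?_⟩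
      obtain ⟨s, hs, h1⟩ := hB x
      obtain ⟨t, ht, h2⟩ := hC x
      refine ⟨_, ?_, (h1.pair h2).comp (Runs.op (.cons b) _)⟩
      simp only [Op.eval, Ty.size, List.map_cons, List.sum_cons, List.length_cons]
      have := Nat.zero_le (a.size x *
        (b.size z + 1 + 2 * ((List.map b.size l).sum + l.length + 1) + b.size z + 10))
      nlinarith

namespace PolyTime

variable {α β γ δ σ : Type} [Codable α] [Codable β] [Codable γ] [Codable δ] [Codable σ]

@[fun_prop]
theorem const (c : β) : PolyTime fun _ : α => c := by
  obtain ⟨C, hC⟩ := exists_runs_constProg (Codable.ty α) (Codable.ty β) (Codable.enc c)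
  exact ⟨_, fun x => size x * C + C, (PolyBdd.size.mul (.const C)).add (.const C),
    fun x => hC (Codable.enc x)⟩

/-- Branching on the sign of an integer. -/
theorem ite_pos {c : α → ℤ} {f g : α → β} (hc : PolyTime c) (hf : PolyTime f) (hg : PolyTime g) :
    PolyTime fun x => if 0 < c x then f x else g x := by
  obtain ⟨r, R, hR, hr⟩ := hc
  obtain ⟨p, S, hS, hp⟩ := hf
  obtain ⟨q, T, hT, hq⟩ := hg
  refine ⟨.branch r p q, fun x => R x + (S x + T x) + 1, (hR.add (hS.add hT)).add (.const 1),
    fun x => ?_⟩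
  obtain ⟨u, hu, h0⟩ := hr x
  obtain ⟨s, hs, h1⟩ := hp x
  obtain ⟨t, ht, h2⟩ := hq x
  by_cases h : 0 < c x
  · simp only [if_pos h]
    exact ⟨_, by omega, Runs.branch_pos h0 h h1⟩
  · simp only [if_neg h]
    exact ⟨_, by omega, Runs.branch_neg h0 (not_lt.1 h) h2⟩

/-- A truth value and the integer 0 or 1 have the same representation, so the same program serves
both. `natCast` rests on the same remark. -/
theorem boolToInt {c : α → Bool} (hc : PolyTime c) :
    PolyTime fun x => if c x = true then (1 : ℤ) else 0 := hc

@[fun_prop]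
theorem cond {c : α → Bool} {f g : α → β} (hc : PolyTime c) (hf : PolyTime f) (hg : PolyTime g) :
    PolyTime fun x => bif c x then f x else g x := by
  convert ite_pos hc.boolToInt hf hg using 2 with x
  cases c x <;> rfl

/-- A bound on the number of rounds is not enough, since a body may double the state each time. The
sizes of all intermediate states are therefore bounded by hypothesis. -/
theorem iterate {init : α → σ} {test : σ → ℤ} {body : σ → σ} (hi : PolyTime init)
    (ht : PolyTime test) (hb : PolyTime body) {K S : α → ℕ} (hK : PolyBdd K) (hS : PolyBdd S)
    (hpos : ∀ x, ∀ i < K x, 0 < test (body^[i] (init x)))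
    (hend : ∀ x, test (body^[K x] (init x)) ≤ 0)
    (hsize : ∀ x, ∀ i ≤ K x, size (body^[i] (init x)) ≤ S x) :
    PolyTime fun x => body^[K x] (init x) := by
  obtain ⟨i, I, hI, hi⟩ := hi
  obtain ⟨r, R, ⟨R', hR⟩, hr⟩ := ht
  obtain ⟨p, P, ⟨P', hP⟩, hp⟩ := hb
  refine ⟨.comp i (.loop r p), fun x => I x + (K x + 1) *
      (R'.eval (S x) + P'.eval (S x) + 1) + 1,
    (hI.add ((hK.add (.const 1)).mul (((PolyBdd.eval R' hS).add (PolyBdd.eval P' hS)).add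
      (.const 1)))).add (.const 1), fun x => ?_⟩
  -- Induction on the number `k` of rounds still to come, because `Runs.loop_step` adds a round at
  -- the front.
  have key : ∀ k ≤ K x, ∃ t ≤ (k + 1) * (R'.eval (S x) + P'.eval (S x) + 1),
      Runs (.loop r p) (Codable.enc (body^[K x - k] (init x)))
        (Codable.enc (body^[K x] (init x))) t := by
    intro k
    induction k with
    | zero =>
      intro _
      obtain ⟨u, hu, h0⟩ := hr (body^[K x] (init x))
      have := (hR _).trans (R'.eval_mono_nat (hsize x (K x) le_rfl))
      exact ⟨_, by omega, Runs.loop_stop h0 (hend x)⟩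
    | succ k ih =>
      intro hk
      obtain ⟨t, ht, h2⟩ := ih (by omega)
      have e : K x - k = (K x - (k + 1)) + 1 := by omega
      rw [e, Function.iterate_succ_apply'] at h2
      obtain ⟨u, hu, h0⟩ := hr (body^[K x - (k + 1)] (init x))
      obtain ⟨v, hv, h1⟩ := hp (body^[K x - (k + 1)] (init x))
      have a1 := (hR _).trans (R'.eval_mono_nat (hsize x (K x - (k + 1)) (by omega)))
      have a2 := (hP _).trans (P'.eval_mono_nat (hsize x (K x - (k + 1)) (by omega)))
      refine ⟨_, ?_, Runs.loop_step h0 (hpos x _ (by omega)) h1 h2⟩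
      rw [Nat.succ_mul]
      omega
  obtain ⟨s, hs, h1⟩ := hi x
  obtain ⟨t, ht, h2⟩ := key (K x) le_rfl
  rw [Nat.sub_self] at h2
  exact ⟨_, by dsimp only; omega, h1.comp h2⟩

/-! ### Integers, natural numbers and truth values -/

theorem size_int (z : ℤ) : size z = Nat.size z.natAbs + 1 := rfl

theorem size_nat (n : ℕ) : size n = Nat.size n + 1 := by
  simp [size, Codable.ty, Codable.enc, Ty.size]

theorem size_prod (x : α × β) : size x = size x.1 + size x.2 + 1 := rfl

theorem size_list (l : List α) : size l = (l.map size).sum + l.length + 1 := by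
  simp only [size, Codable.ty, Codable.enc, Ty.size, List.map_map, List.length_map]
  rfl

theorem _root_.Nat.size_add_le (a b : ℕ) : Nat.size (a + b) ≤ max (Nat.size a) (Nat.size b) + 1 := by
  rw [Nat.size_le, pow_succ]
  have h1 : a < 2 ^ max a.size b.size :=
    (Nat.lt_size_self a).trans_le (Nat.pow_le_pow_right (by norm_num) (le_max_left _ _))
  have h2 : b < 2 ^ max a.size b.size :=
    (Nat.lt_size_self b).trans_le (Nat.pow_le_pow_right (by norm_num) (le_max_right _ _))
  omega

theorem size_int_add_le (a b : ℤ) : size (a + b) ≤ size a + size b := by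
  rw [size_int, size_int, size_int]
  have h1 := Nat.size_le_size (Int.natAbs_add_le a b)
  have h2 := Nat.size_add_le a.natAbs b.natAbs
  omega

@[fun_prop]
theorem int_add {f g : α → ℤ} (hf : PolyTime f) (hg : PolyTime g) :
    PolyTime fun x => f x + g x :=
  comp (of_op (α := ℤ × ℤ) (f := fun x => x.1 + x.2) .add (fun _ => rfl)
    (PolyBdd.size.mono fun x => by
      rw [size_prod]; exact (size_int_add_le _ _).trans (Nat.le_succ _))) (hf.prodMk hg)

@[fun_prop]
theorem int_sub {f g : α → ℤ} (hf : PolyTime f) (hg : PolyTime g) :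
    PolyTime fun x => f x - g x :=
  comp (of_op (α := ℤ × ℤ) (f := fun x => x.1 - x.2) .sub (fun _ => rfl)
    (PolyBdd.size.mono fun x => by
      have := size_int_add_le x.1 (-x.2)
      rw [size_prod, sub_eq_add_neg]
      rw [show size (-x.2) = size x.2 by simp [size_int]] at this
      omega)) (hf.prodMk hg)

@[fun_prop]
theorem natCast {f : α → ℕ} (hf : PolyTime f) : PolyTime fun x => (f x : ℤ) := hf

@[fun_prop]
theorem nat_add {f g : α → ℕ} (hf : PolyTime f) (hg : PolyTime g) :
    PolyTime fun x => f x + g x := by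
  obtain ⟨p, T, hT, h⟩ := hf.natCast.int_add hg.natCast
  exact ⟨p, T, hT, fun x => by
    obtain ⟨t, ht, hr⟩ := h x
    exact ⟨t, ht, by simpa [Codable.enc] using hr⟩⟩

@[fun_prop]
theorem int_toNat {f : α → ℤ} (hf : PolyTime f) : PolyTime fun x => (f x).toNat := by
  obtain ⟨p, T, hT, h⟩ := ite_pos hf hf (const (0 : ℤ))
  exact ⟨p, T, hT, fun x => by
    obtain ⟨t, ht, hr⟩ := h x
    refine ⟨t, ht, ?_⟩
    have e : (Codable.enc (f x).toNat : (Codable.ty ℕ).Val) =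
        (if 0 < f x then f x else 0 : ℤ) := by
      change (((f x).toNat : ℕ) : ℤ) = _
      split_ifs <;> omega
    rw [e]; exact hr⟩

theorem decide_pos {f : α → ℤ} (hf : PolyTime f) : PolyTime fun x => decide (0 < f x) := by
  convert ite_pos hf (const true) (const false) using 2 with x
  by_cases h : 0 < f x <;> simp [h]

@[fun_prop]
theorem int_lt {f g : α → ℤ} (hf : PolyTime f) (hg : PolyTime g) :
    PolyTime fun x => decide (f x < g x) := by
  simpa using (hg.int_sub hf).decide_pos

@[fun_prop]
theorem not {f : α → Bool} (hf : PolyTime f) : PolyTime fun x => !f x := by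
  convert hf.cond (const false) (const true) using 2 with x
  cases f x <;> rfl

@[fun_prop]
theorem and {f g : α → Bool} (hf : PolyTime f) (hg : PolyTime g) :
    PolyTime fun x => f x && g x := by
  convert hf.cond hg (const false) using 2 with x
  cases f x <;> rfl

@[fun_prop]
theorem or {f g : α → Bool} (hf : PolyTime f) (hg : PolyTime g) :
    PolyTime fun x => f x || g x := by
  convert hf.cond (const true) hg using 2 with x
  cases f x <;> rfl

@[fun_prop]
theorem int_le {f g : α → ℤ} (hf : PolyTime f) (hg : PolyTime g) :
    PolyTime fun x => decide (f x ≤ g x) := by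
  convert (hg.int_lt hf).not using 2 with x
  rw [← decide_not, decide_eq_decide, not_lt]

@[fun_prop]
theorem int_eq {f g : α → ℤ} (hf : PolyTime f) (hg : PolyTime g) :
    PolyTime fun x => decide (f x = g x) := by
  convert (hf.int_le hg).and (hg.int_le hf) using 2 with x
  rw [← Bool.decide_and, decide_eq_decide, le_antisymm_iff]

@[fun_prop]
theorem nat_lt {f g : α → ℕ} (hf : PolyTime f) (hg : PolyTime g) :
    PolyTime fun x => decide (f x < g x) := by
  simpa using hf.natCast.int_lt hg.natCast

@[fun_prop]
theorem nat_le {f g : α → ℕ} (hf : PolyTime f) (hg : PolyTime g) :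
    PolyTime fun x => decide (f x ≤ g x) := by
  simpa using hf.natCast.int_le hg.natCast

@[fun_prop]
theorem nat_eq {f g : α → ℕ} (hf : PolyTime f) (hg : PolyTime g) :
    PolyTime fun x => decide (f x = g x) := by
  simpa using hf.natCast.int_eq hg.natCast

@[fun_prop]
theorem bool_beq {f g : α → Bool} (hf : PolyTime f) (hg : PolyTime g) :
    PolyTime fun x => f x == g x := by
  convert hf.cond hg hg.not using 2 with x
  cases f x <;> cases g x <;> rfl

/-! ### Lists -/

theorem length_le_size (l : List α) : l.length ≤ size l := by rw [size_list]; omega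

theorem size_cons (a : α) (l : List α) : size (a :: l) = size a + size l + 1 := by
  rw [size_list, size_list]; simp; omega

theorem size_nil : size ([] : List α) = 1 := by rw [size_list]; simp

theorem size_le_of_mem {a : α} {l : List α} (h : a ∈ l) : size a ≤ size l := by
  rw [size_list]
  have := List.single_le_sum (l := l.map size) (by simp) _ (List.mem_map_of_mem h)
  omega

theorem size_append (l m : List α) : size (l ++ m) + 1 = size l + size m := by
  rw [size_list, size_list, size_list]; simp; omega

@[fun_prop]
theorem cons {f : α → β} {l : α → List β} (hf : PolyTime f) (hl : PolyTime l) :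
    PolyTime fun x => f x :: l x :=
  comp (of_op (α := β × List β) (f := fun x => x.1 :: x.2) (.cons _) (fun _ => rfl)
    (PolyBdd.size.mono fun x => by rw [size_prod, size_cons])) (hf.prodMk hl)

@[fun_prop]
theorem tail {l : α → List β} (hl : PolyTime l) : PolyTime fun x => (l x).tail :=
  comp (of_op (α := List β) (f := fun x => x.tail) (.tail _)
    (fun x => by cases x <;> rfl)
    (PolyBdd.size.mono fun x => by cases x <;> simp [size_cons]; omega)) hl

@[fun_prop]
theorem headD {d : α → β} {l : α → List β} (hd : PolyTime d) (hl : PolyTime l) :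
    PolyTime fun x => (l x).headD (d x) :=
  comp (of_op (α := β × List β) (f := fun x => x.2.headD x.1) (.head _)
    (fun x => by rcases x with ⟨d, _ | _⟩ <;> rfl)
    (PolyBdd.size.mono fun x => by
      rcases x with ⟨d, _ | ⟨a, l⟩⟩ <;> simp [size_prod, size_cons] <;> omega)) (hd.prodMk hl)

theorem nat_size_le_self (n : ℕ) : Nat.size n ≤ n := by
  rw [Nat.size_le]; exact Nat.lt_two_pow_self

@[fun_prop]
theorem length {l : α → List β} (hl : PolyTime l) : PolyTime fun x => (l x).length :=
  comp (of_op (α := List β) (f := fun x => x.length) (.length _)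
    (fun x => by simp [Op.eval, Codable.enc])
    (PolyBdd.size.mono fun x => by
      rw [size_nat, size_list]; have := nat_size_le_self x.length; omega)) hl

/-- The loop state consists of the input, the unread part of the list and the accumulator. The
length of the unread part is the loop test. -/
theorem foldl [Inhabited β] {init : α → σ} {l : α → List β} {step : α → σ → β → σ}
    (hi : PolyTime init) (hl : PolyTime l)
    (hs : PolyTime fun p : α × σ × β => step p.1 p.2.1 p.2.2) {S : α → ℕ} (hS : PolyBdd S)
    (hsize : ∀ x, ∀ i, size (((l x).take i).foldl (step x) (init x)) ≤ S x) :
    PolyTime fun x => (l x).foldl (step x) (init x) := by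
  let body : α × List β × σ → α × List β × σ := fun p =>
    (p.1, p.2.1.tail, step p.1 p.2.2 (p.2.1.headD default))
  have hbody : PolyTime body := by
    refine prodMk (by fun_prop) (prodMk (by fun_prop) ?_)
    exact hs.comp (f := fun p : α × List β × σ => (p.1, p.2.2, p.2.1.headD default)) (by fun_prop)
  have key : ∀ x, ∀ i ≤ (l x).length, body^[i] (x, l x, init x) =
      (x, (l x).drop i, ((l x).take i).foldl (step x) (init x)) := by
    intro x i hi
    induction i with
    | zero => simp
    | succ i ih =>
      rw [Function.iterate_succ_apply', ih (by omega)]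
      have hi' : i < (l x).length := hi
      simp only [body, List.tail_drop, Prod.mk.injEq, true_and]
      rw [List.take_succ_eq_append_getElem hi', List.foldl_append,
        List.drop_eq_getElem_cons hi']
      simp [hi']
  have := iterate (init := fun x => (x, l x, init x)) (test := fun p => (p.2.1.length : ℤ))
    (body := body) (by fun_prop) (by fun_prop) hbody (K := fun x => (l x).length)
    (S := fun x => size x + (size (l x) + S x + 1) + 1)
    (bdd_comp (PolyBdd.size.mono length_le_size) hl)
    ((PolyBdd.size.add ((hl.polyBdd_size.add hS).add (.const 1))).add (.const 1))
    (fun x i hi => by rw [key x i hi.le]; simp; omega)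
    (fun x => by rw [key x _ le_rfl]; simp)
    (fun x i hi => by
      rw [key x i hi, size_prod, size_prod]
      have h1 := hsize x i
      have h2 := size_append ((l x).take i) ((l x).drop i)
      have h3 := size_list ((l x).take i)
      rw [List.take_append_drop] at h2
      dsimp only
      omega)
  convert this.snd.snd using 2 with x
  rw [key x _ le_rfl]; simp

/-- An additive growth of `S x` per element adds up to at most `size (l x) * S x`. -/
theorem foldl_of_size_le [Inhabited β] {init : α → σ} {l : α → List β} {step : α → σ → β → σ}
    (hi : PolyTime init) (hl : PolyTime l)
    (hs : PolyTime fun p : α × σ × β => step p.1 p.2.1 p.2.2) {S : α → ℕ} (hS : PolyBdd S)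
    (hsize : ∀ x, ∀ s, ∀ b ∈ l x, size (step x s b) ≤ size s + S x) :
    PolyTime fun x => (l x).foldl (step x) (init x) := by
  refine foldl hi hl hs (S := fun x => size (init x) + size (l x) * S x)
    (hi.polyBdd_size.add (hl.polyBdd_size.mul hS)) fun x i => ?_
  have key : ∀ (m : List β) (s : σ), (∀ b ∈ m, b ∈ l x) →
      size (m.foldl (step x) s) ≤ size s + m.length * S x := by
    intro m
    induction m with
    | nil => simp
    | cons b m ih =>
      intro s hm
      have h1 := ih (step x s b) fun c hc => hm c (List.mem_cons_of_mem _ hc)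
      have h2 := hsize x s b (hm b List.mem_cons_self)
      rw [List.foldl_cons, List.length_cons, Nat.succ_mul]
      omega
  refine (key _ _ fun b => List.mem_of_mem_take).trans ?_
  have h1 := length_le_size (l x)
  have h2 : ((l x).take i).length ≤ (l x).length := by simp
  exact Nat.add_le_add_left (Nat.mul_le_mul_right _ (h2.trans h1)) _

@[fun_prop]
theorem reverse [Inhabited β] {l : α → List β} (hl : PolyTime l) :
    PolyTime fun x => (l x).reverse := by
  have := foldl_of_size_le (init := fun _ => []) (step := fun (_ : α) (s : List β) b => b :: s)
    (by fun_prop) hl (by fun_prop) (S := fun x => size (l x) + 1) (hl.polyBdd_size.add (.const 1))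
    fun x s b hb => by rw [size_cons]; have := size_le_of_mem hb; omega
  simpa using this

@[fun_prop]
theorem append [Inhabited β] {l m : α → List β} (hl : PolyTime l) (hm : PolyTime m) :
    PolyTime fun x => l x ++ m x := by
  have := foldl_of_size_le (init := m) (l := fun x => (l x).reverse)
    (step := fun (_ : α) (s : List β) b => b :: s)
    hm (by fun_prop) (by fun_prop) (S := fun x => size (l x) + 1) (hl.polyBdd_size.add (.const 1))
    fun x s b hb => by
      rw [size_cons]; have := size_le_of_mem (List.mem_reverse.1 hb); omega
  simpa using this

@[fun_prop]
theorem flatMap [Inhabited β] [Inhabited γ] {l : α → List β} {f : α → β → List γ}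
    (hl : PolyTime l) (hf : PolyTime fun p : α × β => f p.1 p.2) :
    PolyTime fun x => (l x).flatMap (f x) := by
  have hs : PolyTime fun p : α × List γ × β => f p.1 p.2.2 :=
    hf.comp (f := fun p : α × List γ × β => (p.1, p.2.2)) (by fun_prop)
  obtain ⟨q, hq⟩ := hf.polyBdd_size
  have := foldl_of_size_le (init := fun _ => []) (l := l)
    (step := fun x (s : List γ) b => s ++ f x b)
    (by fun_prop) hl (by fun_prop) (S := fun x => q.eval (size x + size (l x) + 1))
    (PolyBdd.eval q ((PolyBdd.size.add hl.polyBdd_size).add (.const 1)))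
    fun x s b hb => by
      have h1 := size_append s (f x b)
      have h2 := hq (x, b)
      have h3 := size_le_of_mem hb
      have h4 := q.eval_mono_nat (show size (x, b) ≤ size x + size (l x) + 1 by
        rw [size_prod]; dsimp only; omega)
      dsimp only at h2
      omega
  simpa [List.flatMap_eq_foldl] using this

@[fun_prop]
theorem map [Inhabited β] [Inhabited γ] {l : α → List β} {f : α → β → γ}
    (hl : PolyTime l) (hf : PolyTime fun p : α × β => f p.1 p.2) :
    PolyTime fun x => (l x).map (f x) := by
  have := flatMap (f := fun x b => [f x b]) hl (hf.cons (const []))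
  convert this using 2 with x
  induction l x with
  | nil => rfl
  | cons b l ih => simp_all

@[fun_prop]
theorem filter [Inhabited β] {l : α → List β} {f : α → β → Bool}
    (hl : PolyTime l) (hf : PolyTime fun p : α × β => f p.1 p.2) :
    PolyTime fun x => (l x).filter (f x) := by
  have := flatMap (f := fun x b => bif f x b then [b] else []) hl
    (hf.cond (by fun_prop) (by fun_prop))
  convert this using 2 with x
  induction l x with
  | nil => rfl
  | cons b l ih => rw [List.filter_cons, List.flatMap_cons, ← ih]; cases f x b <;> rfl

@[fun_prop]
theorem any [Inhabited β] {l : α → List β} {f : α → β → Bool}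
    (hl : PolyTime l) (hf : PolyTime fun p : α × β => f p.1 p.2) :
    PolyTime fun x => (l x).any (f x) := by
  have h2 := (const (α := α) 0).nat_lt (hl.filter hf).length
  convert h2 using 2 with x
  rw [Bool.eq_iff_iff]
  simp [List.length_pos_iff_exists_mem]

@[fun_prop]
theorem all [Inhabited β] {l : α → List β} {f : α → β → Bool}
    (hl : PolyTime l) (hf : PolyTime fun p : α × β => f p.1 p.2) :
    PolyTime fun x => (l x).all (f x) := by
  convert (hl.any (f := fun x b => !f x b) hf.not).not using 2 with x
  simp [List.all_eq_not_any_not]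

/-- The counter starts at `i` and falls by one per element. It vanishes only at position `i` and is
negative from then on, so nothing is overwritten later. -/
theorem foldl_getD {β : Type} (l : List β) (i : ℕ) (d : β) :
    (l.foldl (fun (s : ℤ × β) b => (s.1 - 1, bif decide (s.1 = 0) then b else s.2)) ((i : ℤ), d)).2
      = l.getD i d := by
  have neg : ∀ (l : List β) (z : ℤ) (d : β), z < 0 →
      (l.foldl (fun (s : ℤ × β) b => (s.1 - 1, bif decide (s.1 = 0) then b else s.2)) (z, d)).2
        = d := by
    intro l
    induction l with
    | nil => intros; rfl
    | cons b l ih => 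
      intro z d hz
      rw [List.foldl_cons, ih _ _ (by dsimp only; omega)]
      simp [hz.ne]
  induction l generalizing i with
  | nil => simp
  | cons b l ih =>
    rw [List.foldl_cons]
    cases i with
    | zero => rw [neg _ _ _ (by simp)]; simp
    | succ i =>
      have : ((i + 1 : ℕ) : ℤ) - 1 = i := by push_cast; ring
      have h0 : ¬ (((i + 1 : ℕ) : ℤ) = 0) := by omega
      simp only [this, h0, decide_false, cond_false]
      rw [ih]; simp

@[fun_prop]
theorem getD [Inhabited β] {l : α → List β} {i : α → ℕ} {d : α → β}
    (hl : PolyTime l) (hi : PolyTime i) (hd : PolyTime d) :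
    PolyTime fun x => (l x).getD (i x) (d x) := by
  have := foldl_of_size_le (init := fun x => ((i x : ℤ), d x))
    (step := fun (_ : α) (s : ℤ × β) b => (s.1 - 1, bif decide (s.1 = 0) then b else s.2))
    (by fun_prop) hl (by fun_prop) (S := fun x => size (l x) + size (1 : ℤ))
    (hl.polyBdd_size.add (.const _))
    fun x s b hb => by
      have h1 := size_int_add_le s.1 (-1)
      have h2 := size_le_of_mem hb
      have h3 : size (-1 : ℤ) = size (1 : ℤ) := rfl
      rw [size_prod, size_prod, sub_eq_add_neg]
      dsimp only
      cases decide (s.1 = 0) <;> simp only [cond_true, cond_false] <;> omega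
  convert this.snd using 2 with x
  exact (foldl_getD _ _ _).symm

theorem size_range_le (n : ℕ) : size (List.range n) ≤ n * (n + 2) + 1 := by
  rw [size_list]
  have : ((List.range n).map size).sum ≤ ((List.range n).map size).length • (n + 1) := by
    refine List.sum_le_card_nsmul _ _ fun y hy => ?_
    obtain ⟨i, hi, rfl⟩ := List.mem_map.1 hy
    have h1 := nat_size_le_self i
    have h2 := List.mem_range.1 hi
    rw [size_nat]
    omega
  simp at this ⊢
  nlinarith

-- Only ranges up to the length of a list are admitted: a range up to a number written in binary can
-- be exponentially long.
@[fun_prop]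
theorem range_length [Inhabited β] {l : α → List β} (hl : PolyTime l) :
    PolyTime fun x => List.range (l x).length := by
  -- The length of the accumulator is the next number to be appended.
  have key : ∀ l : List β,
      l.foldl (fun (s : List ℕ) _ => s ++ [s.length]) [] = List.range l.length := by
    intro l
    induction l using List.reverseRecOn with
    | nil => rfl
    | append_singleton l b ih => simp [ih, List.range_succ]
  have := foldl (init := fun _ => []) (l := l)
    (step := fun (_ : α) (s : List ℕ) (_ : β) => s ++ [s.length]) (by fun_prop) hl
    (by fun_prop) (S := fun x => size (l x) * (size (l x) + 2) + 1)
    ((hl.polyBdd_size.mul (hl.polyBdd_size.add (.const 2))).add (.const 1))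
    fun x i => by
      rw [key]
      refine (size_range_le _).trans ?_
      have h1 := length_le_size (l x)
      have h2 : ((l x).take i).length ≤ (l x).length := by simp
      have h3 := h2.trans h1
      gcongr
  simpa [key] using this

@[fun_prop]
theorem list_sum_int {l : α → List ℤ} (hl : PolyTime l) : PolyTime fun x => (l x).sum := by
  have := foldl_of_size_le (init := fun _ => (0 : ℤ)) (step := fun (_ : α) (s : ℤ) b => s + b)
    (by fun_prop) hl (by fun_prop) (S := fun x => size (l x)) hl.polyBdd_size
    fun x s b hb => (size_int_add_le _ _).trans (Nat.add_le_add_left (size_le_of_mem hb) _)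
  simpa [List.sum_eq_foldl] using this

@[fun_prop]
theorem list_sum_nat {l : α → List ℕ} (hl : PolyTime l) : PolyTime fun x => (l x).sum := by
  convert (map (f := fun _ (b : ℕ) => (b : ℤ)) hl (by fun_prop)).list_sum_int.int_toNat using 2 with x
  have key : ((l x).map fun b : ℕ => (b : ℤ)).sum = ((l x).sum : ℕ) := by
    induction l x with
    | nil => rfl
    | cons b l ih => simp_all
  rw [key, Int.toNat_natCast]

end PolyTime

/-! ## The assignment problem -/

/-- The restriction of `f` to the numbers below `N` is a permutation of them. -/
def IsPermBelow (N : ℕ) (f : ℕ → ℕ) : Prop :=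
  (∀ x < N, f x < N) ∧ ∀ x < N, ∀ y < N, f x = f y → x = y

namespace IsPermBelow

theorem sum_comp {M : Type} [AddCommMonoid M] {N : ℕ} {f : ℕ → ℕ} (h : IsPermBelow N f)
    (g : ℕ → M) : ∑ x ∈ Finset.range N, g (f x) = ∑ x ∈ Finset.range N, g x := by
  have hm : ∀ x ∈ Finset.range N, f x ∈ Finset.range N := fun x hx => by
    simpa using h.1 x (by simpa using hx)
  have hi : Set.InjOn f (Finset.range N) := fun x hx y hy => h.2 x (by simpa using hx) y
    (by simpa using hy)
  exact Finset.sum_nbij f hm hi (Finset.surjOn_of_injOn_of_card_le f hm hi le_rfl) fun _ _ => rfl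

theorem exists_eq {N : ℕ} {f : ℕ → ℕ} (h : IsPermBelow N f) {y : ℕ} (hy : y < N) :
    ∃ x < N, f x = y := by
  have hm : ∀ x ∈ Finset.range N, f x ∈ Finset.range N := fun x hx => by
    simpa using h.1 x (by simpa using hx)
  have hi : Set.InjOn f (Finset.range N) := fun x hx y hy => h.2 x (by simpa using hx) y
    (by simpa using hy)
  obtain ⟨x, hx, e⟩ := Finset.surjOn_of_injOn_of_card_le f hm hi le_rfl
    (show y ∈ (Finset.range N : Set ℕ) by simpa using hy)
  exact ⟨x, by simpa using hx, e⟩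

theorem congr {N : ℕ} {f g : ℕ → ℕ} (h : IsPermBelow N f) (e : ∀ x < N, f x = g x) :
    IsPermBelow N g :=
  ⟨fun x hx => e x hx ▸ h.1 x hx, fun x hx y hy hxy =>
    h.2 x hx y hy (by rw [e x hx, e y hy, hxy])⟩

end IsPermBelow

theorem List.getD_map_range {α : Type} (f : ℕ → α) {N i : ℕ} (h : i < N) (d : α) :
    ((List.range N).map f).getD i d = f i := by
  simp [List.getD, h]

/-- The first element of `l` at which `f` is smallest; `d` if the list is empty. -/
def List.minBy {α : Type} (f : α → ℤ) (l : List α) (d : α) : α :=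
  l.foldl (fun b x => bif decide (f x < f b) then x else b) (l.headD d)

theorem List.minBy_spec {α : Type} (f : α → ℤ) {l : List α} (h : l ≠ []) (d : α) :
    l.minBy f d ∈ l ∧ ∀ x ∈ l, f (l.minBy f d) ≤ f x := by
  have key : ∀ (l : List α) (b : α),
      (l.foldl (fun b x => bif decide (f x < f b) then x else b) b) ∈ b :: l ∧
      ∀ x ∈ b :: l, f (l.foldl (fun b x => bif decide (f x < f b) then x else b) b) ≤ f x := by
    intro l
    induction l with
    | nil => simp
    | cons a l ih =>
      intro b
      rw [List.foldl_cons]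
      by_cases hab : f a < f b
      · simp only [hab, decide_true, cond_true]
        obtain ⟨h1, h2⟩ := ih a
        refine ⟨List.mem_cons_of_mem _ h1, fun x hx => ?_⟩
        rcases List.mem_cons.1 hx with rfl | hx
        · exact (h2 a List.mem_cons_self).trans hab.le
        · exact h2 x hx
      · simp only [hab, decide_false, cond_false]
        obtain ⟨h1, h2⟩ := ih b
        refine ⟨?_, fun x hx => ?_⟩
        · rcases List.mem_cons.1 h1 with h1 | h1
          · rw [h1]; exact List.mem_cons_self
          · exact List.mem_cons_of_mem _ (List.mem_cons_of_mem _ h1)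
        · rcases List.mem_cons.1 hx with rfl | hx
          · exact h2 x List.mem_cons_self
          · rcases List.mem_cons.1 hx with rfl | hx
            · exact (h2 b List.mem_cons_self).trans (not_lt.1 hab)
            · exact h2 x (List.mem_cons_of_mem _ hx)
  cases l with
  | nil => exact absurd rfl h
  | cons a l =>
    obtain ⟨h1, h2⟩ := key (a :: l) a
    refine ⟨?_, fun x hx => h2 x (List.mem_cons_of_mem _ hx)⟩
    rcases List.mem_cons.1 h1 with h1 | h1
    · rw [List.minBy, List.headD_cons, h1]; exact List.mem_cons_self
    · exact h1

/-! ### The Hungarian method and its invariants -/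

namespace Hungarian

/-- The state of the Hungarian method: dual values of the rows and of the columns, the assignment
of rows to columns, the number of rows that are assigned at no loss, and the alternating tree. The
tree is represented by its rows, each with the assignment that results when this row, instead of
the row `row`, is left without a column of its own. -/
structure State where
  u : List ℤ
  v : List ℤ
  asg : List ℕ
  row : ℕ
  tree : List (ℕ × List ℕ)

/-- An entry of the cost matrix. -/
def cost (a : List (List ℕ)) (i j : ℕ) : ℕ := (a.getD i []).getD j 0

/-- The reduced cost. -/
def slack (a : List (List ℕ)) (u v : List ℤ) (i j : ℕ) : ℤ :=
  cost a i j - u.getD i 0 - v.getD j 0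

/-- Row `i` belongs to the tree. -/
def inTree (S : List (ℕ × List ℕ)) (i : ℕ) : Bool := S.any fun p => decide (p.1 = i)

/-- Column `j` is not reached by the tree. -/
def isOpen (s : State) (j : ℕ) : Bool :=
  decide (s.asg.getD j 0 = s.row) || !inTree s.tree (s.asg.getD j 0)

/-- The pairs of a row of the tree and an open column. -/
def candidates (N : List ℕ) (s : State) : List ((ℕ × List ℕ) × ℕ) :=
  s.tree.flatMap fun p => (N.filter fun j => isOpen s j).map fun j => (p, j)

/-- Assign row `i` to column `j`, and the row of `j` to the column of `i`. -/
def exchange (N ρ : List ℕ) (i j : ℕ) : List ℕ :=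
  N.map fun x => bif decide (x = j) then i else
    bif decide (ρ.getD x 0 = i) then ρ.getD j 0 else ρ.getD x 0

/-- The dual values of the rows after a change by `δ`. -/
def dualRow (N : List ℕ) (s : State) (δ : ℤ) : List ℤ :=
  N.map fun x => s.u.getD x 0 + bif inTree s.tree x then δ else 0

/-- The dual values of the columns after a change by `δ`. -/
def dualCol (N : List ℕ) (s : State) (δ : ℤ) : List ℤ :=
  N.map fun x => s.v.getD x 0 - bif isOpen s x then 0 else δ

/-- Extension of the tree by the column `j` and its row. -/
def grow (N : List ℕ) (s : State) (δ : ℤ) (p : ℕ × List ℕ) (j : ℕ) : State :=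
  ⟨dualRow N s δ, dualCol N s δ, s.asg, s.row,
    (s.asg.getD j 0, exchange N p.2 p.1 j) :: s.tree⟩

/-- Assignment of one more row, when a free column `j` has been reached. -/
def augment (N : List ℕ) (s : State) (δ : ℤ) (p : ℕ × List ℕ) (j : ℕ) : State :=
  ⟨dualRow N s δ, dualCol N s δ, exchange N p.2 p.1 j, s.row + 1,
    [(s.row + 1, exchange N p.2 p.1 j)]⟩

/-- Change of the dual values and of the tree. -/
def update (N : List ℕ) (s : State) (δ : ℤ) (p : ℕ × List ℕ) (j : ℕ) : State :=
  bif decide (s.asg.getD j 0 < s.row) then grow N s δ p j else augment N s δ p j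

/-- The update for a pair of a row and a column. -/
def updateAt (a : List (List ℕ)) (s : State) (c : (ℕ × List ℕ) × ℕ) : State :=
  update (List.range a.length) s (slack a s.u s.v c.1.1 c.2) c.1 c.2

/-- One step of the Hungarian method. -/
def step (a : List (List ℕ)) (s : State) : State :=
  bif decide (s.row < a.length) then
    updateAt a s (List.minBy (fun c => slack a s.u s.v c.1.1 c.2)
      (candidates (List.range a.length) s) ((0, []), 0))
  else s

/-- The initial state. -/
def init (N : List ℕ) : State := ⟨N.map fun _ => 0, N.map fun _ => 0, N, 0, [(0, N)]⟩

/-- The assignment of rows to columns found by the Hungarian method. -/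
def solve (a : List (List ℕ)) : List ℕ :=
  (((List.range a.length).flatMap fun _ => List.range a.length ++ List.range a.length).foldl
    (fun s _ => step a s) (init (List.range a.length))).asg

/-- The invariants of the Hungarian method. -/
structure Inv (a : List (List ℕ)) (s : State) : Prop where
  u_length : s.u.length = a.length
  v_length : s.v.length = a.length
  asg_length : s.asg.length = a.length
  tree_length : ∀ p ∈ s.tree, p.2.length = a.length
  feasible : ∀ i < a.length, ∀ j < a.length, 0 ≤ slack a s.u s.v i j
  row_le : s.row ≤ a.length
  root_mem : (s.row, s.asg) ∈ s.tree
  tree_le : ∀ p ∈ s.tree, p.1 ≤ s.row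
  nodup : (s.tree.map Prod.fst).Nodup
  perm : ∀ p ∈ s.tree, IsPermBelow a.length fun x => p.2.getD x 0
  -- The row left out by a tree assignment is parked in the column where `asg` parks the root row.
  free : ∀ p ∈ s.tree, ∀ x < a.length, p.2.getD x 0 = p.1 ↔ s.asg.getD x 0 = s.row
  -- Rows up to `row`, except the one left out, are matched at zero slack. Later rows fill the
  -- remaining columns arbitrarily, which keeps the assignment a permutation.
  tight : ∀ p ∈ s.tree, ∀ x < a.length, p.2.getD x 0 ≠ p.1 → p.2.getD x 0 ≤ s.row →
    slack a s.u s.v (p.2.getD x 0) x = 0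
  -- Together with `closed`: flipping a tree path only permutes tree rows among themselves. So in
  -- each column either both `asg` and the tree assignment have a tree row, or neither has.
  eq_of_open : ∀ p ∈ s.tree, ∀ x < a.length, inTree s.tree (s.asg.getD x 0) = false →
    p.2.getD x 0 = s.asg.getD x 0
  closed : ∀ p ∈ s.tree, ∀ x < a.length, inTree s.tree (s.asg.getD x 0) = true →
    inTree s.tree (p.2.getD x 0) = true

variable {a : List (List ℕ)} {s : State}

theorem inTree_iff {S : List (ℕ × List ℕ)} {i : ℕ} : inTree S i = true ↔ ∃ p ∈ S, p.1 = i := by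
  simp [inTree]

theorem slack_dual {δ : ℤ} {i j : ℕ} (hi : i < a.length) (hj : j < a.length) :
    slack a (dualRow (List.range a.length) s δ) (dualCol (List.range a.length) s δ) i j =
      slack a s.u s.v i j - (bif inTree s.tree i then δ else 0) +
        (bif isOpen s j then 0 else δ) := by
  rw [slack, slack, dualRow, dualCol, List.getD_map_range _ hi, List.getD_map_range _ hj]
  ring

theorem exchange_getD {N : ℕ} (ρ : List ℕ) (i j : ℕ) {x : ℕ} (hx : x < N) :
    (exchange (List.range N) ρ i j).getD x 0 =
      if x = j then i else if ρ.getD x 0 = i then ρ.getD j 0 else ρ.getD x 0 := by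
  rw [exchange, List.getD_map_range _ hx]
  simp [Bool.cond_decide]

theorem isPermBelow_exchange {N : ℕ} {ρ : List ℕ} (h : IsPermBelow N fun x => ρ.getD x 0)
    {i j : ℕ} (hi : i < N) (hj : j < N) :
    IsPermBelow N fun x => (exchange (List.range N) ρ i j).getD x 0 := by
  refine IsPermBelow.congr (f := fun x => if x = j then i else
    if ρ.getD x 0 = i then ρ.getD j 0 else ρ.getD x 0) ⟨fun x hx => ?_, fun x hx y hy => ?_⟩
    fun x hx => (exchange_getD ρ i j hx).symm
  · have h1 := h.1 x hx
    have h2 := h.1 j hj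
    dsimp only at *
    split_ifs <;> assumption
  · have h1 := h.2 x hx y hy
    have h2 := h.2 x hx j hj
    have h3 := h.2 j hj y hy
    dsimp only at *
    intro e
    grind

/-- Only slacks between a tree row and an open column decrease, and these are at least `δ`. At a
tight position the row is in the tree exactly when the column is not open, so the two changes
cancel. -/
theorem Inv.dual (h : Inv a s) {δ : ℤ} (h0 : 0 ≤ δ)
    (hδ : ∀ q ∈ s.tree, ∀ x < a.length, isOpen s x = true → δ ≤ slack a s.u s.v q.1 x) :
    (∀ i < a.length, ∀ j < a.length, 0 ≤ slack a (dualRow (List.range a.length) s δ)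
      (dualCol (List.range a.length) s δ) i j) ∧
    (∀ p ∈ s.tree, ∀ x < a.length, p.2.getD x 0 ≠ p.1 → p.2.getD x 0 ≤ s.row →
      slack a (dualRow (List.range a.length) s δ)
      (dualCol (List.range a.length) s δ) (p.2.getD x 0) x = 0) := by
  constructor
  · intro i hi j hj
    rw [slack_dual hi hj]
    have h1 := h.feasible i hi j hj
    cases e1 : inTree s.tree i
    · cases isOpen s j <;> simp <;> omega
    · cases e2 : isOpen s j
      · simpa using h1
      · obtain ⟨q, hq, rfl⟩ := inTree_iff.1 e1
        have := hδ q hq j hj e2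
        simpa using this
  · intro p hp x hx h1 h2
    rw [slack_dual ((h.perm p hp).1 x hx) hx, h.tight p hp x hx h1 h2]
    have h3 := h.free p hp x hx
    have h4 := h.eq_of_open p hp x hx
    have h5 := h.closed p hp x hx
    have h6 : s.asg.getD x 0 ≠ s.row := fun e => h1 (h3.2 e)
    cases e : inTree s.tree (s.asg.getD x 0)
    · have e2 := e
      rw [← h4 e] at e2
      rw [isOpen, e, e2]; simp
    · rw [isOpen, e, h5 e, decide_eq_false h6]
      simp

/-- Since `δ` is the least slack between tree rows and open columns, row `p.1` and column `j` become
tight and can be matched. The exchange puts `p.1` into `j` and parks the former row of `j` where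
`p.1` was. -/
theorem Inv.update (h : Inv a s) (hrow : s.row < a.length) {p : ℕ × List ℕ} (hp : p ∈ s.tree)
    {j : ℕ} (hj : j < a.length) (hopen : isOpen s j = true)
    (hmin : ∀ q ∈ s.tree, ∀ x < a.length, isOpen s x = true →
      slack a s.u s.v p.1 j ≤ slack a s.u s.v q.1 x) :
    Inv a (updateAt a s (p, j)) := by
  have hp1 : p.1 < a.length := (h.tree_le p hp).trans_lt hrow
  obtain ⟨hfeas, htight⟩ := h.dual (h.feasible p.1 hp1 j hj) hmin
  have hroot := inTree_iff.2 ⟨_, h.root_mem, rfl⟩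
  have htj : slack a (dualRow (List.range a.length) s (slack a s.u s.v p.1 j))
      (dualCol (List.range a.length) s (slack a s.u s.v p.1 j)) p.1 j = 0 := by
    rw [slack_dual hp1 hj, hopen, inTree_iff.2 ⟨p, hp, rfl⟩]
    simp
  have hperm := isPermBelow_exchange (h.perm p hp) hp1 hj
  have hinjp := (h.perm p hp).2
  have hinj := (h.perm _ h.root_mem).2
  have hfree := h.free p hp
  have hor : s.asg.getD j 0 = s.row ∨ inTree s.tree (s.asg.getD j 0) = false := by
    simpa [isOpen] using hopen
  have hpj : inTree s.tree (s.asg.getD j 0) = false → p.2.getD j 0 = s.asg.getD j 0 :=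
    h.eq_of_open p hp j hj
  have hlt := (h.perm _ h.root_mem).1 j hj
  dsimp only at hinj hlt hinjp
  -- First case: `j` holds a matched row, which becomes a new tree row. Otherwise `j` is free and
  -- the tree restarts from the next row.
  by_cases hlt' : s.asg.getD j 0 < s.row
  · have hnt : inTree s.tree (s.asg.getD j 0) = false := hor.resolve_left hlt'.ne
    have hpj := hpj hnt
    have hin : ∀ i, inTree ((s.asg.getD j 0, exchange (List.range a.length) p.2 p.1 j) :: s.tree) i
        = true ↔ i = s.asg.getD j 0 ∨ inTree s.tree i = true := fun i => by
      simp only [inTree, List.any_cons, Bool.or_eq_true, decide_eq_true_eq]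
      exact or_congr_left eq_comm
    have hin' : ∀ i,
        inTree ((s.asg.getD j 0, exchange (List.range a.length) p.2 p.1 j) :: s.tree) i
        = false ↔ i ≠ s.asg.getD j 0 ∧ inTree s.tree i = false := fun i => by
      rw [← not_iff_not, Bool.not_eq_false, hin, not_and_or, not_not, Bool.not_eq_false]
    simp only [updateAt, Hungarian.update, hlt', decide_true, cond_true, grow]
    refine ⟨by simp [dualRow], by simp [dualCol], h.asg_length, ?_, hfeas, h.row_le,
      List.mem_cons_of_mem _ h.root_mem, ?_, ?_, ?_, ?_, ?_, ?_, ?_⟩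
    · exact List.forall_mem_cons.2 ⟨by simp [exchange], h.tree_length⟩
    · exact List.forall_mem_cons.2 ⟨hlt'.le, h.tree_le⟩
    · refine List.nodup_cons.2 ⟨fun hm => ?_, h.nodup⟩
      obtain ⟨q, hq, e⟩ := List.mem_map.1 hm
      rw [inTree_iff.2 ⟨q, hq, e⟩] at hnt
      cases hnt
    · exact List.forall_mem_cons.2 ⟨hperm, h.perm⟩
    · refine List.forall_mem_cons.2 ⟨fun x hx => ?_, h.free⟩
      have h1 := hfree x hx
      have h2 := hinjp x hx j hj
      have h3 := hfree j hj
      dsimp only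
      rw [exchange_getD _ _ _ hx]
      split_ifs with e1 e2
      · subst e1; grind
      · grind
      · grind
    · refine List.forall_mem_cons.2 ⟨fun x hx => ?_, htight⟩
      have h1 := htight p hp x hx
      dsimp only
      rw [exchange_getD _ _ _ hx]
      split_ifs with e1 e2
      · intro _ _; rw [e1]; exact htj
      · intro e; exact absurd hpj e
      · exact fun _ => h1 e2
    · dsimp only
      refine List.forall_mem_cons.2 ⟨fun x hx hx' => ?_, fun q hq x hx hx' => ?_⟩
      · obtain ⟨h1, h2⟩ := (hin' _).1 hx'
        have h3 := h.eq_of_open p hp x hx h2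
        rw [exchange_getD _ _ _ hx]
        split_ifs with e1 e2
        · rw [e1] at h1; exact absurd rfl h1
        · rw [hfree x hx] at e2
          rw [e2, hroot] at h2
          cases h2
        · exact h3
      · exact h.eq_of_open q hq x hx ((hin' _).1 hx').2
    · dsimp only
      refine List.forall_mem_cons.2 ⟨fun x hx hx' => ?_, fun q hq x hx hx' => ?_⟩
      · rw [hin] at hx' ⊢
        rw [exchange_getD _ _ _ hx]
        split_ifs with e1 e2
        · exact Or.inr (inTree_iff.2 ⟨p, hp, rfl⟩)
        · exact Or.inl hpj
        · rcases hx' with hx' | hx'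
          · exact absurd (hinj x hx j hj hx') e1
          · exact Or.inr (h.closed p hp x hx hx')
      · rw [hin] at hx' ⊢
        rcases hx' with hx' | hx'
        · obtain rfl := hinj x hx j hj hx'
          exact Or.inl (h.eq_of_open q hq x hx hnt)
        · exact Or.inr (h.closed q hq x hx hx')
  · have hmem : ∀ {P : ℕ × List ℕ → Prop},
        P (s.row + 1, exchange (List.range a.length) p.2 p.1 j) →
        ∀ q ∈ [(s.row + 1, exchange (List.range a.length) p.2 p.1 j)], P q := by
      intro P hP q hq; rw [List.mem_singleton.1 hq]; exact hP
    simp only [updateAt, Hungarian.update, hlt', decide_false, cond_false, augment]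
    refine ⟨by simp [dualRow], by simp [dualCol], by simp [exchange], hmem (by simp [exchange]),
      hfeas, hrow, List.mem_singleton.2 rfl, hmem le_rfl, List.nodup_singleton _, hmem hperm,
      hmem fun _ _ => Iff.rfl, hmem fun x hx => ?_, hmem fun _ _ _ => rfl, hmem fun _ _ h => h⟩
    have h1 := htight p hp x hx
    have h3 := hfree j hj
    have h4 := hfree x hx
    have h5 := hinj x hx j hj
    dsimp only
    rw [exchange_getD _ _ _ hx]
    split_ifs with e1 e2
    · intro _ _; rw [e1]; exact htj
    · intro h6 h7
      -- The row displaced from `j` is at least `row + 1`, while tightness is now required only of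
      -- rows up to `row + 1` other than `row + 1` itself.
      exfalso
      rcases hor with e | e
      · exact e1 (h5 ((h4.1 e2).trans e.symm))
      · have := hpj e
        have h8 : s.asg.getD j 0 ≠ s.row := by
          intro e'; rw [e', hroot] at e; cases e
        omega
    · exact fun h6 h7 => h1 e2 (by omega)

/-- The column that holds the root row is always open, so there is a candidate and the default value
of `minBy` plays no role. -/
theorem Inv.exists_step (h : Inv a s) (hrow : s.row < a.length) : ∃ p ∈ s.tree, ∃ j < a.length,
    isOpen s j = true ∧ (∀ q ∈ s.tree, ∀ x < a.length, isOpen s x = true →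
      slack a s.u s.v p.1 j ≤ slack a s.u s.v q.1 x) ∧ step a s = updateAt a s (p, j) := by
  have hmem : ∀ c, c ∈ candidates (List.range a.length) s ↔
      c.1 ∈ s.tree ∧ c.2 < a.length ∧ isOpen s c.2 = true := by
    rintro ⟨p, j⟩
    simp only [candidates, List.mem_flatMap, List.mem_map, List.mem_filter, List.mem_range,
      Prod.mk.injEq]
    constructor
    · rintro ⟨p', h1, j', h2, rfl, rfl⟩; exact ⟨h1, h2⟩
    · rintro ⟨h1, h2⟩; exact ⟨p, h1, j, h2, rfl, rfl⟩
  obtain ⟨x, hx, e⟩ := (h.perm _ h.root_mem).exists_eq hrow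
  have hne : candidates (List.range a.length) s ≠ [] := List.ne_nil_of_mem
    ((hmem ((s.row, s.asg), x)).2 ⟨h.root_mem, hx, by simp only [isOpen]; simp at e ⊢; simp [e]⟩)
  obtain ⟨h1, h2⟩ := List.minBy_spec (fun c : (ℕ × List ℕ) × ℕ => slack a s.u s.v c.1.1 c.2) hne
    ((0, []), 0)
  obtain ⟨h3, h4, h5⟩ := (hmem _).1 h1
  exact ⟨_, h3, _, h4, h5, fun q hq x hx hx' => h2 (q, x) ((hmem _).2 ⟨hq, hx, hx'⟩), by
    rw [step]; simp [hrow]⟩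

theorem Inv.step (h : Inv a s) : Inv a (step a s) := by
  by_cases hrow : s.row < a.length
  · obtain ⟨p, hp, j, hj, h1, h2, e⟩ := h.exists_step hrow
    rw [e]
    exact h.update hrow hp hj h1 h2
  · rw [Hungarian.step]; simpa [hrow] using h

theorem Inv.tree_length_le (h : Inv a s) : s.tree.length ≤ s.row + 1 := by
  have h1 : (s.tree.map Prod.fst).toFinset ⊆ Finset.range (s.row + 1) := fun i hi => by
    obtain ⟨p, hp, rfl⟩ := List.mem_map.1 (List.mem_toFinset.1 hi)
    have := h.tree_le p hp
    simp; omega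
  have h2 := Finset.card_le_card h1
  rw [List.toFinset_card_of_nodup h.nodup] at h2
  simpa using h2

/-- A step either enlarges the tree or raises `row` and shrinks the tree to one entry. The tree has
at most `row + 1 ≤ a.length` entries, so the weight `a.length + 1` of `row` outweighs the shrinking.
-/
theorem Inv.measure_step (h : Inv a s) (hrow : s.row < a.length) :
    s.row * (a.length + 1) + s.tree.length <
      (Hungarian.step a s).row * (a.length + 1) + (Hungarian.step a s).tree.length := by
  obtain ⟨p, hp, j, hj, h1, h2, e⟩ := h.exists_step hrow
  have h3 := h.tree_length_le
  rw [e]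
  by_cases hlt' : s.asg.getD j 0 < s.row
  · simp only [updateAt, Hungarian.update, hlt', decide_true, cond_true, grow, List.length_cons]
    omega
  · simp only [updateAt, Hungarian.update, hlt', decide_false, cond_false, augment,
      List.length_singleton, Nat.succ_mul]
    omega

theorem inv_init : Inv a (init (List.range a.length)) := by
  have hg : ∀ x < a.length, (List.range a.length).getD x 0 = x := fun x hx => by
    simp [List.getD, hx]
  have hmem : ∀ {P : ℕ × List ℕ → Prop}, P (0, List.range a.length) →
      ∀ q ∈ [(0, List.range a.length)], P q := by
    intro P hP q hq; rw [List.mem_singleton.1 hq]; exact hP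
  refine ⟨by simp [init], by simp [init], by simp [init], hmem (by simp), fun i hi j hj => ?_,
    Nat.zero_le _, List.mem_singleton.2 rfl, hmem le_rfl, List.nodup_singleton _, hmem ?_,
    hmem fun _ _ => Iff.rfl, hmem fun x hx => ?_, hmem fun _ _ _ => rfl, hmem fun _ _ h => h⟩
  · rw [slack, init, List.getD_map_range _ hi, List.getD_map_range _ hj]; simp
  · exact IsPermBelow.congr (f := fun x => x) ⟨fun _ h => h, fun _ _ _ _ h => h⟩
      fun x hx => (hg x hx).symm
  · dsimp only
    intro h1 h2
    exact absurd (Nat.le_zero.1 h2) h1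

theorem foldl_step {β : Type} (l : List β) (s : State) :
    l.foldl (fun s _ => step a s) s = (step a)^[l.length] s := by
  induction l generalizing s with
  | nil => rfl
  | cons b l ih => rw [List.foldl_cons, ih]; rfl

theorem inv_iterate (k : ℕ) : Inv a ((step a)^[k] (init (List.range a.length))) := by
  induction k with
  | zero => exact inv_init
  | succ k ih => rw [Function.iterate_succ_apply']; exact ih.step

/-- Until the method is finished the measure exceeds the number of steps, yet it stays below
`a.length * (a.length + 1)`. -/
theorem le_row_iterate (k : ℕ) (hk : a.length * (a.length + 1) ≤ k) :
    ((step a)^[k] (init (List.range a.length))).row = a.length := by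
  have key : ∀ k, ((step a)^[k] (init (List.range a.length))).row = a.length ∨
      k < ((step a)^[k] (init (List.range a.length))).row * (a.length + 1) +
        ((step a)^[k] (init (List.range a.length))).tree.length := by
    intro k
    induction k with
    | zero => right; simp [init]
    | succ k ih =>
      rw [Function.iterate_succ_apply']
      have hinv := inv_iterate (a := a) k
      rcases hinv.row_le.lt_or_eq with h | h
      · rcases ih with ih | ih
        · omega
        · have := hinv.measure_step h
          right; omega
      · left; rw [step]; simp [h]
  have hinv := inv_iterate (a := a) k
  rcases key k with h | h
  · exact h
  · by_contra hne
    have h1 := hinv.tree_length_le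
    have h2 := lt_of_le_of_ne hinv.row_le hne
    have h3 := Nat.mul_le_mul_right (a.length + 1) (Nat.succ_le_of_lt h2)
    rw [Nat.succ_mul] at h3
    omega

theorem solve_eq : ∃ k, solve a = ((step a)^[k] (init (List.range a.length))).asg ∧
    ((step a)^[k] (init (List.range a.length))).row = a.length := by
  refine ⟨_, by rw [solve, foldl_step], le_row_iterate _ ?_⟩
  -- The list that clocks `solve` has `N * (N + N)` entries, which is at least `N * (N + 1)` when
  -- `N` is positive.
  simp
  rcases Nat.eq_zero_or_pos a.length with h | h
  · simp [h]
  · exact Nat.mul_le_mul_left _ (by omega)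

theorem isPermBelow_solve (a : List (List ℕ)) :
    IsPermBelow a.length fun x => (solve a).getD x 0 := by
  obtain ⟨k, h, -⟩ := solve_eq (a := a)
  rw [h]
  exact (inv_iterate k).perm _ (inv_iterate k).root_mem

/-- The Hungarian method finds an assignment of minimum cost. -/
theorem sum_solve_le {f : ℕ → ℕ} (hf : IsPermBelow a.length f) :
    ∑ x ∈ Finset.range a.length, cost a ((solve a).getD x 0) x ≤
      ∑ x ∈ Finset.range a.length, cost a (f x) x := by
  have hs := isPermBelow_solve a
  obtain ⟨k, h, hrow⟩ := solve_eq (a := a)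
  have hinv := inv_iterate (a := a) k
  generalize (step a)^[k] (init (List.range a.length)) = s at *
  -- Complementary slackness: with `row = a.length` every position of the assignment is tight.
  have h1 : ∀ x ∈ Finset.range a.length, (cost a ((solve a).getD x 0) x : ℤ) =
      s.u.getD ((solve a).getD x 0) 0 + s.v.getD x 0 := fun x hx => by
    have hx' := Finset.mem_range.1 hx
    have hlt := hs.1 x hx'
    dsimp only at hlt
    have := hinv.tight _ hinv.root_mem x hx'
    rw [← h] at this
    have := this (by dsimp only; omega) (by dsimp only; omega)
    dsimp only at this
    rw [slack] at this
    omega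
  have h2 : ∀ x ∈ Finset.range a.length,
      s.u.getD (f x) 0 + s.v.getD x 0 ≤ (cost a (f x) x : ℤ) := fun x hx => by
    have hx' := Finset.mem_range.1 hx
    have := hinv.feasible (f x) (hf.1 x hx') x hx'
    rw [slack] at this
    omega
  -- Weak duality: under any permutation the dual values of the rows have the same sum, so it may be
  -- reindexed from `f` to the computed assignment.
  have h3 := Finset.sum_le_sum h2
  rw [Finset.sum_add_distrib, hf.sum_comp (fun i => s.u.getD i 0), ← hs.sum_comp,
    ← Finset.sum_add_distrib, ← Finset.sum_congr rfl h1] at h3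
  exact_mod_cast h3

end Hungarian

/-! ### Running time of the Hungarian method -/

namespace PolyTime

variable {α β : Type} [Codable α] [Codable β]

@[fun_prop]
theorem minBy [Inhabited β] {f : α → β → ℤ} {l : α → List β} {d : α → β}
    (hf : PolyTime fun p : α × β => f p.1 p.2) (hl : PolyTime l) (hd : PolyTime d) :
    PolyTime fun x => (l x).minBy (f x) (d x) := by
  have h1 : PolyTime fun p : α × β × β => f p.1 p.2.2 :=
    hf.comp (f := fun p : α × β × β => (p.1, p.2.2)) (by fun_prop)
  have h2 : PolyTime fun p : α × β × β => f p.1 p.2.1 :=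
    hf.comp (f := fun p : α × β × β => (p.1, p.2.1)) (by fun_prop)
  refine foldl_of_size_le (init := fun x => (l x).headD (d x))
    (step := fun x b y => bif decide (f x y < f x b) then y else b)
    (by fun_prop) hl (by fun_prop) (S := fun x => size (l x)) hl.polyBdd_size
    fun x s b hb => ?_
  have := size_le_of_mem hb
  cases decide (f x b < f x s) <;> simp only [cond_true, cond_false] <;> omega

end PolyTime

namespace Hungarian

/-- The components of a state. -/
def State.toProd (s : State) : List ℤ × List ℤ × List ℕ × ℕ × List (ℕ × List ℕ) :=
  (s.u, s.v, s.asg, s.row, s.tree)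

instance : Codable State :=
  ⟨Codable.ty (List ℤ × List ℤ × List ℕ × ℕ × List (ℕ × List ℕ)), fun s => Codable.enc s.toProd⟩

theorem size_state (s : State) :
    size s = size s.u + (size s.v + (size s.asg + (size s.row + size s.tree + 1) + 1) + 1) + 1 :=
  rfl

section

variable {α : Type} [Codable α]

theorem polyTime_toProd {s : α → State} (hs : PolyTime s) : PolyTime fun x => (s x).toProd := hs

@[fun_prop]
theorem polyTime_mk {u v : α → List ℤ} {asg : α → List ℕ} {row : α → ℕ}
    {tree : α → List (ℕ × List ℕ)} (hu : PolyTime u) (hv : PolyTime v) (ha : PolyTime asg)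
    (hr : PolyTime row) (ht : PolyTime tree) :
    PolyTime fun x => State.mk (u x) (v x) (asg x) (row x) (tree x) :=
  show PolyTime fun x => (u x, v x, asg x, row x, tree x) by fun_prop

@[fun_prop]
theorem polyTime_u {s : α → State} (hs : PolyTime s) : PolyTime fun x => (s x).u :=
  (polyTime_toProd hs).fst

@[fun_prop]
theorem polyTime_v {s : α → State} (hs : PolyTime s) : PolyTime fun x => (s x).v :=
  (polyTime_toProd hs).snd.fst

@[fun_prop]
theorem polyTime_asg {s : α → State} (hs : PolyTime s) : PolyTime fun x => (s x).asg :=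
  (polyTime_toProd hs).snd.snd.fst

@[fun_prop]
theorem polyTime_row {s : α → State} (hs : PolyTime s) : PolyTime fun x => (s x).row :=
  (polyTime_toProd hs).snd.snd.snd.fst

@[fun_prop]
theorem polyTime_tree {s : α → State} (hs : PolyTime s) : PolyTime fun x => (s x).tree :=
  (polyTime_toProd hs).snd.snd.snd.snd

@[fun_prop]
theorem polyTime_slack {a : α → List (List ℕ)} {u v : α → List ℤ} {i j : α → ℕ}
    (ha : PolyTime a) (hu : PolyTime u) (hv : PolyTime v) (hi : PolyTime i) (hj : PolyTime j) :
    PolyTime fun x => slack (a x) (u x) (v x) (i x) (j x) := by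
  unfold slack cost; fun_prop

@[fun_prop]
theorem polyTime_inTree {S : α → List (ℕ × List ℕ)} {i : α → ℕ}
    (hS : PolyTime S) (hi : PolyTime i) : PolyTime fun x => inTree (S x) (i x) := by
  unfold inTree; fun_prop

@[fun_prop]
theorem polyTime_isOpen {s : α → State} {j : α → ℕ}
    (hs : PolyTime s) (hj : PolyTime j) : PolyTime fun x => isOpen (s x) (j x) := by
  unfold isOpen; fun_prop

@[fun_prop]
theorem polyTime_candidates {N : α → List ℕ} {s : α → State}
    (hN : PolyTime N) (hs : PolyTime s) : PolyTime fun x => candidates (N x) (s x) := by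
  unfold candidates; fun_prop

@[fun_prop]
theorem polyTime_exchange {N ρ : α → List ℕ} {i j : α → ℕ} (hN : PolyTime N) (hρ : PolyTime ρ)
    (hi : PolyTime i) (hj : PolyTime j) :
    PolyTime fun x => exchange (N x) (ρ x) (i x) (j x) := by
  unfold exchange; fun_prop

@[fun_prop]
theorem polyTime_dualRow {N : α → List ℕ} {s : α → State} {δ : α → ℤ}
    (hN : PolyTime N) (hs : PolyTime s) (hδ : PolyTime δ) :
    PolyTime fun x => dualRow (N x) (s x) (δ x) := by
  unfold dualRow; fun_prop

@[fun_prop]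
theorem polyTime_dualCol {N : α → List ℕ} {s : α → State} {δ : α → ℤ}
    (hN : PolyTime N) (hs : PolyTime s) (hδ : PolyTime δ) :
    PolyTime fun x => dualCol (N x) (s x) (δ x) := by
  unfold dualCol; fun_prop

@[fun_prop]
theorem polyTime_updateAt {a : α → List (List ℕ)} {s : α → State} {c : α → (ℕ × List ℕ) × ℕ}
    (ha : PolyTime a) (hs : PolyTime s) (hc : PolyTime c) :
    PolyTime fun x => updateAt (a x) (s x) (c x) := by
  unfold updateAt update grow augment; fun_prop

@[fun_prop]
theorem polyTime_step {a : α → List (List ℕ)} {s : α → State}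
    (ha : PolyTime a) (hs : PolyTime s) : PolyTime fun x => step (a x) (s x) := by
  unfold step; fun_prop

end

variable {a : List (List ℕ)} {s : State}

theorem cost_le (a : List (List ℕ)) (i j : ℕ) : cost a i j ≤ 2 ^ size a := by
  have h : ∀ {β : Type} [Codable β] (l : List β) (i : ℕ) (d : β),
      l.getD i d ∈ l ∨ l.getD i d = d := fun l i d => by
    rw [List.getD_eq_getElem?_getD]
    cases e : l[i]? with
    | none => exact Or.inr rfl
    | some b => exact Or.inl (List.mem_of_getElem? e)
  rw [cost]
  rcases h (a.getD i []) j 0 with h1 | h1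
  · rcases h a i [] with h2 | h2
    · have h3 := PolyTime.size_le_of_mem h1
      have h4 := PolyTime.size_le_of_mem h2
      rw [PolyTime.size_nat] at h3
      exact (Nat.lt_size_self _).le.trans (Nat.pow_le_pow_right (by norm_num) (by omega))
    · rw [h2] at h1; cases h1
  · rw [h1]; exact Nat.zero_le _

/-- The dual values have absolute value at most `U`. -/
def DualBdd (U : ℕ) (s : State) : Prop :=
  (∀ z ∈ s.u, |z| ≤ U) ∧ ∀ z ∈ s.v, |z| ≤ U

theorem abs_getD_le {l : List ℤ} {U : ℕ} (h : ∀ z ∈ l, |z| ≤ U) (i : ℕ) : |l.getD i 0| ≤ U := by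
  rw [List.getD_eq_getElem?_getD]
  cases e : l[i]? with
  | none => simp
  | some b => exact h _ (List.mem_of_getElem? e)

/-- A slack is at most an entry plus two dual values in absolute value, and a dual value changes by
at most one slack. -/
theorem DualBdd.step {U : ℕ} (h : DualBdd U s) : DualBdd (2 ^ size a + 3 * U) (step a s) := by
  have hδ : ∀ i j, |slack a s.u s.v i j| ≤ ((2 ^ size a + 2 * U : ℕ) : ℤ) := fun i j => by
    have h1 := abs_getD_le h.1 i
    have h2 := abs_getD_le h.2 j
    have h3 : (cost a i j : ℤ) ≤ ((2 ^ size a : ℕ) : ℤ) := by exact_mod_cast cost_le a i j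
    rw [slack]
    rw [abs_le] at *
    push_cast at *
    constructor <;> linarith [Int.natCast_nonneg (cost a i j)]
  have hrow : ∀ N i j, ∀ z ∈ dualRow N s (slack a s.u s.v i j),
      |z| ≤ ((2 ^ size a + 3 * U : ℕ) : ℤ) := fun N i j z hz => by
    obtain ⟨x, -, rfl⟩ := List.mem_map.1 hz
    have h1 := abs_getD_le h.1 x
    have h2 := hδ i j
    have h3 : (0 : ℤ) < 2 ^ size a := by positivity
    rw [abs_le] at *
    push_cast at *
    cases inTree s.tree x <;> simp only [cond_true, cond_false] <;> constructor <;> linarith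
  have hcol : ∀ N i j, ∀ z ∈ dualCol N s (slack a s.u s.v i j),
      |z| ≤ ((2 ^ size a + 3 * U : ℕ) : ℤ) := fun N i j z hz => by
    obtain ⟨x, -, rfl⟩ := List.mem_map.1 hz
    have h1 := abs_getD_le h.2 x
    have h2 := hδ i j
    have h3 : (0 : ℤ) < 2 ^ size a := by positivity
    rw [abs_le] at *
    push_cast at *
    cases isOpen s x <;> simp only [cond_true, cond_false] <;> constructor <;> linarith
  rw [Hungarian.step]
  cases decide (s.row < a.length)
  · have h3 : (U : ℤ) ≤ ((2 ^ size a + 3 * U : ℕ) : ℤ) := by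
      push_cast
      have : (0 : ℤ) < 2 ^ size a := by positivity
      linarith
    exact ⟨fun z hz => (h.1 z hz).trans h3, fun z hz => (h.2 z hz).trans h3⟩
  · rw [cond_true, updateAt, update]
    cases decide (s.asg.getD _ 0 < s.row) <;> exact ⟨hrow _ _ _, hcol _ _ _⟩

/-- A factor of 4 per step is a crude estimate, but it costs only two bits per step. -/
theorem dualBdd_iterate (k : ℕ) :
    DualBdd (2 ^ (size a + 2 * k)) ((step a)^[k] (init (List.range a.length))) := by
  induction k with
  | zero =>
    constructor <;> intro z hz <;> obtain ⟨x, -, rfl⟩ := List.mem_map.1 hz <;> simp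
  | succ k ih =>
    rw [Function.iterate_succ_apply']
    have h1 := ih.step (a := a)
    have h2 : 2 ^ size a + 3 * 2 ^ (size a + 2 * k) ≤ 2 ^ (size a + 2 * (k + 1)) := by
      have h3 : 2 ^ size a ≤ 2 ^ (size a + 2 * k) := Nat.pow_le_pow_right (by norm_num) (by omega)
      have h4 : 2 ^ (size a + 2 * (k + 1)) = 4 * 2 ^ (size a + 2 * k) := by ring
      omega
    have h3 : ((2 ^ size a + 3 * 2 ^ (size a + 2 * k) : ℕ) : ℤ) ≤
        ((2 ^ (size a + 2 * (k + 1)) : ℕ) : ℤ) := by exact_mod_cast h2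
    exact ⟨fun z hz => (h1.1 z hz).trans h3, fun z hz => (h1.2 z hz).trans h3⟩

theorem size_le_of_forall {β : Type} [Codable β] {l : List β} {n B : ℕ} (hl : l.length ≤ n)
    (h : ∀ x ∈ l, size x ≤ B) : size l ≤ n * (B + 1) + 1 := by
  rw [PolyTime.size_list]
  have h1 := List.sum_le_card_nsmul (l.map size) B fun y hy => by
    obtain ⟨x, hx, rfl⟩ := List.mem_map.1 hy
    exact h x hx
  rw [List.length_map, smul_eq_mul] at h1
  have h2 := Nat.mul_le_mul_right (B + 1) hl
  rw [Nat.mul_succ] at h2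
  omega

/-- The tree has at most `n + 1` entries, each a list of `n` or fewer numbers below `n` with a
label. Only the dual values can be large, and `k` measures their bits. -/
theorem Inv.size_le (h : Inv a s) {k : ℕ} (hd : DualBdd (2 ^ k) s) {n : ℕ} (hn : a.length ≤ n) :
    size s ≤ 3 * (n * (n + k + 3) + 1) + ((n + 1) * (n * (n + 2) + n + 4) + 1) + n + 6 := by
  have hdual : ∀ l : List ℤ, l.length = a.length → (∀ z ∈ l, |z| ≤ (2 ^ k : ℕ)) →
      size l ≤ n * (n + k + 3) + 1 := fun l hl hz => by
    refine (size_le_of_forall (n := n) (by omega) (B := k + 2) fun z hm => ?_).trans ?_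
    · have h1 := hz z hm
      have h2 : z.natAbs ≤ 2 ^ k := by rw [← Int.natCast_natAbs] at h1; exact_mod_cast h1
      have h3 : z.natAbs.size ≤ k + 1 := Nat.size_le.2 (h2.trans_lt (by
        rw [pow_succ]; have := Nat.two_pow_pos k; omega))
      rw [PolyTime.size_int]; omega
    · have := Nat.mul_le_mul_left n (show k + 2 + 1 ≤ n + k + 3 by omega); omega
  have hasg : ∀ p ∈ s.tree, size p.2 ≤ n * (n + 2) + 1 := fun p hp => by
    refine size_le_of_forall (by rw [h.tree_length p hp]; exact hn) fun y hy => ?_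
    obtain ⟨i, hi, rfl⟩ := List.mem_iff_getElem.1 hy
    have h1 := (h.perm p hp).1 i (by rw [← h.tree_length p hp]; exact hi)
    dsimp only at h1
    rw [List.getD_eq_getElem _ _ hi] at h1
    have := PolyTime.nat_size_le_self p.2[i]
    rw [PolyTime.size_nat]; omega
  have hnat : ∀ i ≤ a.length, size i ≤ n + 1 := fun i hi => by
    have := PolyTime.nat_size_le_self i
    rw [PolyTime.size_nat]; omega
  have htree : size s.tree ≤ (n + 1) * (n * (n + 2) + n + 4) + 1 := by
    refine size_le_of_forall (B := n * (n + 2) + n + 3) (h.tree_length_le.trans (by have := h.row_le; omega)) fun p hp => ?_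
    have h1 := hasg p hp
    have h2 := hnat p.1 ((h.tree_le p hp).trans h.row_le)
    rw [PolyTime.size_prod]; omega
  have h1 := hdual _ h.u_length hd.1
  have h2 := hdual _ h.v_length hd.2
  have h3 := hasg _ h.root_mem
  have h4 := hnat _ h.row_le
  have h5 := Nat.mul_le_mul_left n (show n + 2 ≤ n + k + 3 by omega)
  rw [size_state]
  dsimp only at h3
  omega

@[fun_prop]
theorem polyTime_solve {α : Type} [Codable α] {a : α → List (List ℕ)} (ha : PolyTime a) :
    PolyTime fun x => solve (a x) := by
  have hl : PolyTime fun x => (List.range (a x).length).flatMap fun _ =>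
      List.range (a x).length ++ List.range (a x).length := by fun_prop
  let K : α → ℕ := fun x => size ((List.range (a x).length).flatMap fun _ =>
      List.range (a x).length ++ List.range (a x).length)
  have hK : PolyBdd K := hl.polyBdd_size
  have hn := ha.polyBdd_size
  have hk : PolyBdd fun x => size (a x) + 2 * K x := hn.add ((PolyBdd.const 2).mul hK)
  have c : ∀ c, PolyBdd fun _ : α => c := PolyBdd.const
  have := PolyTime.foldl (init := fun x => init (List.range (a x).length))
    (step := fun x s (_ : ℕ) => step (a x) s) (by unfold init; fun_prop) hl (by fun_prop)
    -- This is the bound of `Inv.size_le` with `n = size (a x)` and `k = size (a x) + 2 * K x`.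
    (((((c 3).mul ((hn.mul ((hn.add hk).add (c 3))).add (c 1))).add
      (((hn.add (c 1)).mul (((hn.mul (hn.add (c 2))).add hn).add (c 4))).add (c 1))).add hn).add
      (c 6))
    fun x i => by
      rw [foldl_step]
      have h1 := PolyTime.length_le_size ((List.range (a x).length).flatMap fun _ =>
        List.range (a x).length ++ List.range (a x).length)
      have h2 : (((List.range (a x).length).flatMap fun _ =>
        List.range (a x).length ++ List.range (a x).length).take i).length ≤ K x :=
        (List.length_take_le' _ _).trans h1
      generalize (((List.range (a x).length).flatMap fun _ =>
        List.range (a x).length ++ List.range (a x).length).take i).length = k at *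
      have h3 := dualBdd_iterate (a := a x) k
      have h4 : 2 ^ (size (a x) + 2 * k) ≤ 2 ^ (size (a x) + 2 * K x) :=
        Nat.pow_le_pow_right (by norm_num) (by omega)
      have h5 : ((2 ^ (size (a x) + 2 * k) : ℕ) : ℤ) ≤ ((2 ^ (size (a x) + 2 * K x) : ℕ) : ℤ) := by
        exact_mod_cast h4
      exact (inv_iterate k).size_le
        ⟨fun z hz => (h3.1 z hz).trans h5, fun z hz => (h3.2 z hz).trans h5⟩
        (PolyTime.length_le_size (a x))
  exact polyTime_asg this

end Hungarian

/-! ## Covering elements of maximum weight by few chains -/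

/-- A set `E` of numbers below `n` with weights `w`, the arcs of a strict order, and the numbers
`st` at which a chain may start. At most `m` chains are available. -/
structure ChainProblem where
  n : ℕ
  m : ℕ
  E : ℕ → Bool
  st : ℕ → Bool
  arc : ℕ → ℕ → Bool
  w : ℕ → ℕ

namespace ChainProblem

/-- The elements are numbers below `n`, and the arcs form a strict order. -/
structure Valid (P : ChainProblem) : Prop where
  lt : ∀ {j}, P.E j = true → j < P.n
  irrefl : ∀ j, P.arc j j = false
  trans : ∀ {i j k}, P.arc i j = true → P.arc j k = true → P.arc i k = true

/-- The total weight. -/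
def total (P : ChainProblem) : ℕ :=
  ((List.range P.n).map fun j => bif P.E j then P.w j else 0).sum

/-- The element or sink `t` may follow the element or unit `s`. -/
def ok (P : ChainProblem) (s t : ℕ) : Bool :=
  decide (P.n ≤ t) || (P.E t && bif decide (s < P.n) then P.E s && P.arc s t else
    decide (s < P.n + P.m) && P.st t)

/-- The cost of letting `t` follow `s`. An element that follows itself is not covered. -/
def entry (P : ChainProblem) (t s : ℕ) : ℕ :=
  bif decide (s = t) then bif P.E t then P.w t else 0 else bif P.ok s t then 0 else P.total + 1

/-- The cost matrix of the assignment problem. -/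
def matrix (P : ChainProblem) : List (List ℕ) :=
  (List.range (P.n + P.n)).map fun t => (List.range (P.n + P.n)).map fun s => P.entry t s

/-- An optimal successor function. -/
def next (P : ChainProblem) : List ℕ := Hungarian.solve P.matrix

/-- The chain that starts with the successor of the unit `u`. -/
def route (P : ChainProblem) (ρ : List ℕ) (u : ℕ) : List ℕ :=
  ((List.range P.n).foldl (fun (c : ℕ × List ℕ) _ =>
    bif decide (c.1 < P.n) then (ρ.getD c.1 0, c.2 ++ [c.1]) else c) (ρ.getD (P.n + u) 0, [])).2

/-- The nonempty chains. -/
def routes (P : ChainProblem) (ρ : List ℕ) : List (List ℕ) :=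
  ((List.range P.n).map fun u => P.route ρ u).filter fun l => decide (0 < l.length)

/-- The covered elements. -/
def met (P : ChainProblem) (ρ : List ℕ) : List ℕ :=
  (List.range P.n).filter fun j => P.E j && !decide (ρ.getD j 0 = j)

variable {P : ChainProblem}

theorem length_matrix : P.matrix.length = P.n + P.n := by simp [matrix]

theorem cost_matrix {s t : ℕ} (hs : s < P.n + P.n) (ht : t < P.n + P.n) :
    Hungarian.cost P.matrix t s = P.entry t s := by
  rw [Hungarian.cost, matrix, List.getD_map_range _ ht, List.getD_map_range _ hs]

theorem perm_next : IsPermBelow (P.n + P.n) fun x => P.next.getD x 0 := by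
  have := Hungarian.isPermBelow_solve P.matrix
  rwa [length_matrix] at this

theorem sum_next_le {f : ℕ → ℕ} (hf : IsPermBelow (P.n + P.n) f) :
    ∑ x ∈ Finset.range (P.n + P.n), P.entry (P.next.getD x 0) x ≤
      ∑ x ∈ Finset.range (P.n + P.n), P.entry (f x) x := by
  have := Hungarian.sum_solve_le (a := P.matrix) (by rwa [length_matrix])
  rw [length_matrix] at this
  rw [← Finset.sum_congr rfl fun x hx => cost_matrix (by simpa using hx)
    (perm_next.1 x (by simpa using hx)), ← Finset.sum_congr rfl fun x hx =>
    cost_matrix (by simpa using hx) (hf.1 x (by simpa using hx))]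
  exact this

theorem total_eq : P.total = ∑ x ∈ Finset.range P.n, if P.E x = true then P.w x else 0 := by
  rw [total, ← List.toFinset_range, List.sum_toFinset _ List.nodup_range]
  simp only [Bool.cond_eq_ite]

theorem sum_ite_E (hP : P.Valid) (q : ℕ → Prop) [DecidablePred q] :
    ∑ x ∈ Finset.range (P.n + P.n), (if P.E x = true ∧ q x then P.w x else 0) =
      ∑ x ∈ Finset.range P.n, if P.E x = true ∧ q x then P.w x else 0 := by
  refine (Finset.sum_subset (Finset.range_subset_range.2 (Nat.le_add_right _ _)) fun x _ hx => ?_).symm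
  rw [if_neg]
  intro h
  exact hx (Finset.mem_range.2 (hP.lt h.1))

theorem entry_self (x : ℕ) : P.entry x x = if P.E x = true then P.w x else 0 := by
  simp [entry, Bool.cond_eq_ite]

/-- The identity, which covers nothing, costs `total`. A single forbidden entry costs more, so an
optimal assignment contains none. -/
theorem ok_next (hP : P.Valid) {s : ℕ} (hs : s < P.n + P.n) (h : P.next.getD s 0 ≠ s) :
    P.ok s (P.next.getD s 0) = true := by
  by_contra hne
  have h1 := sum_next_le (P := P) (f := fun x => x) ⟨fun _ h => h, fun _ _ _ _ h => h⟩
  have h2 := Finset.single_le_sum (f := fun x => P.entry (P.next.getD x 0) x)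
    (fun _ _ => Nat.zero_le _) (Finset.mem_range.2 hs)
  have h3 : P.entry (P.next.getD s 0) s = P.total + 1 := by
    rw [entry, decide_eq_false (Ne.symm h), Bool.eq_false_iff.2 hne]; rfl
  have h4 := sum_ite_E hP fun _ => True
  simp only [and_true, ← total_eq] at h4
  simp only [entry_self, h4] at h1
  omega

theorem sum_weight_unmet_le (hP : P.Valid) :
    ∑ x ∈ Finset.range P.n, (if P.E x = true ∧ P.next.getD x 0 = x then P.w x else 0) ≤
      ∑ x ∈ Finset.range (P.n + P.n), P.entry (P.next.getD x 0) x := by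
  rw [← sum_ite_E hP fun x => P.next.getD x 0 = x]
  refine Finset.sum_le_sum fun x _ => ?_
  split_ifs with h
  · rw [h.2, entry_self, if_pos h.1]
  · exact Nat.zero_le _

/-- The first `k` elements of the chain with first element `c`. -/
def follow (P : ChainProblem) (ρ : List ℕ) : ℕ → ℕ → List ℕ
  | 0, _ => []
  | k + 1, c => if c < P.n then c :: follow P ρ k (ρ.getD c 0) else []

/-- `follow` has the recursive form needed for inductions. Once the fold has reached a sink it no
longer changes. -/
theorem route_eq (ρ : List ℕ) (u : ℕ) :
    P.route ρ u = P.follow ρ P.n (ρ.getD (P.n + u) 0) := by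
  have key : ∀ (l : List ℕ) (c : ℕ) (acc : List ℕ), (l.foldl (fun (c : ℕ × List ℕ) _ =>
      bif decide (c.1 < P.n) then (ρ.getD c.1 0, c.2 ++ [c.1]) else c) (c, acc)).2 =
      acc ++ P.follow ρ l.length c := by
    intro l
    induction l with
    | nil => intro c acc; simp [follow]
    | cons _ l ih =>
      intro c acc
      rw [List.foldl_cons, List.length_cons, follow]
      by_cases h : c < P.n
      · simp only [h, decide_true, cond_true, if_true]
        rw [ih]; simp
      · simp only [h, decide_false, cond_false, if_false]
        rw [ih]
        cases l <;> simp [follow, h]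
  rw [route, key]; simp

theorem take_follow (ρ : List ℕ) (k l c : ℕ) : (P.follow ρ (k + l) c).take k = P.follow ρ k c := by
  induction k generalizing c with
  | zero => simp [follow]
  | succ k ih =>
    rw [Nat.succ_add, follow, follow]
    split_ifs
    · rw [List.take_succ_cons, ih]
    · rfl

theorem next_mem_follow (ρ : List ℕ) {k c x : ℕ} (h : x ∈ P.follow ρ k c)
    (hx : ρ.getD x 0 < P.n) : ρ.getD x 0 ∈ P.follow ρ (k + 1) c := by
  induction k generalizing c with
  | zero => simp [follow] at h
  | succ k ih =>
    rw [follow] at h ⊢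
    split_ifs at h ⊢ with hc
    · rcases List.mem_cons.1 h with rfl | h
      · rw [follow, if_pos hx]; simp
      · exact List.mem_cons_of_mem _ (ih h)
    · simp at h

theorem lt_of_mem_follow {ρ : List ℕ} {k c x : ℕ} (h : x ∈ P.follow ρ k c) : x < P.n := by
  induction k generalizing c with
  | zero => simp [follow] at h
  | succ k ih =>
    rw [follow] at h
    split_ifs at h with hc
    · rcases List.mem_cons.1 h with rfl | h
      · exact hc
      · exact ih h
    · simp at h

/-- Allowed steps from a covered element lead to a sink or along an arc. By injectivity the next
element is not its own successor, hence is covered too; transitivity then relates all pairs of the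
chain. -/
theorem follow_spec (hP : P.Valid) (k c : ℕ)
    (hc : c < P.n → P.E c = true ∧ P.next.getD c 0 ≠ c) :
    (∀ x ∈ P.follow P.next k c, P.E x = true ∧ P.next.getD x 0 ≠ x) ∧
      (P.follow P.next k c).Pairwise fun i j => P.arc i j = true := by
  induction k generalizing c with
  | zero => simp [follow]
  | succ k ih =>
    rw [follow]
    split_ifs with h
    · obtain ⟨h1, h2⟩ := hc h
      have hok := ok_next hP (by omega) h2
      have hlt := perm_next.1 c (show c < P.n + P.n by omega)
      dsimp only at hlt
      have harc : P.next.getD c 0 < P.n → P.E (P.next.getD c 0) = true ∧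
          P.arc c (P.next.getD c 0) = true := fun h3 => by
        simp only [ok, h, decide_true, cond_true, Bool.or_eq_true, decide_eq_true_eq,
          Bool.and_eq_true] at hok
        rcases hok with h4 | h4
        · omega
        · exact ⟨h4.1, h4.2.2⟩
      obtain ⟨h5, h6⟩ := ih (P.next.getD c 0) fun h3 => ⟨(harc h3).1, fun e =>
        h2 (perm_next.2 _ hlt c (by omega) e)⟩
      refine ⟨List.forall_mem_cons.2 ⟨⟨h1, h2⟩, h5⟩, List.pairwise_cons.2 ⟨fun x hx => ?_, h6⟩⟩
      cases k with
      | zero => simp [follow] at hx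
      | succ k =>
        rw [follow] at hx h6
        split_ifs at hx h6 with h7
        · rcases List.mem_cons.1 hx with rfl | hx
          · exact (harc h7).2
          · exact hP.trans (harc h7).2 ((List.pairwise_cons.1 h6).1 x hx)
        · simp at hx
    · simp

theorem first_spec (hP : P.Valid) {u : ℕ} (hu : u < P.n) (h : P.next.getD (P.n + u) 0 < P.n) :
    (P.E (P.next.getD (P.n + u) 0) = true ∧
      P.next.getD (P.next.getD (P.n + u) 0) 0 ≠ P.next.getD (P.n + u) 0) ∧
      u < P.m ∧ P.st (P.next.getD (P.n + u) 0) = true := by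
  have h1 : P.next.getD (P.n + u) 0 ≠ P.n + u := by omega
  have h2 := ok_next hP (by omega) h1
  simp only [ok, Bool.or_eq_true, decide_eq_true_eq, Bool.and_eq_true,
    show ¬ (P.n + u < P.n) by omega, decide_false, cond_false] at h2
  rcases h2 with h2 | h2
  · omega
  · exact ⟨⟨h2.1, fun e => h1 (perm_next.2 _ (by omega) _ (by omega) e)⟩, by omega, h2.2.2⟩

theorem length_le_of_pairwise (hP : P.Valid) {l : List ℕ} (hl : ∀ x ∈ l, x < P.n)
    (h : l.Pairwise fun i j => P.arc i j = true) : l.length ≤ P.n := by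
  have hn : l.Nodup := h.imp fun {i j} hij e => by
    subst e; rw [hP.irrefl] at hij; cases hij
  have : l.toFinset ⊆ Finset.range P.n := fun x hx => by
    simpa using hl x (by simpa using hx)
  have := Finset.card_le_card this
  rwa [List.toFinset_card_of_nodup hn, Finset.card_range] at this

theorem mem_routes {ρ : List ℕ} {l : List ℕ} : l ∈ P.routes ρ ↔
    l ≠ [] ∧ ∃ u < P.n, P.follow ρ P.n (ρ.getD (P.n + u) 0) = l := by
  simp only [routes, List.mem_filter, List.mem_map, List.mem_range, route_eq, decide_eq_true_eq,
    List.length_pos_iff]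
  tauto

theorem routes_spec (hP : P.Valid) {l : List ℕ} (hl : l ∈ P.routes P.next) :
    (∃ c, l.head? = some c ∧ P.st c = true) ∧ (l.Pairwise fun i j => P.arc i j = true) ∧
      ∀ x ∈ l, P.E x = true := by
  obtain ⟨hne, u, hu, rfl⟩ := mem_routes.1 hl
  have h1 : P.next.getD (P.n + u) 0 < P.n := by
    obtain ⟨k, hk⟩ := Nat.exists_eq_succ_of_ne_zero (show P.n ≠ 0 by omega)
    by_contra h
    rw [show P.follow P.next P.n = P.follow P.next (k + 1) by rw [hk], follow, if_neg h] at hne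
    exact hne rfl
  obtain ⟨h2, -, h3⟩ := first_spec hP hu h1
  obtain ⟨h4, h5⟩ := follow_spec hP P.n _ fun _ => h2
  refine ⟨⟨_, ?_, h3⟩, h5, fun x hx => (h4 x hx).1⟩
  obtain ⟨k, hk⟩ := Nat.exists_eq_succ_of_ne_zero (show P.n ≠ 0 by omega)
  conv_lhs => rw [show P.follow P.next P.n = P.follow P.next (k + 1) by rw [hk]]
  rw [follow, if_pos h1]; rfl

/-- Only a unit with index below `m` may be followed by an element, so the other routes are empty
and filtered out. -/
theorem length_routes_le (hP : P.Valid) : (P.routes P.next).length ≤ P.m := by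
  rw [routes, List.filter_map, List.length_map]
  have h1 : ((List.range P.n).filter
      ((fun l : List ℕ => decide (0 < l.length)) ∘ fun u => P.route P.next u)).toFinset ⊆
      Finset.range P.m := fun u hu => by
    simp only [List.mem_toFinset, List.mem_filter, List.mem_range, Function.comp_apply,
      decide_eq_true_eq, route_eq] at hu
    obtain ⟨hu, hl⟩ := hu
    rw [Finset.mem_range]
    refine (first_spec hP hu ?_).2.1
    obtain ⟨k, hk⟩ := Nat.exists_eq_succ_of_ne_zero (show P.n ≠ 0 by omega)
    by_contra h
    rw [show P.follow P.next P.n = P.follow P.next (k + 1) by rw [hk], follow, if_neg h] at hl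
    exact absurd hl (by simp)
  have h2 := Finset.card_le_card h1
  rwa [List.toFinset_card_of_nodup (List.nodup_range.filter _), Finset.card_range] at h2

/-- Walking back along predecessors never closes a cycle, because arcs form a strict order. The walk
must end at a unit, and its route contains `x`. -/
theorem exists_mem_routes (hP : P.Valid) {x : ℕ} (hx : P.E x = true) (hne : P.next.getD x 0 ≠ x) :
    ∃ l ∈ P.routes P.next, x ∈ l := by
  -- The induction is on the number of elements from which an arc leads to `x`; it drops strictly
  -- when `x` is replaced by its predecessor.
  have key : ∀ (N x : ℕ), ((Finset.range P.n).filter fun y => P.arc y x = true).card < N →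
      P.E x = true → P.next.getD x 0 ≠ x →
      ∃ u < P.n, ∃ k, x ∈ P.follow P.next k (P.next.getD (P.n + u) 0) := by
    intro N
    induction N with
    | zero => intro x h; exact absurd h (Nat.not_lt_zero _)
    | succ N ih =>
      intro x hN hx hne
      have hxn := hP.lt hx
      obtain ⟨s, hs, rfl⟩ := perm_next.exists_eq (show x < P.n + P.n by omega)
      have hsne : P.next.getD s 0 ≠ s := fun e => hne (by rw [e, e])
      have hok := ok_next hP hs hsne
      by_cases hsn : s < P.n
      · simp only [ok, hsn, decide_true, cond_true, Bool.or_eq_true, decide_eq_true_eq,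
          Bool.and_eq_true, show ¬ (P.n ≤ P.next.getD s 0) by omega, false_or] at hok
        obtain ⟨-, hEs, harc⟩ := hok
        have hsub : (Finset.range P.n).filter (fun y => P.arc y s = true) ⊂
            (Finset.range P.n).filter fun y => P.arc y (P.next.getD s 0) = true := by
          refine (Finset.ssubset_iff_of_subset fun y hy => ?_).2
            ⟨s, Finset.mem_filter.2 ⟨Finset.mem_range.2 hsn, harc⟩, by simp [hP.irrefl]⟩
          have hy := Finset.mem_filter.1 hy
          exact Finset.mem_filter.2 ⟨hy.1, hP.trans hy.2 harc⟩
        obtain ⟨u, hu, k, hk⟩ := ih s ((Finset.card_lt_card hsub).trans_le (Nat.lt_succ_iff.1 hN))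
          hEs hsne
        exact ⟨u, hu, k + 1, next_mem_follow _ hk hxn⟩
      · refine ⟨s - P.n, by omega, 1, ?_⟩
        rw [show P.n + (s - P.n) = s by omega, follow, if_pos hxn]
        simp
  obtain ⟨u, hu, k, hk⟩ := key _ x (Nat.lt_succ_self _) hx hne
  -- A chain has no repetitions, hence at most `n` elements, so cutting routes at length `n` loses
  -- nothing.
  have h1 := (follow_spec hP (P.n + k) (P.next.getD (P.n + u) 0) fun h => (first_spec hP hu h).1).2
  have h2 := length_le_of_pairwise hP (fun _ h => lt_of_mem_follow h) h1
  have h3 := take_follow (P := P) P.next P.n k (P.next.getD (P.n + u) 0)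
  rw [List.take_of_length_le h2] at h3
  have h4 := take_follow (P := P) P.next k P.n (P.next.getD (P.n + u) 0)
  rw [Nat.add_comm k, h3] at h4
  rw [← h4] at hk
  have hk := List.mem_of_mem_take hk
  exact ⟨_, mem_routes.2 ⟨List.ne_nil_of_mem hk, u, hu, rfl⟩, hk⟩

/-- A finite set of pairwise comparable elements is sorted by a strict order. -/
theorem exists_sorted (hP : P.Valid) (l : List ℕ)
    (hl : l.Pairwise fun i j => P.arc i j = true ∨ P.arc j i = true) :
    ∃ l' : List ℕ, (∀ x, x ∈ l' ↔ x ∈ l) ∧ l'.Pairwise fun i j => P.arc i j = true := by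
  induction l with
  | nil => exact ⟨[], by simp⟩
  | cons a l ih =>
    obtain ⟨h1, h2⟩ := List.pairwise_cons.1 hl
    obtain ⟨l', h3, h4⟩ := ih h2
    refine ⟨l'.filter (fun x => P.arc x a) ++ a :: l'.filter (fun x => P.arc a x), fun x => ?_, ?_⟩
    · simp only [List.mem_append, List.mem_cons, List.mem_filter, h3]
      constructor
      · rintro (h | h | h)
        · exact Or.inr h.1
        · exact Or.inl h
        · exact Or.inr h.1
      · rintro (h | h)
        · exact Or.inr (Or.inl h)
        · rcases h1 x h with h5 | h5
          · exact Or.inr (Or.inr ⟨h, h5⟩)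
          · exact Or.inl ⟨h, h5⟩
    · refine List.pairwise_append.2 ⟨h4.filter _, List.pairwise_cons.2 ⟨fun x hx =>
        (List.mem_filter.1 hx).2, h4.filter _⟩, fun x hx y hy => ?_⟩
      have h5 := (List.mem_filter.1 hx).2
      rcases List.mem_cons.1 hy with rfl | hy
      · exact h5
      · exact hP.trans h5 (List.mem_filter.1 hy).2

/-- Each chain is freed of the elements already covered by the others. What is left is still sorted,
by transitivity, and empty chains are dropped. -/
theorem exists_disjoint (hP : P.Valid) (ps : List (List ℕ))
    (hps : ∀ p ∈ ps, p.Pairwise fun i j => P.arc i j = true ∨ P.arc j i = true) :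
    ∃ qs : List (List ℕ), qs.length ≤ ps.length ∧ (∀ x, x ∈ qs.flatten ↔ x ∈ ps.flatten) ∧
      qs.flatten.Nodup ∧ ∀ q ∈ qs, q ≠ [] ∧ q.Pairwise fun i j => P.arc i j = true := by
  induction ps with
  | nil => exact ⟨[], by simp⟩
  | cons p ps ih =>
    obtain ⟨hp, hps⟩ := List.forall_mem_cons.1 hps
    obtain ⟨qs, h1, h2, h3, h4⟩ := ih hps
    obtain ⟨q, h5, h6⟩ := exists_sorted hP p hp
    by_cases hq : q.filter (fun x => decide (x ∉ qs.flatten)) = []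
    · refine ⟨qs, by simp; omega, fun x => ?_, h3, h4⟩
      rw [List.flatten_cons, List.mem_append, ← h5, ← h2]
      rw [List.filter_eq_nil_iff] at hq
      have := hq x
      simp only [decide_eq_true_eq, not_not] at this
      tauto
    · refine ⟨q.filter (fun x => decide (x ∉ qs.flatten)) :: qs, by simp; omega, fun x => ?_, ?_,
        List.forall_mem_cons.2 ⟨⟨hq, h6.filter _⟩, h4⟩⟩
      · rw [List.flatten_cons, List.mem_append, List.flatten_cons, List.mem_append, ← h5, ← h2,
          List.mem_filter, decide_eq_true_eq]
        tauto
      · rw [List.flatten_cons]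
        refine List.nodup_append'.2 ⟨(h6.filter _).imp fun {i j} hij e => ?_, h3, fun x hx hx' => ?_⟩
        · subst e; rw [hP.irrefl] at hij; cases hij
        · simpa [hx'] using (List.mem_filter.1 hx).2

/-- The cycle runs from the unit `u` through the chain and back to `u`. As a target, the index `u`
stands for a sink, so closing the cycle is allowed. -/
theorem formPerm_ok {q : List ℕ} {u : ℕ} (hq : (u :: q).Nodup) (hu : P.n ≤ u)
    (hc : (u :: q).IsChain fun s t => P.ok s t = true) {x : ℕ} (hx : x ∈ u :: q) :
    P.ok x ((u :: q).formPerm x) = true := by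
  obtain ⟨i, hi, rfl⟩ := List.mem_iff_getElem.1 hx
  by_cases h : i + 1 < (u :: q).length
  · rw [List.formPerm_apply_lt_getElem _ hq i h]
    exact List.isChain_iff_getElem.1 hc i h
  · have : i = q.length := by simp at hi h; omega
    subst this
    rw [List.formPerm_apply_getElem_length]
    simp [ok, hu]

/-- The permutation is a product of disjoint cycles, one for each chain, each through a unit of its
own. All other indices stay fixed, that is, uncovered or unused. -/
theorem exists_perm (hP : P.Valid) (qs : List (List ℕ)) (hn : qs.flatten.Nodup)
    (hm : qs.length ≤ P.m)
    (h : ∀ q ∈ qs, (q.Pairwise fun i j => P.arc i j = true) ∧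
      ∀ x ∈ q, P.E x = true ∧ P.st x = true) :
    ∃ π : Equiv.Perm ℕ, ∀ x,
      (P.ok x (π x) = true ∧ (x ∈ qs.flatten ∨ P.n ≤ x ∧ x < P.n + qs.length)) ∨
      (π x = x ∧ x ∉ qs.flatten ∧ ¬ (P.n ≤ x ∧ x < P.n + qs.length)) := by
  induction qs with
  | nil => exact ⟨1, fun x => Or.inr ⟨rfl, by simp, by simp⟩⟩
  | cons q qs ih =>
    rw [List.flatten_cons] at hn
    obtain ⟨hn1, hn2, hn3⟩ := List.nodup_append'.1 hn
    obtain ⟨⟨h1, h2⟩, h3⟩ := List.forall_mem_cons.1 h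
    rw [List.length_cons] at hm
    obtain ⟨π, hπ⟩ := ih hn2 (by omega) h3
    have hlt : ∀ x ∈ q, x < P.n := fun x hx => hP.lt (h2 x hx).1
    have hlt' : ∀ x ∈ qs.flatten, x < P.n := fun x hx => by
      obtain ⟨q', hq', hx'⟩ := List.mem_flatten.1 hx
      exact hP.lt ((h3 q' hq').2 x hx').1
    have hnd : ((P.n + qs.length) :: q).Nodup :=
      List.nodup_cons.2 ⟨fun hx => by have := hlt _ hx; omega, hn1⟩
    have hchain : ((P.n + qs.length) :: q).IsChain fun s t => P.ok s t = true := by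
      have hc : q.IsChain fun s t => P.ok s t = true :=
        List.Pairwise.isChain (List.Pairwise.imp_of_mem (fun {a b} ha hb hab => by
          simp [ok, hlt a ha, (h2 b hb).1, (h2 a ha).1, hab]) h1)
      cases q with
      | nil => exact List.isChain_singleton _
      | cons c q =>
        refine List.isChain_cons_cons.2 ⟨?_, hc⟩
        have := h2 c List.mem_cons_self
        simp [ok, this.1, this.2]; omega
    refine ⟨((P.n + qs.length) :: q).formPerm * π, fun x => ?_⟩
    rw [Equiv.Perm.mul_apply, List.flatten_cons, List.mem_append, List.length_cons]
    by_cases hx : x ∈ (P.n + qs.length) :: q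
    · have hfix : π x = x := by
        rcases hπ x with h4 | h4
        · exfalso
          rcases List.mem_cons.1 hx with rfl | hx
          · rcases h4.2 with h5 | h5
            · have := hlt' _ h5; omega
            · omega
          · have := hlt x hx
            rcases h4.2 with h5 | h5
            · exact hn3 hx h5
            · omega
        · exact h4.1
      left
      rw [hfix]
      refine ⟨formPerm_ok hnd (Nat.le_add_right _ _) hchain hx, ?_⟩
      rcases List.mem_cons.1 hx with rfl | hx
      · right; omega
      · exact Or.inl (Or.inl hx)
    · have hπx : π x ∉ (P.n + qs.length) :: q := fun hmem => by
        have hfix : π (π x) = π x := by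
          rcases hπ (π x) with h4 | h4
          · exfalso
            rcases List.mem_cons.1 hmem with e | hmem
            · rcases h4.2 with h5 | h5
              · have := hlt' _ h5; omega
              · omega
            · have := hlt _ hmem
              rcases h4.2 with h5 | h5
              · exact hn3 hmem h5
              · omega
          · exact h4.1
        exact hx (π.injective hfix ▸ hmem)
      rw [List.formPerm_apply_of_notMem hπx]
      rw [List.mem_cons, not_or] at hx
      rcases hπ x with h4 | h4
      · refine Or.inl ⟨h4.1, ?_⟩
        rcases h4.2 with h5 | h5
        · exact Or.inl (Or.inr h5)
        · right; omega
      · exact Or.inr ⟨h4.1, by tauto, by omega⟩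

/-- The given chains yield an assignment that costs at most the weight they leave uncovered, while
the optimal assignment costs at least the weight outside `met`. Comparing complements in `total`
gives the claim. -/
theorem sum_weight_le (hP : P.Valid) (Y : Finset ℕ) (ps : List (List ℕ)) (hm : ps.length ≤ P.m)
    (hps : ∀ p ∈ ps, (p.Pairwise fun i j => P.arc i j = true ∨ P.arc j i = true) ∧
      ∀ x ∈ p, P.E x = true ∧ P.st x = true)
    (hY : ∀ y ∈ Y, ∃ p ∈ ps, y ∈ p) :
    ∑ y ∈ Y, P.w y ≤ ((P.met P.next).map P.w).sum := by
  obtain ⟨qs, h1, h2, h3, h4⟩ := exists_disjoint hP ps fun p hp => (hps p hp).1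
  have hE : ∀ x ∈ qs.flatten, P.E x = true ∧ P.st x = true := fun x hx => by
    obtain ⟨p, hp, hxp⟩ := List.mem_flatten.1 ((h2 x).1 hx)
    exact (hps p hp).2 x hxp
  have hlen : qs.length ≤ P.n := by
    have a1 : qs.flatten.length ≤ P.n := by
      have : qs.flatten.toFinset ⊆ Finset.range P.n := fun x hx => by
        simpa using hP.lt (hE x (by simpa using hx)).1
      have := Finset.card_le_card this
      rwa [List.toFinset_card_of_nodup h3, Finset.card_range] at this
    have a2 : ∀ qs : List (List ℕ), (∀ q ∈ qs, q ≠ []) → qs.length ≤ qs.flatten.length := by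
      intro qs
      induction qs with
      | nil => simp
      | cons q qs ih =>
        intro h
        obtain ⟨b1, b2⟩ := List.forall_mem_cons.1 h
        have := ih b2
        have := List.length_pos_iff.2 b1
        rw [List.flatten_cons, List.length_append, List.length_cons]; omega
    exact (a2 qs fun q hq => (h4 q hq).1).trans a1
  obtain ⟨π, hπ⟩ := exists_perm hP qs h3 (h1.trans hm) fun q hq =>
    ⟨(h4 q hq).2, fun x hx => hE x (List.mem_flatten.2 ⟨q, hq, hx⟩)⟩
  have hperm : IsPermBelow (P.n + P.n) π := by
    refine ⟨fun x hx => ?_, fun x _ y _ e => π.injective e⟩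
    -- An index of `2n` or more lies on no cycle and is fixed, so nothing smaller is mapped to it.
    by_contra hge
    rcases hπ (π x) with h5 | h5
    · rcases h5.2 with h6 | h6
      · have := hP.lt (hE _ h6).1; omega
      · omega
    · rw [π.injective h5.1] at hge; exact hge hx
  have h5 : ∑ x ∈ Finset.range (P.n + P.n), P.entry (π x) x ≤
      ∑ x ∈ Finset.range P.n, if P.E x = true ∧ x ∉ qs.flatten then P.w x else 0 := by
    rw [← sum_ite_E hP fun x => x ∉ qs.flatten]
    refine Finset.sum_le_sum fun x _ => ?_
    rcases hπ x with h6 | h6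
    · by_cases e : x = π x
      · rw [← e] at h6
        have hxE : P.E x = false := by
          rw [Bool.eq_false_iff]
          intro hxE
          have hxn := hP.lt hxE
          have := h6.1
          simp [ok, hxn, hxE, hP.irrefl] at this
          omega
        rw [← e, entry_self, hxE]; simp
      · rw [entry, decide_eq_false e, h6.1]; exact Nat.zero_le _
    · rw [h6.1, entry_self]
      by_cases hxE : P.E x = true
      · rw [if_pos hxE, if_pos ⟨hxE, h6.2.1⟩]
      · rw [if_neg hxE]; exact Nat.zero_le _
  have h6 := ((sum_weight_unmet_le hP).trans (sum_next_le hperm)).trans h5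
  have split : ∀ (q : ℕ → Prop) [DecidablePred q],
      ∑ x ∈ Finset.range P.n, (if P.E x = true ∧ q x then P.w x else 0) +
      ∑ x ∈ Finset.range P.n, (if P.E x = true ∧ ¬ q x then P.w x else 0) = P.total := by
    intro q _
    rw [total_eq, ← Finset.sum_add_distrib]
    refine Finset.sum_congr rfl fun x _ => ?_
    by_cases a : P.E x = true <;> by_cases b : q x <;> simp [a, b]
  have h7 := split fun x => P.next.getD x 0 = x
  have h8 := split fun x => x ∈ qs.flatten
  have h9 : ((P.met P.next).map P.w).sum =
      ∑ x ∈ Finset.range P.n, if P.E x = true ∧ ¬ P.next.getD x 0 = x then P.w x else 0 := by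
    rw [← Finset.sum_filter, met, ← List.sum_toFinset _ (List.nodup_range.filter _)]
    congr 1
    ext x
    simp
  have h10 : ∑ y ∈ Y, P.w y ≤
      ∑ x ∈ Finset.range P.n, if P.E x = true ∧ x ∈ qs.flatten then P.w x else 0 := by
    rw [← Finset.sum_filter]
    refine Finset.sum_le_sum_of_subset fun y hy => ?_
    obtain ⟨p, hp, hyp⟩ := hY y hy
    have hyE := ((hps p hp).2 y hyp).1
    exact Finset.mem_filter.2 ⟨Finset.mem_range.2 (hP.lt hyE), hyE,
      (h2 y).2 (List.mem_flatten.2 ⟨p, hp, hyp⟩)⟩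
  omega

end ChainProblem

/-! ### Feasibility and approximation guarantee of Algorithm B -/

namespace MRMD

variable {D R L : Type}

theorem le_opt (I : MRMD D R L) [DecidableEq R] [Fintype D] {σ : Solution D R L}
    (h : I.Feasible σ) : I.reward σ ≤ I.opt := I.isGreatest_opt.2 ⟨σ, h, rfl⟩

theorem isOptimal_iff (I : MRMD D R L) [DecidableEq R] [Fintype D] {σ : Solution D R L} :
    I.IsOptimal σ ↔ I.Feasible σ ∧ ∀ σ', I.Feasible σ' → I.reward σ' ≤ I.reward σ := by
  constructor
  · exact fun h => ⟨h.1, fun σ' h' => (I.le_opt h').trans_eq h.2.symm⟩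
  · intro h
    obtain ⟨σ', h1, h2⟩ := I.isGreatest_opt.1
    exact ⟨h.1, (I.le_opt h.1).antisymm (h2 ▸ h.2 σ' h1)⟩

/-- Demand `j` can be served after demand `i` by the same unit. -/
def Precedes (I : MRMD D R L) (i j : D) : Prop := I.τ i + I.Δ i + I.fD i j ≤ I.τ j

theorem Precedes.trans {I : MRMD D R L} (hΔ : ∀ d, 0 ≤ I.Δ d) (hT : I.TriangleIneq) {i j k : D}
    (h1 : I.Precedes i j) (h2 : I.Precedes j k) : I.Precedes i k := by
  have := hT.1 i j k
  have := hΔ j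
  simp only [Precedes] at *
  omega

theorem IsPath.pairwise {I : MRMD D R L} [DecidableEq R] (hΔ : ∀ d, 0 ≤ I.Δ d)
    (hT : I.TriangleIneq) {r : R} {s : L} {p : List D} (h : I.IsPath r s p) :
    p.Pairwise I.Precedes := by
  have : IsTrans D I.Precedes := ⟨fun _ _ _ => Precedes.trans hΔ hT⟩
  exact (h.2.1.imp fun _ _ hab => hab.1).pairwise

/-- Because of the triangle inequality a unit may go directly to any demand of its route. With
transitivity of precedence, nonempty sublists of a route remain routes. -/
theorem IsPath.reachable {I : MRMD D R L} [DecidableEq R] (hΔ : ∀ d, 0 ≤ I.Δ d)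
    (hT : I.TriangleIneq) {r : R} {s : L} {p : List D} (h : I.IsPath r s p) :
    ∀ d ∈ p, I.fS s d ≤ I.τ d := by
  have hp := h.pairwise hΔ hT
  obtain ⟨c, hc, hB⟩ := h.1
  cases p with
  | nil => cases hc
  | cons c' p =>
    obtain rfl := Option.some.inj hc
    refine List.forall_mem_cons.2 ⟨hB.1, fun d hd => ?_⟩
    have h1 := (List.pairwise_cons.1 hp).1 d hd
    have h2 := hT.2 s c' d
    have h3 := hΔ c'
    have h4 := hB.1
    simp only [Precedes] at *
    omega

theorem IsPath.mem_S {I : MRMD D R L} [DecidableEq R] {r : R} {s : L} {p : List D}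
    (h : I.IsPath r s p) : s ∈ I.S r := by
  obtain ⟨_, _, hB⟩ := h.1
  exact hB.2.1

theorem SameStart.S_eq {I : MRMD D R L} (h : I.SameStart) {r r' : R} {s : L} (hs : s ∈ I.S r) :
    I.S r' = ∅ ∨ I.S r' = {s} := by
  rcases (I.S r').eq_empty_or_nonempty with e | ⟨t, ht⟩
  · exact Or.inl e
  · right
    ext x
    rw [Finset.mem_singleton]
    exact ⟨fun hx => h _ _ _ _ hx hs, fun hx => hx ▸ (h _ _ _ _ ht hs ▸ ht)⟩

section

variable [Fintype D] [LinearOrder R] (I : MRMD D R L)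

theorem mem_scarcest {v : I.Node} {r : R} : r ∈ I.scarcest v ↔
    r ∈ v.1 ∧ ∀ r' ∈ v.1, I.numUnits r ≤ I.numUnits r' := Finset.mem_filter

theorem rep_mem (v : I.Node) : I.rep v ∈ v.1 :=
  (I.mem_scarcest.1 (Finset.min'_mem _ (I.scarcest_nonempty v))).1

theorem numUnits_rep_le (v : I.Node) {r : R} (hr : r ∈ v.1) :
    I.numUnits (I.rep v) ≤ I.numUnits r :=
  (I.mem_scarcest.1 (Finset.min'_mem _ (I.scarcest_nonempty v))).2 r hr

variable {I}

/-- With one location, comparing the totals `numUnits` means comparing the numbers of units there. A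
type that starts nowhere has total 0 and cannot belong to `v` when `rep v` has units. -/
theorem SameStart.rep_le (h : I.SameStart) {v : I.Node} {r : R} (hr : r ∈ v.1) {s : L}
    (hs : s ∈ I.S (I.rep v)) (hl : 0 < I.l (I.rep v) s) :
    s ∈ I.S r ∧ I.l (I.rep v) s ≤ I.l r s := by
  have h1 := I.numUnits_rep_le v hr
  have h2 : I.S (I.rep v) = {s} := (h.S_eq (r' := I.rep v) hs).resolve_left fun e => by
    rw [e] at hs; simp at hs
  rcases h.S_eq (r' := r) hs with e | e
  · simp only [numUnits, h2, e, Finset.sum_singleton, Finset.sum_empty] at h1; omega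
  · simp only [numUnits, h2, e, Finset.sum_singleton] at h1
    exact ⟨by simp [e], h1⟩

theorem isPath_map_val {v : I.Node} {r : R} {s : L} (hr : r ∈ v.1) (hs : s ∈ I.S r)
    {p : List {d : D // I.M d = v.1}} (hp : (I.sub v).IsPath () s p) :
    I.IsPath r s (p.map Subtype.val) := by
  obtain ⟨⟨d, hd, hB⟩, h1, h2, h3⟩ := hp
  refine ⟨⟨d, by rw [List.head?_map, hd]; rfl, hB.1, hs, by rw [d.2]; exact hr⟩, ?_, ?_,
    h3.map Subtype.val_injective⟩
  · rw [List.isChain_map]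
    exact h1.imp fun a b hab => ⟨hab.1, by rw [a.2, b.2, Finset.inter_self]; exact ⟨r, hr⟩⟩
  · intro d hd
    obtain ⟨d', -, rfl⟩ := List.mem_map.1 hd
    rw [d'.2]; exact hr

variable {χ : ℕ} {c : I.conflictGraph.Coloring (Fin χ)} {σs : I.SubSolutions}

theorem eq_of_color {u v : I.Node} (h : c u = c v) {r : R} (hu : r ∈ u.1) (hv : r ∈ v.1) :
    u = v := by
  by_contra hne
  exact c.valid (show I.conflictGraph.Adj u v from ⟨hne, r, Finset.mem_inter.2 ⟨hu, hv⟩⟩) h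

theorem bestColor_spec : (0 ≤ (I.bestColor c σs).1 ∧ ∀ i, I.colorValue c σs i ≤
      (I.bestColor c σs).1) ∧
    (((I.bestColor c σs).2 = none ∧ (I.bestColor c σs).1 = 0) ∨
      ∃ i, (I.bestColor c σs).2 = some i ∧ (I.bestColor c σs).1 = I.colorValue c σs i) := by
  -- The loop invariant is stated for an arbitrary initial value and an arbitrary list of colours,
  -- so that induction applies.
  have key : ∀ (f : Fin χ → ℤ) (l : List (Fin χ)) (b : ℤ × Option (Fin χ)),
      let e := l.foldl (fun best i => if best.1 ≤ f i then (f i, some i) else best) b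
      (b.1 ≤ e.1 ∧ ∀ i ∈ l, f i ≤ e.1) ∧ (e = b ∨ ∃ i, e.2 = some i ∧ e.1 = f i) := by
    intro f l
    induction l with
    | nil => intro b; simp
    | cons a l ih =>
      intro b
      rw [List.foldl_cons]
      by_cases h : b.1 ≤ f a
      · rw [if_pos h]
        obtain ⟨⟨h1, h2⟩, h3⟩ := ih (f a, some a)
        refine ⟨⟨h.trans h1, List.forall_mem_cons.2 ⟨h1, h2⟩⟩, Or.inr ?_⟩
        rcases h3 with h3 | h3
        · exact ⟨a, by rw [h3], by rw [h3]⟩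
        · exact h3
      · rw [if_neg h]
        obtain ⟨⟨h1, h2⟩, h3⟩ := ih b
        exact ⟨⟨h1, List.forall_mem_cons.2 ⟨(not_le.1 h).le.trans h1, h2⟩⟩, h3⟩
  obtain ⟨⟨h1, h2⟩, h3⟩ := key (I.colorValue c σs) (List.finRange χ) (0, none)
  refine ⟨⟨h1, fun i => h2 i (List.mem_finRange i)⟩, ?_⟩
  rcases h3 with h3 | h3
  · exact Or.inl ⟨congrArg Prod.snd h3, congrArg Prod.fst h3⟩
  · exact Or.inr h3

theorem mem_filterMap_node {v : I.Node} {p : List D} {d : {d : D // I.M d = v.1}} :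
    d ∈ p.filterMap (fun d => if h : I.M d = v.1 then some (⟨d, h⟩ : {d : D // I.M d = v.1})
      else none) ↔ d.1 ∈ p := by
  rw [List.mem_filterMap]
  constructor
  · rintro ⟨a, ha, e⟩
    split_ifs at e with h
    obtain rfl := Option.some.inj e
    exact ha
  · intro h
    exact ⟨d.1, h, by rw [dif_pos d.2]⟩

variable [DecidableEq D]

theorem mem_combine_met {i : Fin χ} {d : D} :
    d ∈ (I.combine c σs i).met ↔ c (I.nodeOf d) = i ∧
      ∃ h : I.M d = (I.nodeOf d).1, ⟨d, h⟩ ∈ (σs (I.nodeOf d)).met := by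
  simp only [combine, Finset.mem_biUnion, Finset.mem_filter, Finset.mem_univ, true_and,
    Finset.mem_map, Function.Embedding.subtype_apply]
  constructor
  · rintro ⟨⟨v, hv⟩, hc, ⟨d, hd⟩, hmem, rfl⟩
    dsimp only at hd
    subst hd
    exact ⟨hc, rfl, hmem⟩
  · rintro ⟨h1, h2, h3⟩
    exact ⟨_, h1, _, h3, rfl⟩

/-- For a given type the sum in `combine` has at most one term, by `eq_of_color`. Capacity and
starting location are inherited from `rep v` through `SameStart.rep_le`. -/
theorem feasible_combine (hS : I.SameStart) (hσ : ∀ v, (I.sub v).Feasible (σs v)) (i : Fin χ) :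
    I.Feasible (I.combine c σs i) := by
  have hmem : ∀ r s p, p ∈ (I.combine c σs i).paths r s ↔ ∃ v : I.Node, (c v = i ∧ r ∈ v.1) ∧
      ∃ q ∈ (σs v).paths () s, q.map Subtype.val = p := fun r s p => by
    simp [combine, Multiset.mem_sum]
  refine ⟨fun r s p hp => ?_, fun r s hs => ?_, fun d hd r hr => ?_⟩
  · obtain ⟨v, ⟨-, hr⟩, q, hq, rfl⟩ := (hmem r s p).1 hp
    have hq' := (hσ v).1 () s q hq
    have hs : s ∈ I.S (I.rep v) := hq'.mem_S
    have h1 : 0 < I.l (I.rep v) s :=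
      (Multiset.card_pos_iff_exists_mem.2 ⟨q, hq⟩).trans_le ((hσ v).2.1 () s hs)
    exact isPath_map_val hr (hS.rep_le hr hs h1).1 hq'
  · simp only [combine, Multiset.card_sum, Multiset.card_map]
    have hone : ∀ v ∈ Finset.univ.filter (fun v : I.Node => c v = i ∧ r ∈ v.1),
        ∀ u ∈ Finset.univ.filter (fun v : I.Node => c v = i ∧ r ∈ v.1), v = u := by
      intro v hv u hu
      have hv := (Finset.mem_filter.1 hv).2
      have hu := (Finset.mem_filter.1 hu).2
      exact eq_of_color (hv.1.trans hu.1.symm) hv.2 hu.2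
    rcases Finset.eq_empty_or_nonempty
      (Finset.univ.filter (fun v : I.Node => c v = i ∧ r ∈ v.1)) with e | ⟨v, hv⟩
    · rw [e]; simp
    · rw [Finset.eq_singleton_iff_unique_mem.2 ⟨hv, fun u hu => hone u hu v hv⟩,
        Finset.sum_singleton]
      have hr := (Finset.mem_filter.1 hv).2.2
      rcases Multiset.empty_or_exists_mem ((σs v).paths () s) with e | ⟨q, hq⟩
      · rw [e]; simp
      · have hs' : s ∈ I.S (I.rep v) := ((hσ v).1 () s q hq).mem_S
        have h1 := (hσ v).2.1 () s hs'
        have h2 := Multiset.card_pos_iff_exists_mem.2 ⟨q, hq⟩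
        exact h1.trans (hS.rep_le hr hs' (h2.trans_le h1)).2
  · obtain ⟨h1, h2, h3⟩ := mem_combine_met.1 hd
    obtain ⟨s, q, hq, hdq⟩ := (hσ _).2.2 _ h3 () (Finset.mem_singleton_self _)
    exact ⟨s, _, (hmem r s _).2 ⟨_, ⟨h1, hr⟩, q, hq, rfl⟩, List.mem_map.2 ⟨_, hdq, rfl⟩⟩

theorem reward_combine (i : Fin χ) : I.reward (I.combine c σs i) = I.colorValue c σs i := by
  rw [reward, combine, Finset.sum_biUnion, colorValue]
  · refine Finset.sum_congr rfl fun v _ => ?_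
    rw [Finset.sum_map]; rfl
  · intro u _ v _ huv
    refine Finset.disjoint_left.2 fun d hu hv => huv ?_
    obtain ⟨a, -, rfl⟩ := Finset.mem_map.1 hu
    obtain ⟨b, -, e⟩ := Finset.mem_map.1 hv
    refine Subtype.ext (a.2.symm.trans (Eq.trans ?_ b.2))
    exact congrArg I.M e.symm

/-- The part of a solution that concerns the node `v`. -/
def restrict (σ : Solution D R L) (v : I.Node) : Solution {d : D // I.M d = v.1} Unit L where
  paths _ s := ((σ.paths (I.rep v) s).map fun p =>
    p.filterMap fun d => if h : I.M d = v.1 then some ⟨d, h⟩ else none).filter fun p => p ≠ []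
  met := Finset.univ.filter fun d => d.1 ∈ σ.met

/-- The routes of type `rep v` suffice, since every met demand of the node requests this type.
Skipping the other demands is justified by `IsPath.pairwise` and `IsPath.reachable`. -/
theorem feasible_restrict (hΔ : ∀ d, 0 ≤ I.Δ d) (hT : I.TriangleIneq) {σ : Solution D R L}
    (hσ : I.Feasible σ) (v : I.Node) : (I.sub v).Feasible (restrict σ v) := by
  refine ⟨fun r s p hp => ?_, fun r s hs => ?_, fun d hd r _ => ?_⟩
  · obtain ⟨hp, hne⟩ := Multiset.mem_filter.1 hp
    obtain ⟨q, hq, rfl⟩ := Multiset.mem_map.1 hp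
    have hpath := hσ.1 _ _ q hq
    have h1 : (q.filterMap fun d => if h : I.M d = v.1 then
        some (⟨d, h⟩ : {d : D // I.M d = v.1}) else none).Pairwise
        fun a b => I.Precedes a.1 b.1 := by
      rw [List.pairwise_filterMap]
      refine (hpath.pairwise hΔ hT).imp fun {a b} hab x hx y hy => ?_
      split_ifs at hx hy
      obtain rfl := Option.some.inj hx
      obtain rfl := Option.some.inj hy
      exact hab
    have h2 : (q.filterMap fun d => if h : I.M d = v.1 then
        some (⟨d, h⟩ : {d : D // I.M d = v.1}) else none).Nodup := by
      refine List.Nodup.filterMap (fun a b x hx hy => ?_) hpath.2.2.2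
      rw [Option.mem_def] at hx hy
      split_ifs at hx hy
      obtain rfl := Option.some.inj hx
      exact (congrArg Subtype.val (Option.some.inj hy)).symm
    refine ⟨?_, (List.Pairwise.isChain h1).imp fun a b hab => ⟨hab, (), by simp [sub]⟩,
      fun d _ => Finset.mem_singleton_self _, h2⟩
    obtain ⟨d, hd⟩ := Option.ne_none_iff_exists'.1 fun e => hne (List.head?_eq_none_iff.1 e)
    exact ⟨d, hd, hpath.reachable hΔ hT _ (mem_filterMap_node.1 (List.mem_of_head? hd)),
      hpath.mem_S, Finset.mem_singleton_self _⟩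
  · refine (Multiset.card_le_card (Multiset.filter_le _ _)).trans ?_
    rw [Multiset.card_map]
    exact hσ.2.1 _ s hs
  · have hd := (Finset.mem_filter.1 hd).2
    obtain ⟨s, p, hp, hdp⟩ := hσ.2.2 d.1 hd (I.rep v) (by rw [d.2]; exact I.rep_mem v)
    have := mem_filterMap_node.2 hdp
    exact ⟨s, _, Multiset.mem_filter.2 ⟨Multiset.mem_map.2 ⟨p, hp, rfl⟩, List.ne_nil_of_mem this⟩,
      this⟩

theorem reward_eq_sum_restrict (σ : Solution D R L) :
    I.reward σ = ∑ v : I.Node, (I.sub v).reward (restrict σ v) := by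
  rw [reward, ← Finset.sum_fiberwise σ.met I.nodeOf]
  refine Finset.sum_congr rfl fun v _ => ?_
  rw [reward]
  refine Finset.sum_bij' (fun d hd => ⟨d, congrArg Subtype.val (Finset.mem_filter.1 hd).2⟩)
    (fun d _ => d.1) ?_ ?_ ?_ ?_ ?_
  · intro d hd; exact Finset.mem_filter.2 ⟨Finset.mem_univ _, (Finset.mem_filter.1 hd).1⟩
  · intro d hd; exact Finset.mem_filter.2 ⟨(Finset.mem_filter.1 hd).2, Subtype.ext d.2⟩
  · intros; rfl
  · intros; rfl
  · intros; rfl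

theorem opt_le (hΔ : ∀ d, 0 ≤ I.Δ d) (hT : I.TriangleIneq)
    (hσ : ∀ v, (I.sub v).IsOptimal (σs v)) : I.opt ≤ χ * (I.bestColor c σs).1 := by
  obtain ⟨σ, h1, h2⟩ := I.isGreatest_opt.1
  rw [← h2, reward_eq_sum_restrict]
  calc ∑ v : I.Node, (I.sub v).reward (restrict σ v)
      ≤ ∑ v : I.Node, (I.sub v).reward (σs v) := Finset.sum_le_sum fun v _ =>
        ((I.sub v).le_opt (feasible_restrict hΔ hT h1 v)).trans_eq (hσ v).2.symm
    _ = ∑ i : Fin χ, I.colorValue c σs i :=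
        (Finset.sum_fiberwise Finset.univ c fun v => (I.sub v).reward (σs v)).symm
    _ ≤ ∑ _i : Fin χ, (I.bestColor c σs).1 :=
        Finset.sum_le_sum fun i _ => bestColor_spec.1.2 i
    _ = χ * (I.bestColor c σs).1 := by simp

theorem isOutputB_spec (hΔ : ∀ d, 0 ≤ I.Δ d) (hT : I.TriangleIneq) (hS : I.SameStart) {b : ℤ}
    {σ : Solution D R L} (h : I.IsOutputB c b σ) :
    I.Feasible σ ∧ I.reward σ = b ∧ I.opt ≤ (χ : ℤ) * I.reward σ := by
  obtain ⟨σs, h1, rfl, rfl⟩ := h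
  have h2 := opt_le (c := c) hΔ hT h1
  rcases (bestColor_spec (c := c) (σs := σs)).2 with ⟨e1, e2⟩ | ⟨i, e1, e2⟩
  · rw [e2] at h2 ⊢
    rw [e1]
    exact ⟨⟨by simp, by simp, by simp⟩, by simp [reward], by simpa [reward] using h2⟩
  · rw [e2] at h2 ⊢
    rw [e1]
    dsimp only
    rw [reward_combine]
    exact ⟨feasible_combine hS (fun v => (h1 v).1) i, rfl, h2⟩

end

end MRMD

/-! ### Algorithm B as a function on encoded instances -/

/-- An instance with a colouring of its conflict graph. -/
structure ColoredInstance where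
  n : ℕ
  k : ℕ
  m : ℕ
  χ : ℕ
  I : MRMD (Fin n) (Fin k) (Fin m)
  c : I.conflictGraph.Coloring (Fin χ)

namespace ColoredInstance

instance : Codable ColoredInstance := ⟨inTy, fun x => encIn x.I x.c⟩

/-- The lists that describe an instance and a colouring. -/
abbrev Tables : Type :=
  (List (List (Bool × ℕ)) × List ((ℤ × ℤ) × (ℤ × List Bool)) × List (List ℤ) × List (List ℤ)) ×
    List (List Bool)

/-- The description by lists. -/
@[irreducible]
def tables (x : ColoredInstance) : Tables :=
  ((List.ofFn fun r => List.ofFn fun s => (decide (s ∈ x.I.S r), x.I.l r s),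
    List.ofFn fun d => ((x.I.τ d, x.I.Δ d),
      (x.I.w d, List.ofFn fun r => decide (r ∈ x.I.M d))),
    List.ofFn fun s => List.ofFn fun d => x.I.fS s d,
    List.ofFn fun i => List.ofFn fun j => x.I.fD i j),
   List.ofFn fun i => List.ofFn fun d => decide (x.c (x.I.nodeOf d) = i))

/-- The demands. -/
def demands (x : ColoredInstance) : List ℕ := List.range x.tables.1.2.1.length

/-- The resource types. -/
def types (x : ColoredInstance) : List ℕ := List.range x.tables.1.1.length

/-- The starting locations. -/
def locations (x : ColoredInstance) : List ℕ := List.range x.tables.1.2.2.1.length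

/-- Units of type `r` may start at `s`. -/
def inS (x : ColoredInstance) (r s : ℕ) : Bool :=
  ((x.tables.1.1.getD r []).getD s (false, 0)).1

/-- The number of units of type `r` that start at `s`. -/
def units (x : ColoredInstance) (r s : ℕ) : ℕ :=
  ((x.tables.1.1.getD r []).getD s (false, 0)).2

/-- The data of a demand. -/
def demand (x : ColoredInstance) (d : ℕ) : (ℤ × ℤ) × (ℤ × List Bool) :=
  x.tables.1.2.1.getD d ((0, 0), (0, []))

/-- Demand `d` requests type `r`. -/
def requests (x : ColoredInstance) (d r : ℕ) : Bool := (x.demand d).2.2.getD r false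

/-- The demands `d` and `d'` have the same request set. -/
def sameRequest (x : ColoredInstance) (d d' : ℕ) : Bool :=
  x.types.all fun r => x.requests d r == x.requests d' r

/-- Demand `j` can be served after demand `i`. -/
def precedes (x : ColoredInstance) (i j : ℕ) : Bool :=
  decide ((x.demand i).1.1 + (x.demand i).1.2 + (x.tables.1.2.2.2.getD i []).getD j 0 ≤
    (x.demand j).1.1)

/-- Demand `d` can be served by a unit that starts at `s`. -/
def reachable (x : ColoredInstance) (s d : ℕ) : Bool :=
  decide ((x.tables.1.2.2.1.getD s []).getD d 0 ≤ (x.demand d).1.1)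

/-- The order of precedence, where ties are broken by the indices of the demands. -/
def arc (x : ColoredInstance) (i j : ℕ) : Bool :=
  (decide (i < x.n) && decide (j < x.n)) &&
    (x.precedes i j && (!x.precedes j i || decide (i < j)))

/-- The number of units of type `r`. -/
def numUnits (x : ColoredInstance) (r : ℕ) : ℕ :=
  (x.locations.map fun s => bif x.inS r s then x.units r s else 0).sum

/-- The requested type of `d` with the fewest units. -/
def rep (x : ColoredInstance) (d : ℕ) : ℕ :=
  (x.types.filter fun r => x.requests d r &&
    x.types.all fun r' => !x.requests d r' || decide (x.numUnits r ≤ x.numUnits r')).headD 0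

/-- The demands of nonnegative reward with the same request set as `d`. -/
def elem (x : ColoredInstance) (d j : ℕ) : Bool :=
  decide (j < x.n) && (x.sameRequest d j && decide (0 ≤ (x.demand j).2.1))

/-- A unit of the scarcest type requested by `d` can serve `j` first. -/
def start (x : ColoredInstance) (d j : ℕ) : Bool :=
  x.locations.any fun s => x.inS (x.rep d) s && x.reachable s j

/-- The subproblem of the node of `d`. -/
def chains (x : ColoredInstance) (d : ℕ) : ChainProblem where
  n := x.n
  m := x.numUnits (x.rep d)
  E := x.elem d
  st := x.start d
  arc := x.arc
  w j := (x.demand j).2.1.toNat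

/-- The routes of an optimal solution of the subproblem of the node of `d`. -/
def routes (x : ColoredInstance) (d : ℕ) : List (List ℕ) := (x.chains d).routes (x.chains d).next

/-- The demands met by an optimal solution of the subproblem of the node of `d`. -/
def met (x : ColoredInstance) (d : ℕ) : List ℕ := (x.chains d).met (x.chains d).next

/-- The optimal value of the subproblem of the node of `d`. -/
def value (x : ColoredInstance) (d : ℕ) : ℤ := ((x.met d).map fun j => (x.demand j).2.1).sum

/-- No earlier demand has the same request set. -/
def isFirst (x : ColoredInstance) (d : ℕ) : Bool :=
  x.demands.all fun d' => !decide (d' < d) || !x.sameRequest d d'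

/-- The first demands of the nodes in a colour class. -/
def nodes (x : ColoredInstance) (cl : List Bool) : List ℕ :=
  x.demands.filter fun d => x.isFirst d && cl.getD d false

/-- The value of a colour class. -/
def classValue (x : ColoredInstance) (cl : List Bool) : ℤ :=
  ((x.nodes cl).map fun d => x.value d).sum

/-- The best value and the last colour class at which it was attained. -/
def best (x : ColoredInstance) : ℤ × List Bool :=
  x.tables.2.foldl (fun b cl => bif decide (b.1 ≤ x.classValue cl) then (x.classValue cl, cl) else b)
    (0, [])

/-- The routes of the units of type `r` that start at `s`, when the colour class `cl` is selected. -/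
def outRoutes (x : ColoredInstance) (cl : List Bool) (r s : ℕ) : List (List ℕ) :=
  ((x.nodes cl).filter fun d => x.requests d r).flatMap fun d =>
    bif x.inS (x.rep d) s then x.routes d else []

/-- The demands met when the colour class `cl` is selected. -/
def outMet (x : ColoredInstance) (cl : List Bool) : List ℕ := (x.nodes cl).flatMap fun d => x.met d

/-- The output of Algorithm B. -/
def output (x : ColoredInstance) : ℤ × List (List (List (List ℕ))) × List ℕ :=
  (x.best.1, (x.types.map fun r => x.locations.map fun s => x.outRoutes x.best.2 r s),
    x.outMet x.best.2)

section

variable {α : Type} [Codable α] {x : α → ColoredInstance} {d r s i j : α → ℕ} {cl : α → List Bool}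

-- The tables have literally the same representation as the instance, so the identity operation
-- computes them.
@[fun_prop]
theorem polyTime_tables (hx : PolyTime x) : PolyTime fun a => (x a).tables := by
  refine PolyTime.comp (g := tables) ?_ hx
  refine PolyTime.of_op (.id inTy) (fun x => ?_) (PolyBdd.size.mono fun x => le_of_eq ?_)
  · simp [Codable.enc, tables, encIn, encInst, List.map_ofFn, Function.comp_def, encBool, Op.eval]
  · simp [Codable.size, Codable.enc, tables, encIn, encInst, List.map_ofFn, Function.comp_def,
      encBool, Codable.ty]

theorem length_demands (x : ColoredInstance) : x.demands.length = x.n := by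
  simp [demands, tables]

@[fun_prop]
theorem polyTime_demands (hx : PolyTime x) : PolyTime fun a => (x a).demands := by
  unfold demands; fun_prop

@[fun_prop]
theorem polyTime_types (hx : PolyTime x) : PolyTime fun a => (x a).types := by
  unfold types; fun_prop

@[fun_prop]
theorem polyTime_locations (hx : PolyTime x) : PolyTime fun a => (x a).locations := by
  unfold locations; fun_prop

@[fun_prop]
theorem polyTime_n (hx : PolyTime x) : PolyTime fun a => (x a).n := by
  simp only [← length_demands]; fun_prop

@[fun_prop]
theorem polyTime_range (hx : PolyTime x) : PolyTime fun a => List.range (x a).n := by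
  simp only [← length_demands]; fun_prop

@[fun_prop]
theorem polyTime_inS (hx : PolyTime x) (hr : PolyTime r) (hs : PolyTime s) :
    PolyTime fun a => (x a).inS (r a) (s a) := by
  unfold inS; fun_prop

@[fun_prop]
theorem polyTime_units (hx : PolyTime x) (hr : PolyTime r) (hs : PolyTime s) :
    PolyTime fun a => (x a).units (r a) (s a) := by
  unfold units; fun_prop

@[fun_prop]
theorem polyTime_demand (hx : PolyTime x) (hd : PolyTime d) :
    PolyTime fun a => (x a).demand (d a) := by
  unfold demand; fun_prop

@[fun_prop]
theorem polyTime_requests (hx : PolyTime x) (hd : PolyTime d) (hr : PolyTime r) :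
    PolyTime fun a => (x a).requests (d a) (r a) := by
  unfold requests; fun_prop

@[fun_prop]
theorem polyTime_sameRequest (hx : PolyTime x) (hi : PolyTime i) (hj : PolyTime j) :
    PolyTime fun a => (x a).sameRequest (i a) (j a) := by
  unfold sameRequest; fun_prop

@[fun_prop]
theorem polyTime_precedes (hx : PolyTime x) (hi : PolyTime i) (hj : PolyTime j) :
    PolyTime fun a => (x a).precedes (i a) (j a) := by
  unfold precedes; fun_prop

@[fun_prop]
theorem polyTime_reachable (hx : PolyTime x) (hs : PolyTime s) (hd : PolyTime d) :
    PolyTime fun a => (x a).reachable (s a) (d a) := by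
  unfold reachable; fun_prop

@[fun_prop]
theorem polyTime_arc (hx : PolyTime x) (hi : PolyTime i) (hj : PolyTime j) :
    PolyTime fun a => (x a).arc (i a) (j a) := by
  unfold arc; fun_prop

@[fun_prop]
theorem polyTime_numUnits (hx : PolyTime x) (hr : PolyTime r) :
    PolyTime fun a => (x a).numUnits (r a) := by
  unfold numUnits; fun_prop

@[fun_prop]
theorem polyTime_rep (hx : PolyTime x) (hd : PolyTime d) :
    PolyTime fun a => (x a).rep (d a) := by
  unfold rep; fun_prop

@[fun_prop]
theorem polyTime_elem (hx : PolyTime x) (hd : PolyTime d) (hj : PolyTime j) :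
    PolyTime fun a => (x a).elem (d a) (j a) := by
  unfold elem; fun_prop

@[fun_prop]
theorem polyTime_start (hx : PolyTime x) (hd : PolyTime d) (hj : PolyTime j) :
    PolyTime fun a => (x a).start (d a) (j a) := by
  unfold start; fun_prop

@[fun_prop]
theorem polyTime_total (hx : PolyTime x) (hd : PolyTime d) :
    PolyTime fun a => ((x a).chains (d a)).total := by
  simp only [ChainProblem.total, chains]; fun_prop

@[fun_prop]
theorem polyTime_ok (hx : PolyTime x) (hd : PolyTime d) (hi : PolyTime i) (hj : PolyTime j) :
    PolyTime fun a => ((x a).chains (d a)).ok (i a) (j a) := by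
  simp only [ChainProblem.ok, chains]; fun_prop

@[fun_prop]
theorem polyTime_entry (hx : PolyTime x) (hd : PolyTime d) (hi : PolyTime i) (hj : PolyTime j) :
    PolyTime fun a => ((x a).chains (d a)).entry (i a) (j a) := by
  unfold ChainProblem.entry
  have h : ∀ x d, (chains x d).E = x.elem d ∧ (chains x d).w = fun j => (x.demand j).2.1.toNat :=
    fun _ _ => ⟨rfl, rfl⟩
  simp only [h]; fun_prop

@[fun_prop]
theorem polyTime_matrix (hx : PolyTime x) (hd : PolyTime d) :
    PolyTime fun a => ((x a).chains (d a)).matrix := by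
  -- The number `2n` is presented as the length of a list, to fit `range_length`.
  have h : ∀ x d, List.range ((chains x d).n + (chains x d).n) =
      List.range (x.demands ++ x.demands).length := fun x d => by
    rw [List.length_append, length_demands]; rfl
  simp only [ChainProblem.matrix, h]; fun_prop

@[fun_prop]
theorem polyTime_next (hx : PolyTime x) (hd : PolyTime d) :
    PolyTime fun a => ((x a).chains (d a)).next := by
  unfold ChainProblem.next; fun_prop

@[fun_prop]
theorem polyTime_route {ρ : α → List ℕ} (hx : PolyTime x) (hρ : PolyTime ρ) (hi : PolyTime i) :
    PolyTime fun a => ((x a).chains (d a)).route (ρ a) (i a) := by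
  have h : ∀ x d, (chains x d).n = x.n := fun _ _ => rfl
  simp only [ChainProblem.route, h]
  refine PolyTime.snd (PolyTime.foldl_of_size_le (init := fun a =>
    ((ρ a).getD ((x a).n + i a) 0, ([] : List ℕ))) (l := fun a => List.range (x a).n)
    (step := fun a c (_ : ℕ) => bif decide (c.1 < (x a).n) then ((ρ a).getD c.1 0, c.2 ++ [c.1])
      else c) (by fun_prop) (by fun_prop) (by fun_prop)
    (S := fun a => size (ρ a) + size (0 : ℕ) + 1)
    ((hρ.polyBdd_size.add (.const _)).add (.const _)) fun a c b _ => ?_)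
  cases decide (c.1 < (x a).n)
  · simp
  · rw [cond_true, PolyTime.size_prod, PolyTime.size_prod]
    have h1 := PolyTime.size_append c.2 [c.1]
    rw [PolyTime.size_cons, PolyTime.size_nil] at h1
    have h2 : size ((ρ a).getD c.1 0) ≤ size (ρ a) + size (0 : ℕ) := by
      rw [List.getD_eq_getElem?_getD]
      cases e : (ρ a)[c.1]? with
      | none => exact Nat.le_add_left _ _
      | some b => exact (PolyTime.size_le_of_mem (List.mem_of_getElem? e)).trans (Nat.le_add_right _ _)
    dsimp only
    omega

@[fun_prop]
theorem polyTime_routes (hx : PolyTime x) (hd : PolyTime d) :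
    PolyTime fun a => (x a).routes (d a) := by
  have h : ∀ x d, (chains x d).n = x.n := fun _ _ => rfl
  simp only [routes, ChainProblem.routes, h]; fun_prop

@[fun_prop]
theorem polyTime_met (hx : PolyTime x) (hd : PolyTime d) :
    PolyTime fun a => (x a).met (d a) := by
  have h : ∀ x d, (chains x d).n = x.n ∧ (chains x d).E = x.elem d := fun _ _ => ⟨rfl, rfl⟩
  simp only [met, ChainProblem.met, h]; fun_prop

@[fun_prop]
theorem polyTime_value (hx : PolyTime x) (hd : PolyTime d) :
    PolyTime fun a => (x a).value (d a) := by
  unfold value; fun_prop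

@[fun_prop]
theorem polyTime_isFirst (hx : PolyTime x) (hd : PolyTime d) :
    PolyTime fun a => (x a).isFirst (d a) := by
  unfold isFirst; fun_prop

@[fun_prop]
theorem polyTime_nodes (hx : PolyTime x) (hc : PolyTime cl) :
    PolyTime fun a => (x a).nodes (cl a) := by
  unfold nodes; fun_prop

@[fun_prop]
theorem polyTime_classValue (hx : PolyTime x) (hc : PolyTime cl) :
    PolyTime fun a => (x a).classValue (cl a) := by
  unfold classValue; fun_prop

-- The accumulator is replaced, never extended, and its new value depends on the instance and the
-- current class only. Hence its size stays polynomial.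
@[fun_prop]
theorem polyTime_best (hx : PolyTime x) : PolyTime fun a => (x a).best := by
  obtain ⟨q, hq⟩ := PolyTime.polyBdd_size (f := fun p : α × List Bool =>
    (x p.1).classValue p.2) (by fun_prop)
  have hl : PolyTime fun a => (x a).tables.2 := by fun_prop
  refine PolyTime.foldl_of_size_le (init := fun _ => ((0 : ℤ), ([] : List Bool)))
    (step := fun a (b : ℤ × List Bool) (cl : List Bool) =>
      bif decide (b.1 ≤ (x a).classValue cl) then ((x a).classValue cl, cl) else b)
    (by fun_prop) hl (by fun_prop)
    (S := fun a => q.eval (size a + size (x a).tables.2 + 1) + size (x a).tables.2)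
    ((PolyBdd.eval q ((PolyBdd.size.add hl.polyBdd_size).add (.const 1))).add hl.polyBdd_size)
    fun a b cl hcl => ?_
  have h1 := PolyTime.size_le_of_mem hcl
  have h2 := hq (a, cl)
  have h3 := q.eval_mono_nat (show size (a, cl) ≤ size a + size (x a).tables.2 + 1 by
    rw [PolyTime.size_prod]; dsimp only; omega)
  have h4 : 1 ≤ size b := by rw [PolyTime.size_prod]; omega
  dsimp only at h2
  cases decide (b.1 ≤ (x a).classValue cl)
  · simp
  · rw [cond_true, PolyTime.size_prod]; dsimp only; omega

@[fun_prop]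
theorem polyTime_outRoutes (hx : PolyTime x) (hc : PolyTime cl) (hr : PolyTime r)
    (hs : PolyTime s) : PolyTime fun a => (x a).outRoutes (cl a) (r a) (s a) := by
  unfold outRoutes; fun_prop

@[fun_prop]
theorem polyTime_outMet (hx : PolyTime x) (hc : PolyTime cl) :
    PolyTime fun a => (x a).outMet (cl a) := by
  unfold outMet; fun_prop

theorem polyTime_output : PolyTime output := by
  unfold output; fun_prop

end

end ColoredInstance

/-! ### Correctness of the computed output -/

theorem List.getD_ofFn {α : Type} {n : ℕ} (f : Fin n → α) (i : Fin n) (d : α) :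
    (List.ofFn f).getD i d = f i := by
  simp [List.getD_eq_getElem?_getD]

theorem List.map_range_eq_ofFn {α : Type} {n : ℕ} (f : ℕ → α) :
    (List.range n).map f = List.ofFn fun i : Fin n => f i := by
  apply List.ext_getElem <;> simp

theorem List.sum_map_range {n : ℕ} (f : ℕ → ℕ) :
    ((List.range n).map f).sum = ∑ i : Fin n, f i := by
  rw [List.map_range_eq_ofFn, List.sum_ofFn]

/-- A list of preimages. -/
noncomputable def List.lift {ι : Type} (e : ι → ℕ) (l : List ℕ) : List ι := by
  classical exact l.filterMap fun j => if h : ∃ i, e i = j then some h.choose else none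

theorem List.map_lift {ι : Type} {e : ι → ℕ} {l : List ℕ} (h : ∀ j ∈ l, ∃ i, e i = j) :
    (l.lift e).map e = l := by
  induction l with
  | nil => rfl
  | cons a l ih =>
    obtain ⟨h1, h2⟩ := List.forall_mem_cons.1 h
    have := ih h2
    rw [List.lift] at this ⊢
    rw [List.filterMap_cons_some (dif_pos h1), List.map_cons, this, h1.choose_spec]

theorem List.mem_lift {ι : Type} {e : ι → ℕ} (he : Function.Injective e) {l : List ℕ}
    (h : ∀ j ∈ l, ∃ i, e i = j) {i : ι} : i ∈ l.lift e ↔ e i ∈ l := by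
  conv_rhs => rw [← List.map_lift h]
  exact (List.mem_map_of_injective he).symm

theorem List.coe_flatMap {α β γ : Type} (l : List α) (f : α → List β) (g : β → γ) :
    (((l.flatMap f).map g : List γ) : Multiset γ) =
      (l.map fun a => (((f a).map g : List γ) : Multiset γ)).sum := by
  induction l with
  | nil => rfl
  | cons a l ih => rw [List.flatMap_cons, List.map_append, ← Multiset.coe_add, ih]; rfl

namespace ColoredInstance

open MRMD

variable {x : ColoredInstance}

theorem demands_eq : x.demands = List.range x.n := by simp [demands, tables]

theorem types_eq : x.types = List.range x.k := by simp [types, tables]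

theorem locations_eq : x.locations = List.range x.m := by simp [locations, tables]

theorem inS_eq (r : Fin x.k) (s : Fin x.m) : x.inS r s = decide (s ∈ x.I.S r) := by
  simp [inS, tables, List.getD_ofFn, -List.getD_eq_getElem?_getD]

theorem units_eq (r : Fin x.k) (s : Fin x.m) : x.units r s = x.I.l r s := by
  simp [units, tables, List.getD_ofFn, -List.getD_eq_getElem?_getD]

theorem demand_eq (d : Fin x.n) : x.demand d = ((x.I.τ d, x.I.Δ d),
    (x.I.w d, List.ofFn fun r => decide (r ∈ x.I.M d))) := by
  simp [demand, tables, List.getD_ofFn, -List.getD_eq_getElem?_getD]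

theorem requests_eq (d : Fin x.n) (r : Fin x.k) : x.requests d r = decide (r ∈ x.I.M d) := by
  rw [requests, demand_eq]
  exact List.getD_ofFn _ _ _

theorem sameRequest_iff (d d' : Fin x.n) : x.sameRequest d d' = true ↔ x.I.M d = x.I.M d' := by
  rw [sameRequest, types_eq, List.all_eq_true, Finset.ext_iff]
  constructor
  · intro h r
    have := h r (by simp)
    rw [requests_eq, requests_eq, beq_iff_eq, decide_eq_decide] at this
    exact this
  · intro h r hr
    have := h ⟨r, by simpa using hr⟩
    rw [← decide_eq_decide, ← requests_eq, ← requests_eq] at this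
    simpa using this

theorem precedes_iff (i j : Fin x.n) : x.precedes i j = true ↔ x.I.Precedes i j := by
  rw [precedes, demand_eq, demand_eq, decide_eq_true_eq, Precedes]
  simp [tables, List.getD_ofFn, -List.getD_eq_getElem?_getD]

theorem reachable_iff (s : Fin x.m) (d : Fin x.n) :
    x.reachable s d = true ↔ x.I.fS s d ≤ x.I.τ d := by
  rw [reachable, demand_eq, decide_eq_true_eq]
  simp [tables, List.getD_ofFn, -List.getD_eq_getElem?_getD]

theorem numUnits_eq (r : Fin x.k) : x.numUnits r = x.I.numUnits r := by
  rw [numUnits, locations_eq, List.sum_map_range, MRMD.numUnits]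
  simp only [inS_eq, units_eq, Bool.cond_decide]
  rw [← Finset.sum_filter, Finset.filter_mem_eq_inter, Finset.univ_inter]

/-- A filtered range is increasing, so its head is its minimum; it is nonempty, so the default 0 is
not reached. -/
theorem headD_filter_range {n : ℕ} {p : ℕ → Bool} {s : Finset (Fin n)}
    (h : ∀ i : Fin n, p i = true ↔ i ∈ s) (hs : s.Nonempty) :
    ((List.range n).filter p).headD 0 = s.min' hs := by
  have hmem : ∀ j, j ∈ (List.range n).filter p ↔ ∃ i ∈ s, (i : ℕ) = j := fun j => by
    rw [List.mem_filter, List.mem_range]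
    constructor
    · rintro ⟨h1, h2⟩; exact ⟨⟨j, h1⟩, (h _).1 h2, rfl⟩
    · rintro ⟨i, hi, rfl⟩; exact ⟨i.2, (h i).2 hi⟩
  have hsort : ((List.range n).filter p).Pairwise (· < ·) := List.pairwise_lt_range.filter _
  cases e : (List.range n).filter p with
  | nil =>
    have := (hmem (s.min' hs)).2 ⟨_, s.min'_mem hs, rfl⟩
    rw [e] at this; cases this
  | cons a l =>
    rw [e] at hmem hsort
    rw [List.headD_cons]
    obtain ⟨i, hi, rfl⟩ := (hmem a).1 List.mem_cons_self
    refine le_antisymm ?_ (Fin.val_le_of_le (s.min'_le i hi))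
    rcases List.mem_cons.1 ((hmem (s.min' hs)).2 ⟨_, s.min'_mem hs, rfl⟩) with h1 | h1
    · exact h1.ge
    · exact ((List.pairwise_cons.1 hsort).1 _ h1).le

theorem rep_eq (d : Fin x.n) : x.rep d = x.I.rep (x.I.nodeOf d) := by
  rw [rep, types_eq]
  refine headD_filter_range (s := x.I.scarcest (x.I.nodeOf d)) (fun r => ?_)
    (x.I.scarcest_nonempty _)
  simp only [mem_scarcest, Bool.and_eq_true, requests_eq, decide_eq_true_eq,
    List.all_eq_true, List.mem_range, Bool.or_eq_true, Bool.not_eq_true', nodeOf]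
  refine and_congr_right fun _ => ⟨fun h r' hr' => ?_, fun h r' hr' => ?_⟩
  · have := h r' r'.2
    rw [requests_eq, numUnits_eq, numUnits_eq] at this
    simpa [hr'] using this
  · have := h ⟨r', hr'⟩
    have e1 := requests_eq d ⟨r', hr'⟩
    have e2 := numUnits_eq (x := x) ⟨r', hr'⟩
    dsimp only at e1 e2
    rw [e1, e2, numUnits_eq, decide_eq_false_iff_not]
    tauto

theorem arc_iff {i j : ℕ} : x.arc i j = true ↔ ∃ (hi : i < x.n) (hj : j < x.n),
    x.I.Precedes ⟨i, hi⟩ ⟨j, hj⟩ ∧ (¬ x.I.Precedes ⟨j, hj⟩ ⟨i, hi⟩ ∨ i < j) := by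
  rw [arc, Bool.and_eq_true, Bool.and_eq_true, decide_eq_true_eq, decide_eq_true_eq]
  constructor
  · rintro ⟨⟨hi, hj⟩, h⟩
    refine ⟨hi, hj, ?_⟩
    rw [← precedes_iff, ← precedes_iff]
    simpa using h
  · rintro ⟨hi, hj, h⟩
    rw [← precedes_iff, ← precedes_iff] at h
    exact ⟨⟨hi, hj⟩, by simpa using h⟩

/-- Precedence is transitive, but demands may precede themselves or each other, for instance with
zero durations and travel times. Breaking ties by index makes it a strict order. -/
theorem valid (hΔ : ∀ d, 0 ≤ x.I.Δ d) (hT : x.I.TriangleIneq) (d : ℕ) : (x.chains d).Valid := by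
  refine ⟨fun {j} h => ?_, fun j => ?_, fun {i j k} h1 h2 => ?_⟩
  · simp only [chains, elem, Bool.and_eq_true, decide_eq_true_eq] at h
    exact h.1
  · rw [Bool.eq_false_iff]
    intro h
    obtain ⟨_, _, h1, h2 | h2⟩ := arc_iff.1 h
    · exact h2 h1
    · exact lt_irrefl _ h2
  · obtain ⟨hi, hj, h3, h4⟩ := arc_iff.1 h1
    obtain ⟨_, hk, h5, h6⟩ := arc_iff.1 h2
    refine arc_iff.2 ⟨hi, hk, h3.trans hΔ hT h5, ?_⟩
    -- If `k` also precedes `i`, all three demands precede one another. Both arcs then come from the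
    -- indices, which compose.
    by_cases h7 : x.I.Precedes ⟨k, hk⟩ ⟨i, hi⟩
    · have h8 := h4.resolve_left (not_not.2 (h5.trans hΔ hT h7))
      have h9 := h6.resolve_left (not_not.2 (h7.trans hΔ hT h3))
      exact Or.inr (h8.trans h9)
    · exact Or.inl h7

theorem elem_iff (d : Fin x.n) {j : ℕ} : x.elem d j = true ↔
    ∃ i : Fin x.n, (i : ℕ) = j ∧ x.I.M i = x.I.M d ∧ 0 ≤ x.I.w i := by
  simp only [elem, Bool.and_eq_true, decide_eq_true_eq]
  constructor
  · rintro ⟨h1, h2, h3⟩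
    have e := demand_eq (x := x) ⟨j, h1⟩
    dsimp only at e
    rw [e] at h3
    exact ⟨⟨j, h1⟩, rfl, ((sameRequest_iff d ⟨j, h1⟩).1 h2).symm, h3⟩
  · rintro ⟨i, rfl, h1, h2⟩
    exact ⟨i.2, (sameRequest_iff _ _).2 h1.symm, by rw [demand_eq]; exact h2⟩

theorem start_iff (d j : Fin x.n) : x.start d j = true ↔
    ∃ s ∈ x.I.S (x.I.rep (x.I.nodeOf d)), x.I.fS s j ≤ x.I.τ j := by
  rw [start, locations_eq, rep_eq, List.any_eq_true]
  constructor
  · rintro ⟨s, hs, h⟩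
    have hs := List.mem_range.1 hs
    have e1 := inS_eq (x := x) (x.I.rep (x.I.nodeOf d)) ⟨s, hs⟩
    have e2 := reachable_iff (x := x) ⟨s, hs⟩ j
    dsimp only at e1 e2
    rw [Bool.and_eq_true, e1, e2, decide_eq_true_eq] at h
    exact ⟨⟨s, hs⟩, h⟩
  · rintro ⟨s, h⟩
    refine ⟨s, by simp, ?_⟩
    rw [Bool.and_eq_true, inS_eq, reachable_iff, decide_eq_true_eq]
    exact h

/-- The first demand of a node. -/
def first (x : ColoredInstance) (v : x.I.Node) : Fin x.n :=
  (Finset.univ.filter fun d => x.I.nodeOf d = v).min' (by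
    obtain ⟨d, -, hd⟩ := Finset.mem_image.1 v.2
    exact ⟨d, Finset.mem_filter.2 ⟨Finset.mem_univ _, Subtype.ext hd⟩⟩)

theorem nodeOf_first (v : x.I.Node) : x.I.nodeOf (x.first v) = v :=
  (Finset.mem_filter.1 (Finset.min'_mem (Finset.univ.filter fun d => x.I.nodeOf d = v) _)).2

theorem first_le {v : x.I.Node} {d : Fin x.n} (h : x.I.nodeOf d = v) : x.first v ≤ d :=
  Finset.min'_le (Finset.univ.filter fun d => x.I.nodeOf d = v) d
    (Finset.mem_filter.2 ⟨Finset.mem_univ _, h⟩)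

theorem M_first (v : x.I.Node) : x.I.M (x.first v) = v.1 := congrArg Subtype.val (nodeOf_first v)

theorem nodeOf_eq_iff {d d' : Fin x.n} : x.I.nodeOf d = x.I.nodeOf d' ↔ x.I.M d = x.I.M d' :=
  Subtype.ext_iff

theorem isFirst_iff (d : Fin x.n) : x.isFirst d = true ↔ x.first (x.I.nodeOf d) = d := by
  have h0 : x.first (x.I.nodeOf d) ≤ d := first_le rfl
  simp only [isFirst, demands_eq, List.all_eq_true, List.mem_range, Bool.or_eq_true,
    Bool.not_eq_true', decide_eq_false_iff_not]
  constructor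
  · intro h
    by_contra hne
    rcases h _ (x.first (x.I.nodeOf d)).2 with h1 | h1
    · exact h1 (Fin.lt_def.1 (lt_of_le_of_ne h0 hne))
    · rw [← Bool.not_eq_true, sameRequest_iff] at h1
      exact h1 (M_first (x.I.nodeOf d)).symm
  · intro h j hj
    by_cases hjd : j < d
    · right
      rw [← Bool.not_eq_true]
      intro h1
      have h1 := (sameRequest_iff d ⟨j, hj⟩).1 h1
      have : x.first (x.I.nodeOf d) ≤ ⟨j, hj⟩ := first_le (nodeOf_eq_iff.2 h1.symm)
      rw [h] at this
      exact absurd hjd (not_lt.2 this)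
    · exact Or.inl hjd

/-- The index of a demand of the subproblem of a node. -/
def idx (x : ColoredInstance) (v : x.I.Node) (d : {d // x.I.M d = v.1}) : ℕ := d.1

theorem idx_injective (v : x.I.Node) : Function.Injective (x.idx v) := fun _ _ h =>
  Subtype.ext (Fin.ext h)

theorem exists_idx {v : x.I.Node} {j : ℕ} (h : x.elem (x.first v) j = true) :
    ∃ d, x.idx v d = j := by
  obtain ⟨i, rfl, h1, -⟩ := (elem_iff _).1 h
  exact ⟨⟨i, h1.trans (M_first v)⟩, rfl⟩

/-- The computed solution of the subproblem of a node. -/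
noncomputable def subSolution (x : ColoredInstance) :
    x.I.SubSolutions := fun v =>
  { paths := fun _ s => if s ∈ x.I.S (x.I.rep v) then
      ((x.routes (x.first v)).map (List.lift (x.idx v)) : List _) else 0
    met := ((x.met (x.first v)).lift (x.idx v)).toFinset }

theorem elem_of_mem_routes (hΔ : ∀ d, 0 ≤ x.I.Δ d) (hT : x.I.TriangleIneq) {d : ℕ} {l : List ℕ}
    (hl : l ∈ x.routes d) : ∀ j ∈ l, x.elem d j = true :=
  (ChainProblem.routes_spec (valid hΔ hT d) hl).2.2

theorem mem_met {d j : ℕ} : j ∈ x.met d ↔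
    x.elem d j = true ∧ (x.chains d).next.getD j 0 ≠ j := by
  have h : x.elem d j = true → j < x.n := fun h => by
    simp only [elem, Bool.and_eq_true, decide_eq_true_eq] at h; exact h.1
  have e : (x.chains d).n = x.n ∧ (x.chains d).E = x.elem d := ⟨rfl, rfl⟩
  rw [met, ChainProblem.met, List.mem_filter, e.1, e.2, List.mem_range]
  simp only [Bool.and_eq_true, Bool.not_eq_true', decide_eq_false_iff_not]
  tauto

theorem nodup_met (d : ℕ) : (x.met d).Nodup := List.nodup_range.filter _

theorem reward_subSolution (v : x.I.Node) :
    (x.I.sub v).reward (x.subSolution v) = x.value (x.first v) := by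
  have h : ∀ j ∈ x.met (x.first v), ∃ d, x.idx v d = j := fun j hj => exists_idx (mem_met.1 hj).1
  have hn : ((x.met (x.first v)).lift (x.idx v)).Nodup := by
    apply List.Nodup.of_map (x.idx v)
    rw [List.map_lift h]
    exact nodup_met _
  rw [value]
  conv_rhs => rw [← List.map_lift h]
  rw [List.map_map, reward, subSolution, List.sum_toFinset _ hn]
  congr 1
  refine List.map_congr_left fun d _ => ?_
  change _ = (x.demand (d.1 : ℕ)).2.1
  rw [demand_eq]; rfl

theorem triangleIneq_sub (hT : x.I.TriangleIneq) (v : x.I.Node) : (x.I.sub v).TriangleIneq :=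
  ⟨fun i j k => hT.1 i j k, fun s j k => hT.2 s j k⟩

theorem numUnits_rep (hS : x.I.SameStart) (v : x.I.Node) {s : Fin x.m}
    (hs : s ∈ x.I.S (x.I.rep v)) : x.numUnits (x.rep (x.first v)) = x.I.l (x.I.rep v) s := by
  rw [rep_eq, nodeOf_first, numUnits_eq, MRMD.numUnits,
    (hS.S_eq (r' := x.I.rep v) hs).resolve_left fun e => by rw [e] at hs; simp at hs,
    Finset.sum_singleton]

theorem feasible_subSolution (hΔ : ∀ d, 0 ≤ x.I.Δ d) (hT : x.I.TriangleIneq)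
    (hS : x.I.SameStart) (v : x.I.Node) : (x.I.sub v).Feasible (x.subSolution v) := by
  have hv := valid hΔ hT (x.first v)
  refine ⟨fun _ s p hp => ?_, fun _ s hs => ?_, fun d hd _ _ => ?_⟩
  · simp only [subSolution] at hp
    split_ifs at hp with hs
    swap
    · exact absurd hp (Multiset.notMem_zero _)
    obtain ⟨l, hl, rfl⟩ := List.mem_map.1 (Multiset.mem_coe.1 hp)
    have hl1 := elem_of_mem_routes hΔ hT hl
    obtain ⟨⟨c, hc, hst⟩, harc, -⟩ := ChainProblem.routes_spec hv hl
    have hmap := List.map_lift (l := l) fun j hj => exists_idx (hl1 j hj)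
    generalize List.lift (x.idx v) l = q at hmap
    subst hmap
    rw [List.head?_map] at hc
    obtain ⟨d, hd, rfl⟩ := Option.map_eq_some_iff.1 hc
    have harc' := List.pairwise_map.1 harc
    refine ⟨⟨d, hd, ?_, hs, Finset.mem_singleton_self _⟩, ?_,
      fun _ _ => Finset.mem_singleton_self _, ?_⟩
    · obtain ⟨s', hs', h⟩ := (start_iff (x.first v) d.1).1 hst
      rw [nodeOf_first] at hs'
      rw [hS _ _ _ _ hs hs']
      exact h
    · refine (harc'.imp fun {a b} hab => ?_).isChain
      obtain ⟨_, _, h, -⟩ := arc_iff.1 hab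
      exact ⟨h, (), by simp [sub]⟩
    · refine harc'.imp fun {a b} hab e => ?_
      subst e
      exact absurd hab (by rw [hv.irrefl]; simp)
  · change s ∈ x.I.S (x.I.rep v) at hs
    simp only [subSolution, if_pos hs, Multiset.coe_card, List.length_map]
    refine (ChainProblem.length_routes_le hv).trans_eq ?_
    exact numUnits_rep hS v hs
  · have hmet : ∀ j ∈ x.met (x.first v), ∃ d, x.idx v d = j := fun j hj =>
      exists_idx (mem_met.1 hj).1
    simp only [subSolution, List.mem_toFinset] at hd
    rw [List.mem_lift (idx_injective v) hmet, mem_met] at hd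
    obtain ⟨l, hl, hdl⟩ := ChainProblem.exists_mem_routes hv hd.1 hd.2
    -- A route exists, so there is at least one unit and hence a starting location.
    obtain ⟨s, hs⟩ : (x.I.S (x.I.rep v)).Nonempty := by
      rw [Finset.nonempty_iff_ne_empty]
      intro e
      have h1 := ChainProblem.length_routes_le hv
      have h2 : (x.chains (x.first v)).m = 0 := by
        change x.numUnits (x.rep (x.first v)) = 0
        rw [rep_eq, nodeOf_first, numUnits_eq, MRMD.numUnits, e, Finset.sum_empty]
      have := List.length_pos_of_mem hl
      omega
    refine ⟨s, l.lift (x.idx v), ?_, (List.mem_lift (idx_injective v) fun j hj =>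
      exists_idx (elem_of_mem_routes hΔ hT hl j hj)).2 hdl⟩
    simp only [subSolution, if_pos hs, Multiset.mem_coe]
    exact List.mem_map_of_mem hl

/-- Demands of negative reward may be removed from any competing solution, both from its routes and
from its met set, without lowering its value. What remains is a family of chains to which
`ChainProblem.sum_weight_le` applies. -/
theorem isOptimal_subSolution (hΔ : ∀ d, 0 ≤ x.I.Δ d) (hT : x.I.TriangleIneq)
    (hS : x.I.SameStart) (v : x.I.Node) : (x.I.sub v).IsOptimal (x.subSolution v) := by
  refine (isOptimal_iff _).2 ⟨feasible_subSolution hΔ hT hS v, fun σ hσ => ?_⟩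
  have hv := valid hΔ hT (x.first v)
  have hw : ∀ d : {d // x.I.M d = v.1}, (x.chains (x.first v)).w (x.idx v d) =
      ((x.I.sub v).w d).toNat := fun d => by
    change (x.demand (d.1 : ℕ)).2.1.toNat = _
    rw [demand_eq]; rfl
  have hE : ∀ d : {d // x.I.M d = v.1}, (x.chains (x.first v)).E (x.idx v d) = true ↔
      0 ≤ (x.I.sub v).w d := fun d => by
    refine (elem_iff (x.first v)).trans ⟨?_, fun h => ⟨d.1, rfl, d.2.trans (M_first v).symm, h⟩⟩
    rintro ⟨i, hi, -, h⟩
    obtain rfl := Fin.ext hi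
    exact h
  have hval : x.value (x.first v) = ((((x.chains (x.first v)).met (x.chains (x.first v)).next).map
      (x.chains (x.first v)).w).sum : ℕ) := by
    rw [value, Nat.cast_list_sum, List.map_map]
    congr 1
    refine List.map_congr_left fun j hj => ?_
    obtain ⟨i, rfl, -, h⟩ := (elem_iff _).1 (mem_met.1 hj).1
    change _ = (((x.demand i).2.1.toNat : ℕ) : ℤ)
    rw [demand_eq]
    exact (Int.toNat_of_nonneg h).symm
  let Y : Finset ℕ := (σ.met.filter fun d => 0 ≤ (x.I.sub v).w d).map ⟨x.idx v, idx_injective v⟩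
  have hrew : (x.I.sub v).reward σ ≤ (∑ y ∈ Y, (x.chains (x.first v)).w y : ℕ) := by
    rw [Finset.sum_map, reward, Nat.cast_sum, Finset.sum_filter]
    refine Finset.sum_le_sum fun d _ => ?_
    split_ifs with h
    · rw [Function.Embedding.coeFn_mk, hw, Int.toNat_of_nonneg h]
    · exact (not_le.1 h).le
  rw [reward_subSolution, hval]
  refine hrew.trans (Int.ofNat_le.2 ?_)
  -- A met demand supplies the common starting location `s`; all routes leave from it.
  by_cases hY : Y = ∅
  · rw [hY, Finset.sum_empty]; exact Nat.zero_le _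
  obtain ⟨y, hy⟩ := Finset.nonempty_iff_ne_empty.2 hY
  obtain ⟨d, hd, -⟩ := Finset.mem_map.1 hy
  obtain ⟨s, p, hp, -⟩ := hσ.2.2 d (Finset.mem_filter.1 hd).1 () (Finset.mem_singleton_self _)
  have hs : s ∈ x.I.S (x.I.rep v) := (hσ.1 _ _ _ hp).mem_S
  refine ChainProblem.sum_weight_le hv Y ((σ.paths () s).toList.map fun p =>
    (p.filter fun d => decide (0 ≤ (x.I.sub v).w d)).map (x.idx v)) ?_ ?_ ?_
  · rw [List.length_map, Multiset.length_toList]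
    exact (hσ.2.1 () s hs).trans_eq (numUnits_rep hS v hs).symm
  · intro q hq
    obtain ⟨p, hp, rfl⟩ := List.mem_map.1 hq
    have hpath := hσ.1 () s p (Multiset.mem_toList.1 hp)
    have h1 := hpath.pairwise (fun d => hΔ d.1) (triangleIneq_sub hT v)
    constructor
    · refine List.pairwise_map.2 ((h1.and hpath.2.2.2).filter _ |>.imp fun {a b} hab => ?_)
      have hne : (a.1 : ℕ) ≠ b.1 := fun e => hab.2 (Subtype.ext (Fin.ext e))
      -- Under mutual precedence the arc follows the indices and may run against the route. For this
      -- reason the chain bound asks only for comparable pairs.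
      by_cases h : x.I.Precedes b.1 a.1
      · rcases lt_or_gt_of_ne hne with h' | h'
        · exact Or.inl (arc_iff.2 ⟨a.1.2, b.1.2, hab.1, Or.inr h'⟩)
        · exact Or.inr (arc_iff.2 ⟨b.1.2, a.1.2, h, Or.inr h'⟩)
      · exact Or.inl (arc_iff.2 ⟨a.1.2, b.1.2, hab.1, Or.inl h⟩)
    · intro j hj
      obtain ⟨d, hd, rfl⟩ := List.mem_map.1 hj
      obtain ⟨hd1, hd2⟩ := List.mem_filter.1 hd
      refine ⟨(hE d).2 (by simpa using hd2), (start_iff (x.first v) d.1).2 ⟨s, ?_, ?_⟩⟩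
      · rw [nodeOf_first]; exact hs
      · exact hpath.reachable (fun d => hΔ d.1) (triangleIneq_sub hT v) d hd1
  · intro y hy
    obtain ⟨d, hd, rfl⟩ := Finset.mem_map.1 hy
    obtain ⟨hd1, hd2⟩ := Finset.mem_filter.1 hd
    obtain ⟨s', p, hp, hdp⟩ := hσ.2.2 d hd1 () (Finset.mem_singleton_self _)
    obtain rfl : s = s' := hS _ _ _ _ hs (hσ.1 _ _ _ hp).mem_S
    exact ⟨_, List.mem_map.2 ⟨p, Multiset.mem_toList.2 hp, rfl⟩, List.mem_map.2 ⟨d,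
      List.mem_filter.2 ⟨hdp, by simpa using hd2⟩, rfl⟩⟩

/-- A sum over the first demands of nodes is a sum over nodes. -/
theorem sum_nodes {N : Type} [AddCommMonoid N] {q : ℕ → Bool} {p : x.I.Node → Prop}
    [DecidablePred p] (hq : ∀ v, q (x.first v) = true ↔ p v) {F : x.I.Node → N} {G : ℕ → N}
    (hG : ∀ v, p v → G (x.first v) = F v) :
    ((x.demands.filter fun d => x.isFirst d && q d).map G).sum =
      ∑ v ∈ Finset.univ.filter p, F v := by
  have hmem : ∀ v, x.isFirst (x.first v) = true := fun v => by
    rw [isFirst_iff, nodeOf_first]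
  rw [← List.sum_toFinset _ (by rw [demands_eq]; exact List.nodup_range.filter _)]
  symm
  refine Finset.sum_bij (fun v _ => (x.first v : ℕ)) ?_ ?_ ?_ fun v hv =>
    (hG v (Finset.mem_filter.1 hv).2).symm
  · intro v hv
    simp [demands_eq, hmem, hq, (Finset.mem_filter.1 hv).2]
  · intro u _ v _ e
    rw [← nodeOf_first u, Fin.ext e, nodeOf_first]
  · intro d hd
    simp only [demands_eq, List.mem_toFinset, List.mem_filter, List.mem_range,
      Bool.and_eq_true] at hd
    obtain ⟨hd, h1, h2⟩ := hd
    have h3 := (isFirst_iff ⟨d, hd⟩).1 h1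
    refine ⟨x.I.nodeOf ⟨d, hd⟩, Finset.mem_filter.2 ⟨Finset.mem_univ _, ?_⟩, by rw [h3]⟩
    rw [← hq, h3]; exact h2

/-- The colour class of a colour. -/
def colorClass (x : ColoredInstance) (i : Fin x.χ) : List Bool :=
  List.ofFn fun d => decide (x.c (x.I.nodeOf d) = i)

theorem getD_colorClass (i : Fin x.χ) (v : x.I.Node) :
    (x.colorClass i).getD (x.first v) false = true ↔ x.c v = i := by
  rw [colorClass, List.getD_ofFn, nodeOf_first, decide_eq_true_eq]

theorem classValue_colorClass (i : Fin x.χ) :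
    x.classValue (x.colorClass i) = x.I.colorValue x.c x.subSolution i := by
  rw [classValue, nodes, colorValue]
  exact sum_nodes (getD_colorClass i) fun v _ => (reward_subSolution v).symm

/-- The colour class of the selected colour. -/
def selected (x : ColoredInstance) : Option (Fin x.χ) → List Bool
  | none => []
  | some i => x.colorClass i

/-- The program remembers the list of the selected class where Algorithm B remembers the colour.
Both loops run in parallel, with `selected` relating their states. -/
theorem best_eq : x.best = ((x.I.bestColor x.c x.subSolution).1,
    x.selected (x.I.bestColor x.c x.subSolution).2) := by
  have h : x.tables.2 = (List.finRange x.χ).map x.colorClass := by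
    rw [← List.ofFn_eq_map, tables]; rfl
  have key : ∀ (l : List (Fin x.χ)) (b : ℤ × Option (Fin x.χ)),
      (l.map x.colorClass).foldl (fun b cl => bif decide (b.1 ≤ x.classValue cl) then
        (x.classValue cl, cl) else b) (b.1, x.selected b.2) =
      let e := l.foldl (fun best i => if best.1 ≤ x.I.colorValue x.c x.subSolution i then
        (x.I.colorValue x.c x.subSolution i, some i) else best) b
      (e.1, x.selected e.2) := by
    intro l
    induction l with
    | nil => intro b; rfl
    | cons a l ih =>
      intro b
      rw [List.map_cons, List.foldl_cons, List.foldl_cons, classValue_colorClass, Bool.cond_decide]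
      split_ifs with hb
      · exact ih (_, some a)
      · exact ih b
  rw [best, h]
  exact key _ (0, none)

theorem mem_nodes {cl : List Bool} {d : ℕ} : d ∈ x.nodes cl ↔
    ∃ v, (x.first v : ℕ) = d ∧ cl.getD d false = true := by
  simp only [nodes, demands_eq, List.mem_filter, List.mem_range, Bool.and_eq_true]
  constructor
  · rintro ⟨h1, h2, h3⟩
    exact ⟨_, congrArg Fin.val ((isFirst_iff ⟨d, h1⟩).1 h2), h3⟩
  · rintro ⟨v, rfl, h⟩
    exact ⟨(x.first v).2, by rw [isFirst_iff, nodeOf_first], h⟩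

theorem exists_val_of_elem {d j : ℕ} (h : x.elem d j = true) : ∃ i : Fin x.n, (i : ℕ) = j := by
  simp only [elem, Bool.and_eq_true, decide_eq_true_eq] at h
  exact ⟨⟨j, h.1⟩, rfl⟩

/-- Both sides give the same list of indices, and passing to indices is injective on lists. -/
theorem lift_val (v : x.I.Node) {l : List ℕ} (hl : ∀ j ∈ l, x.elem (x.first v) j = true) :
    (l.lift (x.idx v)).map Subtype.val = l.lift (Fin.val : Fin x.n → ℕ) := by
  apply (List.map_injective_iff.2 Fin.val_injective)
  rw [List.map_lift fun j hj => exists_val_of_elem (hl j hj), List.map_map]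
  exact List.map_lift fun j hj => exists_idx (hl j hj)

/-- The computed routes as lists of demands. -/
noncomputable def routeLists (x : ColoredInstance) (cl : List Bool) (r : Fin x.k) (s : Fin x.m) :
    List (List (Fin x.n)) := (x.outRoutes cl r s).map (List.lift Fin.val)

/-- The demands met as a list of demands. -/
noncomputable def metList (x : ColoredInstance) (cl : List Bool) : List (Fin x.n) :=
  (x.outMet cl).lift Fin.val

theorem paths_listSolution (hΔ : ∀ d, 0 ≤ x.I.Δ d) (hT : x.I.TriangleIneq) (i : Fin x.χ) :
    (fun r s => (x.routeLists (x.colorClass i) r s : Multiset (List (Fin x.n)))) =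
      (x.I.combine x.c x.subSolution i).paths := by
  funext r s
  rw [routeLists, outRoutes, List.coe_flatMap, nodes, List.filter_filter, combine]
  have hq : ∀ v : x.I.Node, (x.requests (x.first v) r &&
      (x.colorClass i).getD (x.first v) false) = true ↔ x.c v = i ∧ r ∈ v.1 := fun v => by
    rw [Bool.and_eq_true, getD_colorClass, requests_eq, decide_eq_true_eq, M_first, and_comm]
  have e : ∀ a, (x.requests a r && (x.isFirst a && (x.colorClass i).getD a false)) =
      (x.isFirst a && (x.requests a r && (x.colorClass i).getD a false)) := fun a => by
    rw [Bool.and_left_comm]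
  simp only [e]
  -- Here `sum_nodes` is applied in the additive monoid of multisets of routes.
  refine sum_nodes (p := fun v => x.c v = i ∧ r ∈ v.1) hq fun v _ => ?_
  rw [rep_eq, nodeOf_first, inS_eq, Bool.cond_decide]
  simp only [subSolution]
  split_ifs
  · rw [Multiset.map_coe, List.map_map]
    congr 1
    exact List.map_congr_left fun l hl => (lift_val v (elem_of_mem_routes hΔ hT hl)).symm
  · rfl

theorem mem_outMet {cl : List Bool} {j : ℕ} : j ∈ x.outMet cl ↔
    ∃ v, cl.getD (x.first v) false = true ∧ j ∈ x.met (x.first v) := by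
  rw [outMet, List.mem_flatMap]
  constructor
  · rintro ⟨d, hd, hj⟩
    obtain ⟨v, rfl, h⟩ := mem_nodes.1 hd
    exact ⟨v, h, hj⟩
  · rintro ⟨v, h, hj⟩
    exact ⟨_, mem_nodes.2 ⟨v, rfl, h⟩, hj⟩

theorem exists_val_of_mem_outMet {cl : List Bool} :
    ∀ j ∈ x.outMet cl, ∃ i : Fin x.n, (i : ℕ) = j := fun j hj => by
  obtain ⟨v, -, h⟩ := mem_outMet.1 hj
  exact exists_val_of_elem (mem_met.1 h).1

theorem met_listSolution (i : Fin x.χ) :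
    (x.metList (x.colorClass i)).toFinset = (x.I.combine x.c x.subSolution i).met := by
  ext d
  rw [List.mem_toFinset, metList, List.mem_lift Fin.val_injective exists_val_of_mem_outMet,
    mem_outMet, mem_combine_met]
  have h : ∀ (v : x.I.Node), ∀ j ∈ x.met (x.first v), ∃ d, x.idx v d = j := fun v j hj =>
    exists_idx (mem_met.1 hj).1
  constructor
  · rintro ⟨v, h1, h2⟩
    obtain ⟨⟨d', hd'⟩, e⟩ := h v _ h2
    obtain rfl : d' = d := Fin.ext e
    obtain rfl : x.I.nodeOf d' = v := Subtype.ext hd'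
    refine ⟨(getD_colorClass i _).1 h1, rfl, ?_⟩
    rw [subSolution, List.mem_toFinset, List.mem_lift (idx_injective _) (h _)]
    exact h2
  · rintro ⟨h1, h2, h3⟩
    rw [subSolution, List.mem_toFinset, List.mem_lift (idx_injective _) (h _)] at h3
    exact ⟨_, (getD_colorClass i _).2 h1, h3⟩

theorem isOutputB_best (hΔ : ∀ d, 0 ≤ x.I.Δ d) (hT : x.I.TriangleIneq) (hS : x.I.SameStart) :
    x.I.IsOutputB x.c x.best.1 (listSolution (x.routeLists x.best.2) (x.metList x.best.2)) := by
  refine ⟨x.subSolution, isOptimal_subSolution hΔ hT hS, by rw [best_eq], ?_⟩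
  rw [best_eq]
  dsimp only
  generalize (x.I.bestColor x.c x.subSolution).2 = o
  cases o with
  | none =>
    -- No demand lies in the empty class, since `getD` returns `false` there.
    have h : x.nodes [] = [] := List.filter_eq_nil_iff.2 fun d _ => by simp
    simp [listSolution, selected, routeLists, metList, outRoutes, outMet, h, List.lift]
  | some i =>
    simp only [listSolution, selected]
    rw [paths_listSolution hΔ hT i, met_listSolution]

theorem enc_output (hΔ : ∀ d, 0 ≤ x.I.Δ d) (hT : x.I.TriangleIneq) :
    Codable.enc x.output = encOut x.best.1 (x.routeLists x.best.2) (x.metList x.best.2) := by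
  have h1 : ∀ l : List ℕ, (∀ j ∈ l, ∃ i : Fin x.n, (i : ℕ) = j) →
      (l.lift (Fin.val : Fin x.n → ℕ)).map (fun d => (d.val : ℤ)) =
        l.map fun j : ℕ => (j : ℤ) := fun l hl => by
    conv_rhs => rw [← List.map_lift hl]
    rw [List.map_map]; rfl
  have h2 : ∀ r s, ∀ l ∈ x.outRoutes x.best.2 r s, ∀ j ∈ l, ∃ i : Fin x.n, (i : ℕ) = j := by
    intro r s l hl j hj
    obtain ⟨d, -, hd⟩ := List.mem_flatMap.1 hl
    cases e : x.inS (x.rep d) s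
    · rw [e] at hd; cases hd
    · rw [e] at hd
      exact exists_val_of_elem (elem_of_mem_routes hΔ hT hd j hj)
  have h3 : ∀ (r : Fin x.k) (s : Fin x.m), (x.routeLists x.best.2 r s).map (List.map fun d =>
      (d.val : ℤ)) = (x.outRoutes x.best.2 r s).map (List.map fun j : ℕ => (j : ℤ)) := fun r s => by
    rw [routeLists, List.map_map]
    exact List.map_congr_left fun l hl => h1 l (h2 r s l hl)
  rw [encOut, metList, h1 _ exists_val_of_mem_outMet]
  simp only [h3]
  rw [output, types_eq, locations_eq]
  simp only [List.map_range_eq_ofFn, Codable.enc, List.map_ofFn, Function.comp_def]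

end ColoredInstance

theorem mainTheorem7 :
    (∀ (n k m χ : ℕ) (I : MRMD (Fin n) (Fin k) (Fin m))
        (c : I.conflictGraph.Coloring (Fin χ)),
        (∀ d, 0 ≤ I.Δ d) → I.TriangleIneq → I.SameStart →
        ∀ (b : ℤ) (σ : Solution (Fin n) (Fin k) (Fin m)), I.IsOutputB c b σ →
          I.Feasible σ ∧ I.reward σ = b ∧ I.opt ≤ (χ : ℤ) * I.reward σ) ∧
    (∃ (prog : Prog inTy outTy) (q : Polynomial ℕ),
      ∀ (n k m χ : ℕ) (I : MRMD (Fin n) (Fin k) (Fin m))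
        (c : I.conflictGraph.Coloring (Fin χ)),
        (∀ d, 0 ≤ I.Δ d) → I.TriangleIneq → I.SameStart →
        ∃ (b : ℤ) (P : Fin k → Fin m → List (List (Fin n))) (Y : List (Fin n)) (t : ℕ),
          Runs prog (encIn I c) (encOut b P Y) t ∧
          I.IsOutputB c b (listSolution P Y) ∧
          t ≤ q.eval (inTy.size (encIn I c))) := by
  refine ⟨fun n k m χ I c hΔ hT hS b σ h => MRMD.isOutputB_spec hΔ hT hS h, ?_⟩
  obtain ⟨prog, T, ⟨q, hq⟩, hrun⟩ := ColoredInstance.polyTime_output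
  refine ⟨prog, q, fun n k m χ I c hΔ hT hS => ?_⟩
  let x : ColoredInstance := ⟨n, k, m, χ, I, c⟩
  obtain ⟨t, ht, hr⟩ := hrun x
  rw [ColoredInstance.enc_output (x := x) hΔ hT] at hr
  -- The size of `x` is by definition the size of `encIn I c`.
  exact ⟨_, _, _, t, hr, ColoredInstance.isOutputB_best (x := x) hΔ hT hS, ht.trans (hq x)⟩
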